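/- Let $\tau$ be a finite vocabulary of function and relation symbols, $\mathcal A$ a $\tau$-structure with finite nonempty domain $A$, $X$ a finite set of first-order variables, and $T$ a team in $\mathcal A$ with domain $X$, i.e. a set of assignments $s\colon X\to A$. All of these are fixed. Formulas of dependence logic $\mathsf D$ are built from $t_1=t_2$, $R(\mathbf t)$, $\neg R(\mathbf t)$ and dependence atoms $\mathord{=}(\mathbf t;\mathbf u)$ (for terms, respectively tuples of terms, over $\tau$) by $\wedge$, $\vee$, $\exists x$, $\forall x$. For a team $S$ with domain $Y$, put $S^x_f=\{s^x_a\mid s\in S,\ a\in f(s)\}$, where $s^x_a\colon Y\cup\{x\}\to A$ maps $x$ to $a$ and agrees with $s$ on $Y\setminus\{x\}$. Satisfaction $(\mathcal A,S)\models\Phi$ is defined as follows: $S$ satisfies a first-order literal iff every $s\in S$ does; $S$ satisfies $\mathord{=}(\mathbf t;\mathbf u)$ iff any two $s_1,s_2\in S$ that agree on the value of $\mathbf t$ agree on the value of $\mathbf u$; $S$ satisfies $\phi_0\wedge\phi_1$ iff it satisfies both $\phi_0$ and $\phi_1$; $S$ satisfies $\phi_0\vee\phi_1$ iff $S=S_0\cup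 S_1$ with $(\mathcal A,S_i)\models\phi_i$ for $i=0,1$; $S$ satisfies $\exists x\,\phi$ iff $(\mathcal A,S^x_f)\models\phi$ for some $f\colon S\to\mathcal P(A)\setminus\{\emptyset\}$; and $S$ satisfies $\forall x\,\phi$ iff $(\mathcal A,S^x_f)\models\phi$ for the constant function $f(s)=A$. Formulas are written as words over a finite alphabet, with variable indices in binary. A parameterized problem $P\subseteq\Sigma^*\times\mathbb N$ is in $\mathrm{FPT}$ if there are a deterministic Turing machine, a computable function $f\colon\mathbb N\to\mathbb N$ and a polynomial $p$ such that for all $(w,k)\in\Sigma^*\times\mathbb N$ the machine decides whether $(w,k)\in P$ in at most $f(k)\cdot p(|w|)$ steps. Let $\mathrm{Fr}(\Phi)$ denote the set of free variables of $\Phi$. Then: 1. The expression complexity of model checking for $\mathsf D$, parameterized by the total number of variables, is in $\mathrm{FPT}$. That is, the set of all pairs $(\Phi,k)$ such that $\Phi$ is a $\mathsf D$-formula with $\mathrm{Fr}(\Phi)\subseteq X$, exactly $k$ distinct variables (free or bound) occur in $\Phi$, and $(\mathcal A,T)\models\Phi$, is in $\mathrm{FPT}$. 2. For every $k\ge 1$,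 the expression complexity of the $k$-variable fragment $\mathsf D^k$ (the $\mathsf D$-formulas in which at most $k$ distinct variables occur) is in $\mathrm P$. That is, the set of all $\Phi\in\mathsf D^k$ with $\mathrm{Fr}(\Phi)\subseteq X$ and $(\mathcal A,T)\models\Phi$ is decidable in polynomial time. -/

import Mathlib

namespace DependenceLogic



/-! ### Formulas of dependence logic -/

/-- Formulas of dependence logic `D` in negation normal form over the vocabulary `L`, with
first-order variables `VAR = ℕ`. The terms are Mathlib's first-order terms, and the dependence
atom `dep t u` is `=(t; u)` for tuples of terms `t` and `u`. -/
inductive DFormula (L : FirstOrder.Language.{0, 0}) : Type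
  | eq (t₁ t₂ : L.Term ℕ)
  | rel {n : ℕ} (R : L.Relations n) (t : Fin n → L.Term ℕ)
  | nrel {n : ℕ} (R : L.Relations n) (t : Fin n → L.Term ℕ)
  | dep (t u : List (L.Term ℕ))
  | and (φ ψ : DFormula L)
  | or (φ ψ : DFormula L)
  | ex (x : ℕ) (φ : DFormula L)
  | all (x : ℕ) (φ : DFormula L)

/-- The set of the variables that occur in a tuple of terms. -/
def tupleVars {L : FirstOrder.Language.{0, 0}} (t : List (L.Term ℕ)) : Finset ℕ :=
  t.foldr (fun r V => r.varFinset ∪ V) ∅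

namespace DFormula

/-- The set `VAR(φ)` of all variables that occur in `φ`, be it free, bound, or only directly
behind a quantifier. -/
def vars {L : FirstOrder.Language.{0, 0}} : DFormula L → Finset ℕ
  | eq t₁ t₂ => t₁.varFinset ∪ t₂.varFinset
  | rel _ t => Finset.univ.biUnion fun i => (t i).varFinset
  | nrel _ t => Finset.univ.biUnion fun i => (t i).varFinset
  | dep t u => tupleVars t ∪ tupleVars u
  | and φ ψ => φ.vars ∪ ψ.vars
  | or φ ψ => φ.vars ∪ ψ.vars
  | ex x φ => insert x φ.vars
  | all x φ => insert x φ.vars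

/-- The set `Fr(φ)` of the free variables of `φ`. -/
def free {L : FirstOrder.Language.{0, 0}} : DFormula L → Finset ℕ
  | eq t₁ t₂ => t₁.varFinset ∪ t₂.varFinset
  | rel _ t => Finset.univ.biUnion fun i => (t i).varFinset
  | nrel _ t => Finset.univ.biUnion fun i => (t i).varFinset
  | dep t u => tupleVars t ∪ tupleVars u
  | and φ ψ => φ.free ∪ ψ.free
  | or φ ψ => φ.free ∪ ψ.free
  | ex x φ => φ.free.erase x
  | all x φ => φ.free.erase x

end DFormula

/-! ### Team semantics

A team in `A` with domain `X ⊆ VAR` is a set of assignments `X → A`. -/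

/-- The value of the term `t` under the assignment `s : X → A`. Formulas `φ` are only evaluated
in teams whose domain `X` contains `Fr(φ)`, so all variables of `t` lie in `X`; the value given
to a variable outside `X` is arbitrary and plays no role. -/
noncomputable def termVal {L : FirstOrder.Language.{0, 0}} {A : Type*} [L.Structure A] [Nonempty A]
    {X : Finset ℕ} (s : X → A) (t : L.Term ℕ) : A :=
  t.realize fun v => if h : v ∈ X then s ⟨v, h⟩ else Classical.arbitrary A

/-- The assignment `s^x_a : X ∪ {x} → A`, which maps `x` to `a` and agrees with `s` on
`X \ {x}`. -/
def updateAssignment {A : Type*} {X : Finset ℕ} (s : X → A) (x : ℕ) (a : A) :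
    ((insert x X : Finset ℕ) : Type) → A :=
  fun y => if h : y.1 = x then a else s ⟨y.1, Finset.mem_of_mem_insert_of_ne y.2 h⟩

/-- The supplemented team `T^x_f = { s^x_a | s ∈ T, a ∈ f(s) }`. -/
def supplement {A : Type*} {X : Finset ℕ} (T : Set (X → A)) (x : ℕ) (f : (X → A) → Set A) :
    Set (((insert x X : Finset ℕ) : Type) → A) :=
  { s' | ∃ s ∈ T, ∃ a ∈ f s, s' = updateAssignment s x a }

/-- `Sat φ X T` is `(A, T) ⊨ φ` for a team `T` in `A` with domain `X`. -/
def Sat {L : FirstOrder.Language.{0, 0}} {A : Type*} [L.Structure A] [Nonempty A] :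
    DFormula L → (X : Finset ℕ) → Set (X → A) → Prop
  | .eq t₁ t₂, _, T => ∀ s ∈ T, termVal s t₁ = termVal s t₂
  | .rel R t, _, T => ∀ s ∈ T, FirstOrder.Language.Structure.RelMap R fun i => termVal s (t i)
  | .nrel R t, _, T => ∀ s ∈ T, ¬ FirstOrder.Language.Structure.RelMap R fun i => termVal s (t i)
  | .dep t u, _, T => ∀ s₁ ∈ T, ∀ s₂ ∈ T,
      t.map (termVal s₁) = t.map (termVal s₂) → u.map (termVal s₁) = u.map (termVal s₂)
  | .and φ ψ, X, T => Sat φ X T ∧ Sat ψ X T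
  | .or φ ψ, X, T => ∃ T₀ T₁ : Set (X → A), T₀ ∪ T₁ = T ∧ Sat φ X T₀ ∧ Sat ψ X T₁
  | .ex x φ, X, T => ∃ f : (X → A) → Set A, (∀ s ∈ T, (f s).Nonempty) ∧
      Sat φ (insert x X) (supplement T x f)
  | .all x φ, X, T => Sat φ (insert x X) (supplement T x fun _ => Set.univ)

/-! ### Formulas as words -/

/-- The alphabet in which the formulas over `L` are written. It is finite if `L` has finitely
many symbols. -/
inductive Letter (L : FirstOrder.Language.{0, 0}) : Type
  | sym (s : L.Symbols)
  | var
  | bit (b : Bool)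
  | eq
  | neg
  | dep
  | semicolon
  | close
  | and
  | or
  | ex
  | all

open Letter in
/-- A variable is written as the letter `var` followed by its index in binary. -/
def encodeVar (L : FirstOrder.Language.{0, 0}) (x : ℕ) : List (Letter L) :=
  var :: (Computability.encodeNat x).map bit

/-- Terms are written in prefix (Polish) notation. -/
def encodeTerm {L : FirstOrder.Language.{0, 0}} : L.Term ℕ → List (Letter L)
  | .var x => encodeVar L x
  | .func (l := l) f t => .sym (.inl ⟨l, f⟩) :: (List.ofFn fun i => encodeTerm (t i)).flatten

/-- Formulas are written in prefix (Polish) notation; `=(t; u)` becomes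
`dep`, `t`, `semicolon`, `u`, `close`. -/
def encodeFormula {L : FirstOrder.Language.{0, 0}} : DFormula L → List (Letter L)
  | .eq t₁ t₂ => .eq :: (encodeTerm t₁ ++ encodeTerm t₂)
  | .rel (n := n) R t => .sym (.inr ⟨n, R⟩) :: (List.ofFn fun i => encodeTerm (t i)).flatten
  | .nrel (n := n) R t =>
      .neg :: .sym (.inr ⟨n, R⟩) :: (List.ofFn fun i => encodeTerm (t i)).flatten
  | .dep t u =>
      .dep :: ((t.map encodeTerm).flatten ++ .semicolon :: ((u.map encodeTerm).flatten ++ [.close]))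
  | .and φ ψ => .and :: (encodeFormula φ ++ encodeFormula ψ)
  | .or φ ψ => .or :: (encodeFormula φ ++ encodeFormula ψ)
  | .ex x φ => .ex :: (encodeVar L x ++ encodeFormula φ)
  | .all x φ => .all :: (encodeVar L x ++ encodeFormula φ)

/-! ### The decision problems -/

/-- The model checking problem with the structure `A` and the team `T` with domain `X` fixed,
parameterized by the total number of variables: the set of the pairs `(w, k)` such that `w` is a
formula `Φ` with `Fr(Φ) ⊆ X`, with exactly `k` variables, and with `(A, T) ⊨ Φ`. -/
def paramExprMC (L : FirstOrder.Language.{0, 0}) (A : Type*) [L.Structure A] [Nonempty A] (X : Finset ℕ)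
    (T : Set (X → A)) : Set (List (Letter L) × ℕ) :=
  { p | ∃ Φ : DFormula L, p.1 = encodeFormula Φ ∧ p.2 = Φ.vars.card ∧ Φ.free ⊆ X ∧ Sat Φ X T }

/-- The model checking problem for `D^k`, the formulas with at most `k` variables, with the
structure `A` and the team `T` with domain `X` fixed. -/
def exprMC (L : FirstOrder.Language.{0, 0}) (A : Type*) [L.Structure A] [Nonempty A] (X : Finset ℕ)
    (T : Set (X → A)) (k : ℕ) : Set (List (Letter L)) :=
  { w | ∃ Φ : DFormula L, w = encodeFormula Φ ∧ Φ.vars.card ≤ k ∧ Φ.free ⊆ X ∧ Sat Φ X T }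

/-! ### Complexity classes

The machines are Mathlib's multi-stack Turing machines `Turing.FinTM2`. A decision machine halts
with the single letter `true` or `false` on its output stack. -/

open Classical in
/-- The language `S` over the alphabet `Γ` is in `P`. -/
def InP {Γ : Type} (S : Set (List Γ)) : Prop :=
  Nonempty (Turing.TM2ComputableInPolyTime (fun w : List Γ => w) Computability.encodeBool
    fun w => decide (w ∈ S))

/-- An instance `(w, k)` of a parameterized problem as an input word: `w` followed by `k` in
unary, on a separate copy of letters. -/
def encodeInstance {Γ : Type} (w : List Γ) (k : ℕ) : List (Γ ⊕ Bool) :=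
  w.map Sum.inl ++ (Computability.unaryEncodeNat k).map Sum.inr

open Classical in
/-- The parameterized problem `P` over the alphabet `Γ` is in `FPT`: some deterministic machine
decides `(w, k) ∈ P` within `f(k) * p(|w|)` steps, for a computable function `f` and a
polynomial `p`. -/
def InFPT {Γ : Type} (P : Set (List Γ × ℕ)) : Prop :=
  ∃ (M : Turing.TM2ComputableAux (Γ ⊕ Bool) Bool) (f : ℕ → ℕ) (p : Polynomial ℕ),
    Computable f ∧ ∀ (w : List Γ) (k : ℕ),
      Nonempty (Turing.TM2OutputsInTime M.tm
        ((encodeInstance w k).map M.inputAlphabet.invFun)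
        (some ((Computability.encodeBool (decide ((w, k) ∈ P))).map M.outputAlphabet.invFun))
        (f k * p.eval w.length))

end DependenceLogic

/-!
An assignment of `m` slots with values in a fixed structure of size `a` is a number below `a ^ m`,
and a team of such assignments is a number below `2 ^ a ^ m`. Hence the set of all teams that
satisfy a formula with `m` variables is described by `2 ^ a ^ m` bits, which is a function of `m`
alone, and it can be computed from the sets for the immediate subformulas: satisfaction is
compositional. Together with a mask of the slots of the free variables this bit string is the *code*
of the formula. The code of a term is the table of its values under all assignments; the code of a
tuple in a dependence atom is the set of the pairs of assignments that disagree on it. Deciding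
whether a formula holds in the given team thus amounts to evaluating it bottom up, and every one of
the linearly many operations has a cost that depends on `m` only.

Since formulas are written in prefix notation, the bottom-up evaluation is carried out by reading
the word from right to left with a stack of codes. Variables are renamed into slots on the fly: the
variables of the given team have the first slots, and each new variable gets the next free one.
Supplementation by functions is replaced by cylinders over teams of slots, so that the domain of a
team does not change at quantifiers (`sat_iff_satS`).

The machine is built in layers. A structured language `StackProg` for stack machines is compiled to
multi-stack Turing machines (`exists_machine`); expressions `NExp` for primitive recursive functions
are compiled to this language (`does_compile`), and the operations on codes are such expressions.
The cost of an expression is primitive recursive in its arguments (`primrec_cost`), which makes the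
parameter-dependent factor of the running time computable. The correctness proof compares three
processes: the program (`exec_mainProg`), its abstract run on codes `confRun`, and a parser that
keeps syntactic objects instead of codes (`confRun_of_parse`). The parser succeeds precisely on the
encodings of formulas (`exists_parse_encodeFormula`, `eq_encodeFormula_of_parse`), and the codes it
corresponds to are correct by the lemmas on `RepTerm`, `RepTuple`, `RepDis` and `RepFml`. The
resulting decision procedure `exists_prog` makes at most `(n + 1) ^ 3 * g k` steps on words of
length `n` with at most `k` variables. With `k` as an input this is fixed-parameter tractability;
with `k` built into the program it is polynomial time.
-/

open Function (update)

namespace DependenceLogic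

/-! ### A structured language for stack machines -/

/-- Structured programs over a countable family of stacks with the alphabet `G` and one register
that holds an optional letter. -/
inductive StackProg (G : Type) : Type
  /-- Apply `f` to the register. -/
  | load (f : Option G → Option G)
  /-- Push a letter that depends on the register onto the stack `k`. -/
  | push (k : ℕ) (f : Option G → G)
  /-- Pop the stack `k` into the register; an empty stack gives `none`. -/
  | pop (k : ℕ)
  | seq (P Q : StackProg G)
  /-- Continue with the program that the register selects. -/
  | switch (F : Option G → StackProg G)
  /-- Repeat `P` as long as the register satisfies `p`. -/
  | loop (p : Option G → Bool) (P : StackProg G)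

namespace StackProg

variable {G : Type}

/-- The execution relation: `Exec P (v, S) (v', S') t` says that `P`, started with the register `v`
and the stacks `S`, ends with `v'` and `S'` after at most `t` steps. -/
inductive Exec : StackProg G → Option G × (ℕ → List G) → Option G × (ℕ → List G) → ℕ → Prop
  | load {f v S t} (ht : 1 ≤ t) : Exec (load f) (v, S) (f v, S) t
  | push {k f v S t} (ht : 1 ≤ t) : Exec (push k f) (v, S) (v, update S k (f v :: S k)) t
  | pop {k v S t} (ht : 1 ≤ t) : Exec (pop k) (v, S) ((S k).head?, update S k (S k).tail) t
  | seq {P Q s₀ s₁ s₂ t₁ t₂ t} (h₁ : Exec P s₀ s₁ t₁) (h₂ : Exec Q s₁ s₂ t₂) (ht : t₁ + t₂ ≤ t) :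
      Exec (seq P Q) s₀ s₂ t
  | switch {F v S s t₁ t} (h : Exec (F v) (v, S) s t₁) (ht : t₁ + 1 ≤ t) :
      Exec (switch F) (v, S) s t
  | loop_done {p P v S t} (hp : p v = false) (ht : 1 ≤ t) : Exec (loop p P) (v, S) (v, S) t
  | loop_step {p P v S s₁ s₂ t₁ t₂ t} (hp : p v = true) (h₁ : Exec P (v, S) s₁ t₁)
      (h₂ : Exec (loop p P) s₁ s₂ t₂) (ht : t₁ + t₂ + 1 ≤ t) : Exec (loop p P) (v, S) s₂ t

/-- The number of steps in `Exec` is an upper bound only. -/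
theorem Exec.mono {P : StackProg G} {s s' t t'} (h : Exec P s s' t) (ht : t ≤ t') :
    Exec P s s' t' := by
  cases h with
  | load h => exact .load (h.trans ht)
  | push h => exact .push (h.trans ht)
  | pop h => exact .pop (h.trans ht)
  | seq h₁ h₂ h => exact .seq h₁ h₂ (h.trans ht)
  | switch h₁ h => exact .switch h₁ (h.trans ht)
  | loop_done hp h => exact .loop_done hp (h.trans ht)
  | loop_step hp h₁ h₂ h => exact .loop_step hp h₁ h₂ (h.trans ht)

/-! ### Compilation to multi-stack Turing machines -/

/-- The labels of the machine code of a program. A switch and a loop have a label `none` of their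
own, at which the register is tested. -/
def Lab : StackProg G → Type
  | load _ => Unit
  | push _ _ => Unit
  | pop _ => Unit
  | seq P Q => P.Lab ⊕ Q.Lab
  | switch F => Option (Σ v, (F v).Lab)
  | loop _ P => Option P.Lab

/-- The label at which the machine code of a program starts. -/
def entry : (P : StackProg G) → P.Lab
  | load _ => ()
  | push _ _ => ()
  | pop _ => ()
  | seq P _ => .inl P.entry
  | switch _ => none
  | loop _ _ => none

theorem finite_lab [Finite G] : ∀ P : StackProg G, Finite P.Lab
  | load _ => inferInstanceAs (Finite Unit)
  | push _ _ => inferInstanceAs (Finite Unit)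
  | pop _ => inferInstanceAs (Finite Unit)
  | seq P Q =>
    have := finite_lab P
    have := finite_lab Q
    inferInstanceAs (Finite (P.Lab ⊕ Q.Lab))
  | switch F =>
    have := fun v => finite_lab (F v)
    inferInstanceAs (Finite (Option (Σ v, (F v).Lab)))
  | loop _ P =>
    have := finite_lab P
    inferInstanceAs (Finite (Option P.Lab))

/-- The program uses only the stacks below `N`. -/
def Below (N : ℕ) : StackProg G → Prop
  | load _ => True
  | push k _ => k < N
  | pop k => k < N
  | seq P Q => P.Below N ∧ Q.Below N
  | switch F => ∀ v, (F v).Below N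
  | loop _ P => P.Below N

theorem Below.mono {N N' : ℕ} (h : N ≤ N') : ∀ {P : StackProg G}, P.Below N → P.Below N'
  | load _, _ => trivial
  | push _ _, hP => lt_of_lt_of_le hP h
  | pop _, hP => lt_of_lt_of_le hP h
  | seq _ _, hP => ⟨hP.1.mono h, hP.2.mono h⟩
  | switch _, hP => fun v => (hP v).mono h
  | loop _ P, hP => Below.mono (P := P) h hP

theorem exists_below [Finite G] : ∀ P : StackProg G, ∃ N, P.Below N
  | load _ => ⟨0, trivial⟩
  | push k _ => ⟨k + 1, Nat.lt_succ_self k⟩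
  | pop k => ⟨k + 1, Nat.lt_succ_self k⟩
  | seq P Q =>
    have ⟨N, hN⟩ := exists_below P
    have ⟨N', hN'⟩ := exists_below Q
    ⟨max N N', hN.mono (le_max_left _ _), hN'.mono (le_max_right _ _)⟩
  | switch F => by
    choose N hN using fun v => exists_below (F v)
    obtain ⟨M, hM⟩ := (Set.finite_range N).bddAbove
    exact ⟨M, fun v => (hN v).mono (hM ⟨v, rfl⟩)⟩
  | loop _ P => exists_below P

/-- The alphabets of the stacks of the compiled machine: the input stack `none`, the output stack
`some none`, and `N` stacks of the program. -/
abbrev StkAlphabet (I G : Type) (N : ℕ) : Option (Option (Fin N)) → Type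
  | none => I
  | some none => Bool
  | some (some _) => G

/-- The stacks of the compiled machine, given the input, the output, and the stacks of the
program. -/
def mkStk {I : Type} (N : ℕ) (x : List I) (y : List Bool) (S : ℕ → List G) :
    ∀ k, List (StkAlphabet I G N k)
  | none => x
  | some none => y
  | some (some i) => S i

theorem update_mkStk {I : Type} {N : ℕ} (x : List I) (y : List Bool) (S : ℕ → List G) {k : ℕ}
    (hk : k < N) (l : List G) :
    update (mkStk N x y S) (some (some ⟨k, hk⟩)) l = mkStk N x y (update S k l) := by
  funext i
  match i with
  | none => rfl
  | some none => rfl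
  | some (some i) =>
    by_cases h : i = ⟨k, hk⟩
    · subst h; simp [mkStk]
    · have h' : (i : ℕ) ≠ k := fun h' => h (Fin.ext h')
      rw [Function.update_of_ne (by simpa using h)]
      simp [mkStk, Function.update_of_ne h']

theorem update_mkStk_in {I : Type} {N : ℕ} (x x' : List I) (y : List Bool) (S : ℕ → List G) :
    update (mkStk N x y S) none x' = mkStk N x' y S := by
  funext i
  match i with
  | none => simp [mkStk]
  | some none => simp [mkStk]
  | some (some i) => simp [mkStk]

theorem update_mkStk_out {I : Type} {N : ℕ} (x : List I) (y y' : List Bool) (S : ℕ → List G) :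
    update (mkStk N x y S) (some none) y' = mkStk N x y' S := by
  funext i
  match i with
  | none => simp [mkStk]
  | some none => simp [mkStk]
  | some (some i) => simp [mkStk]

/-- The machine code of a program, with its labels embedded into `Λ` by `e` and with the exit
label `x`. Stacks from `N` on do not exist in the machine; instructions for them are void, and
programs are run only with an `N` such that `P.Below N`. -/
def code (I : Type) (N : ℕ) {Λ : Type} :
    (P : StackProg G) → (P.Lab → Λ) → Λ → P.Lab → Turing.TM2.Stmt (StkAlphabet I G N) Λ (Option G)
  | load f, _, x, _ => .load f (.goto fun _ => x)
  | push k f, _, x, _ =>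
    if h : k < N then .push (some (some ⟨k, h⟩)) f (.goto fun _ => x) else .goto fun _ => x
  | pop k, _, x, _ =>
    if h : k < N then .pop (some (some ⟨k, h⟩)) (fun _ a => a) (.goto fun _ => x)
    else .goto fun _ => x
  | seq P Q, e, _, .inl l => code I N P (fun l => e (.inl l)) (e (.inr Q.entry)) l
  | seq _ Q, e, x, .inr l => code I N Q (fun l => e (.inr l)) x l
  | switch F, e, _, none => .goto fun v => e (some ⟨v, (F v).entry⟩)
  | switch F, e, x, some ⟨v, l⟩ => code I N (F v) (fun l => e (some ⟨v, l⟩)) x l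
  | loop p P, e, x, none => .goto fun v => cond (p v) (e (some P.entry)) x
  | loop _ P, e, _, some l => code I N P (fun l => e (some l)) (e none) l

/-- `Steps f n c c'` says that `n` steps lead from `c` to `c'`. -/
def Steps {C : Type} (f : C → Option C) (n : ℕ) (c c' : C) : Prop :=
  (flip bind f)^[n] (some c) = some c'

theorem Steps.trans {C : Type} {f : C → Option C} {m n : ℕ} {c₀ c₁ c₂ : C} (h₁ : Steps f m c₀ c₁)
    (h₂ : Steps f n c₁ c₂) : Steps f (m + n) c₀ c₂ := by
  unfold Steps at *
  rw [Nat.add_comm, Function.iterate_add_apply, h₁, h₂]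

theorem Steps.one {C : Type} {f : C → Option C} {c c' : C} (h : f c = some c') :
    Steps f 1 c c' := h

/-- The machine code of a program simulates it step by step. -/
theorem Exec.steps {I : Type} {N : ℕ} {Λ : Type} {M : Λ → Turing.TM2.Stmt (StkAlphabet I G N) Λ (Option G)}
    (a : List I) (b : List Bool) {P : StackProg G} {s s' : Option G × (ℕ → List G)} {t : ℕ}
    (h : Exec P s s' t) :
    ∀ (e : P.Lab → Λ) (x : Λ), (∀ l, M (e l) = code I N P e x l) → P.Below N →
      ∃ j ≤ t, Steps (Turing.TM2.step M) j ⟨some (e P.entry), s.1, mkStk N a b s.2⟩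
        ⟨some x, s'.1, mkStk N a b s'.2⟩ := by
  induction h with
  | load ht =>
    intro e x hM _
    refine ⟨1, ht, .one ?_⟩
    simp [Turing.TM2.step, hM, code]
  | @push k f v S t ht =>
    intro e x hM (hk : k < N)
    refine ⟨1, ht, .one ?_⟩
    simp only [Turing.TM2.step, hM, code, dif_pos hk, Turing.TM2.stepAux]
    rw [update_mkStk]
    rfl
  | @pop k v S t ht =>
    intro e x hM (hk : k < N)
    refine ⟨1, ht, .one ?_⟩
    simp only [Turing.TM2.step, hM, code, dif_pos hk, Turing.TM2.stepAux]
    rw [update_mkStk]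
    rfl
  | @seq P Q s₀ s₁ s₂ t₁ t₂ t h₁ h₂ ht ih₁ ih₂ =>
    intro e x hM hN
    obtain ⟨j₁, hj₁, hs₁⟩ := ih₁ (fun l => e (.inl l)) (e (.inr Q.entry)) (fun l => hM (.inl l)) hN.1
    obtain ⟨j₂, hj₂, hs₂⟩ := ih₂ (fun l => e (.inr l)) x (fun l => hM (.inr l)) hN.2
    exact ⟨j₁ + j₂, by omega, hs₁.trans hs₂⟩
  | @switch F v S s t₁ t h ht ih =>
    intro e x hM hN
    obtain ⟨j, hj, hs⟩ := ih (fun l => e (some ⟨v, l⟩)) x (fun l => hM (some ⟨v, l⟩)) (hN v)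
    refine ⟨1 + j, by omega, Steps.trans (.one ?_) hs⟩
    have := hM none
    simp only [entry, Turing.TM2.step, code] at this ⊢
    rw [this]
    rfl
  | @loop_done p P v S t hp ht =>
    intro e x hM _
    refine ⟨1, ht, .one ?_⟩
    have := hM none
    simp only [entry, Turing.TM2.step, code] at this ⊢
    rw [this]
    simp [hp]
  | @loop_step p P v S s₁ s₂ t₁ t₂ t hp h₁ h₂ ht ih₁ ih₂ =>
    intro e x hM hN
    obtain ⟨j₁, hj₁, hs₁⟩ := ih₁ (fun l => e (some l)) (e none) (fun l => hM (some l)) hN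
    obtain ⟨j₂, hj₂, hs₂⟩ := ih₂ e x hM hN
    refine ⟨1 + j₁ + j₂, by omega, Steps.trans (Steps.trans (.one ?_) hs₁) hs₂⟩
    have := hM none
    simp only [entry, Turing.TM2.step, code] at this ⊢
    rw [this]
    simp [hp]

/-- The code of the whole machine that runs a program: at the label `none` the input is moved onto
the stack `0` of the program, and at the label `some none` the answer is written. -/
def machineCode {I : Type} (ι : I → G) (g₀ : G) (N : ℕ) (P : StackProg G) :
    Option (Option P.Lab) →
      Turing.TM2.Stmt (StkAlphabet I G (N + 1)) (Option (Option P.Lab)) (Option G)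
  | none => .pop (none : Option (Option (Fin (N + 1)))) (fun _ a => Option.map ι a)
      (.branch Option.isSome
        (.push (some (some 0) : Option (Option (Fin (N + 1)))) (fun v => v.elim g₀ id)
          (.goto fun _ => none))
        (.goto fun _ => some (some P.entry)))
  | some none => .push (some none : Option (Option (Fin (N + 1)))) Option.isSome
      (.load (fun _ => none) .halt)
  | some (some l) => code I (N + 1) P (fun l => some (some l)) (some none) l

/-- Reading the input reverses it, as the letters are pushed one after the other. -/
theorem machineCode_read {I : Type} (ι : I → G) (g₀ : G) (N : ℕ) (P : StackProg G) (a : List I) :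
    ∀ (v : Option G) (S : ℕ → List G),
    Steps (Turing.TM2.step (machineCode ι g₀ N P)) (a.length + 1)
      ⟨some none, v, mkStk (N + 1) a [] S⟩
      ⟨some (some (some P.entry)), none,
        mkStk (N + 1) [] [] (update S 0 ((a.map ι).reverse ++ S 0))⟩ := by
  induction a with
  | nil =>
    intro v S
    refine .one ?_
    simp only [Turing.TM2.step, machineCode, Turing.TM2.stepAux]
    have := update_mkStk_in (N := N + 1) ([] : List I) [] [] S
    simp [mkStk] at this ⊢
  | cons i a ih =>
    intro v S
    have h := ih (some (ι i)) (update S 0 (ι i :: S 0))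
    rw [List.length_cons, Nat.add_comm (a.length + 1) 1]
    refine Steps.trans (.one ?_) (by simpa using h)
    simp only [Turing.TM2.step, machineCode, Turing.TM2.stepAux]
    have h1 := update_mkStk_in (N := N + 1) (i :: a) a [] S
    have h2 := update_mkStk (N := N + 1) a [] S (Nat.succ_pos N) (ι i :: S 0)
    simp only [mkStk, List.head?_cons, Option.map_some, Option.isSome_some, cond_true, List.tail_cons,
      Option.elim_some, id]
    rw [h1, ← h2]
    rfl

/-- A program that ends with empty stacks decides, as a Turing machine, whether its register is
finally filled. -/
theorem exists_machine {I : Type} [Finite I] [Finite G] (ι : I → G) (P : StackProg G) :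
    ∃ M : Turing.TM2ComputableAux I Bool, ∀ (a : List I) (v : Option G) (t : ℕ),
      Exec P (none, update (fun _ => []) 0 (a.map ι).reverse) (v, fun _ => []) t →
      Nonempty (Turing.TM2OutputsInTime M.tm (a.map M.inputAlphabet.invFun)
        (some ((Computability.encodeBool v.isSome).map M.outputAlphabet.invFun))
        (t + a.length + 2)) := by
  classical
  rcases isEmpty_or_nonempty G with hG | ⟨⟨g₀⟩⟩
  · -- without letters there is nothing to read, and the register is always empty
    have hI : IsEmpty I := ⟨fun i => hG.false (ι i)⟩
    let := Fintype.ofFinite I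
    refine ⟨{ tm := { K := Bool, k₀ := false, k₁ := true, Γ := fun b => cond b Bool I, Λ := Unit,
                      main := (), σ := Unit, initialState := (),
                      Γk₀Fin := inferInstanceAs (Fintype I),
                      m := fun _ => .push true (fun _ => false) .halt },
              inputAlphabet := Equiv.refl _, outputAlphabet := Equiv.refl _ }, fun a v t _ => ?_⟩
    have ha : a = [] := List.eq_nil_of_length_eq_zero (by
      cases a with
      | nil => rfl
      | cons i _ => exact hI.elim i)
    have hv : v = none := by
      cases v with
      | none => rfl
      | some g => exact hG.elim g
    subst ha hv
    refine ⟨⟨⟨1, ?_⟩, by simp⟩⟩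
    change some _ = some _
    congr 1
    simp only [Turing.haltList, Turing.TM2.stepAux]
    congr 1
    funext k
    cases k <;> simp [Computability.encodeBool]
  -- the machine has one stack more than the program needs, so that there is a stack `0`
  obtain ⟨N, hN⟩ := exists_below P
  have := finite_lab P
  let := Fintype.ofFinite P.Lab
  let := Fintype.ofFinite I
  let := Fintype.ofFinite G
  refine ⟨{ tm := { K := Option (Option (Fin (N + 1))), k₀ := none, k₁ := some none,
                    Γ := StkAlphabet I G (N + 1), Λ := Option (Option P.Lab), main := none,
                    σ := Option G, initialState := none, Γk₀Fin := inferInstanceAs (Fintype I),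
                    m := machineCode ι g₀ N P },
            inputAlphabet := Equiv.refl _, outputAlphabet := Equiv.refl _ }, fun a v t h => ?_⟩
  obtain ⟨j, hj, hs⟩ := h.steps (M := machineCode ι g₀ N P) ([] : List I) []
    (fun l => some (some l)) (some none) (fun _ => rfl) (hN.mono (Nat.le_succ N))
  have h0 := (machineCode_read ι g₀ N P a none fun _ => []).trans (by simpa using hs)
  have h1 := h0.trans (n := 1) (c₂ := ⟨none, none, mkStk (N + 1) [] [v.isSome] fun _ => []⟩) (.one (by
    simp only [Turing.TM2.step, machineCode, Turing.TM2.stepAux]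
    have := update_mkStk_out (N := N + 1) ([] : List I) [] [v.isSome] (fun _ => ([] : List G))
    rw [← this]
    rfl))
  refine ⟨⟨⟨_, ?_⟩, show a.length + 1 + j + 1 ≤ _ by omega⟩⟩
  refine Eq.trans (Eq.trans ?_ h1) ?_
  · congr 2
    simp only [Turing.initList]
    congr 1
    funext k
    match k with
    | none => simp [mkStk]
    | some none => simp [mkStk]
    | some (some i) => simp [mkStk]
  · simp only [Option.map_some, Turing.haltList]
    congr 2
    funext k
    match k with
    | none => simp [mkStk]
    | some none => simp [mkStk, Computability.encodeBool]
    | some (some i) => simp [mkStk]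

/-! ### Basic stack programs -/

/-- `Does P S S' t`: started with the stacks `S` and any register, `P` ends with the stacks `S'`
after at most `t` steps. -/
def Does (P : StackProg G) (S S' : ℕ → List G) (t : ℕ) : Prop :=
  ∀ v, ∃ v', Exec P (v, S) (v', S') t

theorem Does.mono {P : StackProg G} {S S' t t'} (h : Does P S S' t) (ht : t ≤ t') :
    Does P S S' t' := fun v =>
  have ⟨v', h'⟩ := h v
  ⟨v', h'.mono ht⟩

theorem Does.seq {P Q : StackProg G} {S₀ S₁ S₂ t₁ t₂ t} (h₁ : Does P S₀ S₁ t₁)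
    (h₂ : Does Q S₁ S₂ t₂) (ht : t₁ + t₂ ≤ t) : Does (.seq P Q) S₀ S₂ t := fun v =>
  have ⟨v₁, h₁⟩ := h₁ v
  have ⟨v₂, h₂⟩ := h₂ v₁
  ⟨v₂, .seq h₁ h₂ ht⟩

theorem Exec.does_seq {P Q : StackProg G} {v₀ v₁ S₀ S₁ S₂ t₁ t₂ t}
    (h₁ : Exec P (v₀, S₀) (v₁, S₁) t₁) (h₂ : Does Q S₁ S₂ t₂) (ht : t₁ + t₂ ≤ t) :
    ∃ v, Exec (.seq P Q) (v₀, S₀) (v, S₂) t :=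
  have ⟨v₂, h₂⟩ := h₂ v₁
  ⟨v₂, .seq h₁ h₂ ht⟩

theorem Does.exec_seq {P Q : StackProg G} {v₂ S₀ S₁ S₂ t₁ t₂ t} (h₁ : Does P S₀ S₁ t₁)
    (h₂ : ∀ v, Exec Q (v, S₁) (v₂, S₂) t₂) (ht : t₁ + t₂ ≤ t) (v : Option G) :
    Exec (.seq P Q) (v, S₀) (v₂, S₂) t :=
  have ⟨v₁, h₁⟩ := h₁ v
  .seq h₁ (h₂ v₁) ht

theorem does_push (k : ℕ) (g : G) (S : ℕ → List G) {t : ℕ} (ht : 1 ≤ t) :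
    Does (.push k fun _ => g) S (update S k (g :: S k)) t := fun v => ⟨v, .push ht⟩

theorem exec_pop {k : ℕ} {v' : Option G} {S S' : ℕ → List G} {t : ℕ} (hv' : v' = (S k).head?)
    (hS' : S' = update S k (S k).tail) (ht : 1 ≤ t) (v : Option G) :
    Exec (.pop k) (v, S) (v', S') t := by
  subst hv' hS'
  exact .pop ht

/-- The program that does nothing. -/
def skip : StackProg G := load id

theorem does_skip (S : ℕ → List G) {t : ℕ} (ht : 1 ≤ t) : Does skip S S t := fun v => ⟨v, .load ht⟩

/-- Pop the stack `i` as long as `p` holds. -/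
def dropWhile (p : Option G → Bool) (i : ℕ) : StackProg G := .seq (.pop i) (.loop p (.pop i))

/-- Empty the stack `i`. -/
def clear (i : ℕ) : StackProg G := dropWhile Option.isSome i

/-- Move letters from the stack `i` to the stack `j` as long as `p` holds. -/
def moveWhile (g : G) (p : Option G → Bool) (i j : ℕ) : StackProg G :=
  .seq (.pop i) (.loop p (.seq (.push j fun v => v.getD g) (.pop i)))

/-- Move the stack `i` in reverse order onto the stack `j`. -/
def move (g : G) (i j : ℕ) : StackProg G := moveWhile g Option.isSome i j

/-- Move the stack `i` in reverse order onto both the stacks `j` and `k`. -/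
def fork (g : G) (i j k : ℕ) : StackProg G :=
  .seq (.pop i) (.loop Option.isSome
    (.seq (.push j fun v => v.getD g) (.seq (.push k fun v => v.getD g) (.pop i))))

theorem exec_clear {i : ℕ} {S S' : ℕ → List G} {t : ℕ} (hS' : S' = update S i [])
    (ht : 2 * (S i).length + 2 ≤ t) (v : Option G) : Exec (clear i) (v, S) (none, S') t := by
  subst hS'
  have key : ∀ (l : List G) (t : ℕ) (S : ℕ → List G), S i = l.tail → 2 * l.length + 1 ≤ t →
      Exec (.loop Option.isSome (.pop i)) (l.head?, S) (none, update S i []) t := by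
    intro l
    induction l with
    | nil =>
      intro t S hS ht
      rw [Function.update_eq_self_iff.2 (by simpa using hS.symm)]
      exact .loop_done rfl (by simpa using ht)
    | cons g l ih =>
      intro t S hS ht
      simp only [List.length_cons, List.tail_cons] at ht hS
      refine .loop_step (t₁ := 1) (t₂ := t - 2) rfl (.pop le_rfl) ?_ (by omega)
      have := ih (t - 2) (update S i l.tail) (by simp) (by omega)
      simpa [hS] using this
  refine .seq (t₁ := 1) (t₂ := t - 1) (.pop le_rfl) ?_ (by omega)
  have := key (S i) (t - 1) (update S i (S i).tail) (by simp) (by omega)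
  simpa using this

theorem does_clear {i : ℕ} {S S' : ℕ → List G} {t : ℕ} (hS' : S' = update S i [])
    (ht : 2 * (S i).length + 2 ≤ t) : Does (clear i) S S' t := fun v => ⟨_, exec_clear hS' ht v⟩

theorem exec_moveWhile {g : G} {p : Option G → Bool} {i j : ℕ} (hij : i ≠ j) {S S' : ℕ → List G}
    {l r : List G} {t : ℕ} (hS : S i = l ++ r) (hl : ∀ x ∈ l, p (some x) = true)
    (hr : p r.head? = false) (hS' : S' = update (update S i r.tail) j (l.reverse ++ S j))
    (ht : 3 * l.length + 2 ≤ t) (v : Option G) :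
    Exec (moveWhile g p i j) (v, S) (r.head?, S') t := by
  subst hS'
  have key : ∀ (l : List G) (t : ℕ) (S : ℕ → List G), S i = (l ++ r).tail →
      (∀ x ∈ l, p (some x) = true) → 3 * l.length + 1 ≤ t →
      Exec (.loop p (.seq (.push j fun v => v.getD g) (.pop i))) ((l ++ r).head?, S)
        (r.head?, update (update S i r.tail) j (l.reverse ++ S j)) t := by
    intro l
    induction l with
    | nil =>
      intro t S hS _ ht
      simp only [List.nil_append] at hS
      rw [← hS]
      simp only [List.reverse_nil, List.nil_append, Function.update_eq_self]
      exact .loop_done hr (by simpa using ht)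
    | cons x l ih =>
      intro t S hS hl ht
      simp only [List.length_cons, List.cons_append, List.tail_cons] at ht hS
      refine .loop_step (t₁ := 2) (t₂ := t - 3) (hl x (by simp))
        (.seq (.push le_rfl) (.pop le_rfl) le_rfl) ?_ (by omega)
      have := ih (t - 3) (update (update S j (x :: S j)) i (l ++ r).tail) (by simp)
        (fun y hy => hl y (by simp [hy])) (by omega)
      simp only [List.cons_append, List.head?_cons, Option.getD_some,
        Function.update_of_ne hij, hS]
      convert this using 2
      funext k
      simp only [Function.update_apply]
      split_ifs <;> simp_all
  refine .seq (t₁ := 1) (t₂ := t - 1) (.pop le_rfl) ?_ (by omega)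
  have := key l (t - 1) (update S i (l ++ r).tail) (by simp) hl (by omega)
  simpa [hS, Function.update_of_ne hij.symm] using this

theorem exec_move {g : G} {i j : ℕ} (hij : i ≠ j) {S S' : ℕ → List G} {l : List G} {t : ℕ}
    (hS : S i = l) (hS' : S' = update (update S i []) j (l.reverse ++ S j))
    (ht : 3 * l.length + 2 ≤ t) (v : Option G) : Exec (move g i j) (v, S) (none, S') t :=
  exec_moveWhile (l := l) (r := []) hij (by simpa using hS) (fun _ _ => rfl) rfl hS' ht v

theorem does_move {g : G} {i j : ℕ} (hij : i ≠ j) {S S' : ℕ → List G} {l : List G} {t : ℕ}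
    (hS : S i = l) (hS' : S' = update (update S i []) j (l.reverse ++ S j))
    (ht : 3 * l.length + 2 ≤ t) : Does (move g i j) S S' t :=
  fun v => ⟨_, exec_move hij hS hS' ht v⟩

theorem does_fork {g : G} {i j k : ℕ} (hij : i ≠ j) (hik : i ≠ k) (hjk : j ≠ k)
    {S S' : ℕ → List G} {l : List G} {t : ℕ} (hS : S i = l)
    (hS' : S' = update (update (update S i []) j (l.reverse ++ S j)) k (l.reverse ++ S k))
    (ht : 4 * l.length + 2 ≤ t) : Does (fork g i j k) S S' t := by
  subst hS'
  have key : ∀ (l : List G) (t : ℕ) (S : ℕ → List G), S i = l.tail → 4 * l.length + 1 ≤ t →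
      Exec (.loop Option.isSome (.seq (.push j fun v => v.getD g)
        (.seq (.push k fun v => v.getD g) (.pop i)))) (l.head?, S)
        (none, update (update (update S i []) j (l.reverse ++ S j)) k (l.reverse ++ S k)) t := by
    intro l
    induction l with
    | nil =>
      intro t S hS ht
      have : update S i [] = S := Function.update_eq_self_iff.2 (by simpa using hS.symm)
      simp only [this, List.reverse_nil, List.nil_append, Function.update_eq_self]
      exact .loop_done rfl (by simpa using ht)
    | cons x l ih =>
      intro t S hS ht
      simp only [List.length_cons, List.tail_cons] at ht hS
      refine .loop_step (t₁ := 3) (t₂ := t - 4) rfl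
        (.seq (.push le_rfl) (.seq (t₁ := 1) (t₂ := 1) (.push le_rfl) (.pop le_rfl) le_rfl) le_rfl)
        ?_ (by omega)
      have := ih (t - 4) (update (update (update S j (x :: S j)) k (x :: S k)) i l.tail) (by simp)
        (by omega)
      simp only [List.head?_cons, Option.getD_some, Function.update_of_ne hij,
        Function.update_of_ne hik, Function.update_of_ne hjk.symm, hS]
      convert this using 2
      funext k
      simp only [Function.update_apply]
      split_ifs <;> simp_all
  intro v
  refine ⟨none, .seq (t₁ := 1) (t₂ := t - 1) (.pop le_rfl) ?_ (by omega)⟩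
  have := key (S i) (t - 1) (update S i (S i).tail) (by simp) (by rw [hS]; omega)
  simpa [hS, Function.update_of_ne hij.symm, Function.update_of_ne hik.symm] using this

end StackProg

/-! ### Arithmetic expressions -/

/-- Expressions for the primitive recursive functions, with de Bruijn variables. The expression
`natRec n b s` is the value at `n` of the function with the initial value `b` and the step `s`, in
which variable `0` is the argument and variable `1` is the preceding value. -/
inductive NExp : Type
  | zero
  | succ (e : NExp)
  | var (i : ℕ)
  | natRec (n b s : NExp)

namespace NExp

/-- The value of an expression in an environment; a variable without a value is `0`. -/
def eval : NExp → List ℕ → ℕ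
  | zero, _ => 0
  | succ e, l => e.eval l + 1
  | var i, l => l.getD i 0
  | natRec n b s, l => Nat.rec (b.eval l) (fun y z => s.eval (y :: z :: l)) (n.eval l)

/-- The value of `natRec` after `y` rounds. -/
def recVal (b s : NExp) (l : List ℕ) (y : ℕ) : ℕ :=
  Nat.rec (b.eval l) (fun y z => s.eval (y :: z :: l)) y

/-- A bound for the number of steps in which the compiled expression is evaluated. The recursion
pays in each round for the step itself, for discarding the preceding value, and for moving the new
value to its place. -/
def cost : NExp → List ℕ → ℕ
  | zero, _ => 1
  | succ e, l => e.cost l + 1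
  | var i, l => 7 * l.getD i 0 + 4
  | natRec n b s, l =>
    n.cost l + b.cost l +
      (Nat.rec 0 (fun y c => c + (s.cost (y :: recVal b s l y :: l) + 2 * recVal b s l y +
        3 * recVal b s l (y + 1) + 7)) (n.eval l) : ℕ) + 2 * n.eval l +
      3 * recVal b s l (n.eval l) + 6

variable {G : Type}

open StackProg

/-- The unary representation of a number. -/
def num (g : G) (n : ℕ) : List G := List.replicate n g

theorem num_succ (g : G) (n : ℕ) : num g (n + 1) = g :: num g n := rfl

@[simp] theorem num_zero (g : G) : num g 0 = [] := rfl

@[simp] theorem length_num (g : G) (n : ℕ) : (num g n).length = n := by simp [num]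

@[simp] theorem reverse_num (g : G) (n : ℕ) : (num g n).reverse = num g n := by simp [num]

/-- Evaluate an expression: the values of the variables are the stacks listed in `ρ`, in unary; the
result is written to the empty stack `out`; the stacks from `b` on are free. In the recursion the
stack `b` counts down the remaining rounds, `b + 1` holds the argument, `b + 2` the current value,
and `b + 3` receives the next one. -/
def compile (g : G) : NExp → List ℕ → ℕ → ℕ → StackProg G
  | zero, _, _, _ => skip
  | succ e, ρ, out, b => .seq (compile g e ρ out b) (.push out fun _ => g)
  | var i, ρ, out, b =>
    match ρ[i]? with
    | none => skip
    | some r => .seq (move g r b) (fork g b r out)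
  | natRec n e s, ρ, out, b =>
    .seq (compile g n ρ b (b + 1)) <| .seq (compile g e ρ (b + 2) (b + 3)) <|
      .seq (.pop b) <| .seq
        (.loop Option.isSome <|
          .seq (compile g s ((b + 1) :: (b + 2) :: ρ) (b + 3) (b + 4)) <|
          .seq (clear (b + 2)) <| .seq (move g (b + 3) (b + 2)) <|
          .seq (.push (b + 1) fun _ => g) (.pop b)) <|
      .seq (clear (b + 1)) (move g (b + 2) out)

/-- The compiled expression writes its value to `out`, changes no other stack, and obeys the cost
bound. -/
theorem does_compile (g : G) : ∀ (e : NExp) (ρ l : List ℕ) (out b : ℕ) (S : ℕ → List G),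
    List.Forall₂ (fun r x => r < b ∧ r ≠ out ∧ S r = num g x) ρ l → out < b → S out = [] →
    (∀ j, b ≤ j → S j = []) →
    Does (compile g e ρ out b) S (update S out (num g (e.eval l))) (e.cost l)
  | zero, ρ, l, out, b, S, _, _, hout, _ => by
    have : update S out (num g (zero.eval l)) = S := by simp [eval, hout]
    rw [this]
    exact does_skip S le_rfl
  | succ e, ρ, l, out, b, S, hρ, hb, hout, hS => by
    refine (does_compile g e ρ l out b S hρ hb hout hS).seq (does_push out g _ le_rfl) le_rfl |>.mono
      le_rfl |> fun h => ?_
    rw [compile, cost]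
    simpa [eval, num_succ] using h
  | var i, ρ, l, out, b, S, hρ, hb, hout, hS => by
    rcases h : ρ[i]? with _ | r
    · have hl : l[i]? = none := by
        rw [List.getElem?_eq_none_iff] at h ⊢
        rwa [← hρ.length_eq]
      have : update S out (num g ((var i).eval l)) = S := by
        simp [eval, hout, List.getD_eq_getElem?_getD, hl]
      rw [this, compile, h]
      exact does_skip S (by simp [cost])
    · obtain ⟨hi, hr⟩ := List.getElem?_eq_some_iff.1 h
      have hi' : i < l.length := hρ.length_eq ▸ hi
      obtain ⟨h1, h2, h3⟩ := hρ.get hi hi'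
      simp only [List.get_eq_getElem, hr] at h1 h2 h3
      have hx : l.getD i 0 = l[i] := by simp [List.getD_eq_getElem?_getD, hi']
      rw [compile, h]
      simp only [eval, cost, hx]
      refine Does.seq (t₁ := 3 * l[i] + 2) (t₂ := 4 * l[i] + 2) (does_move h1.ne h3 rfl (by simp))
        (does_fork h1.ne' hb.ne' h2 (l := num g l[i]) (by simp [hS b le_rfl]) ?_ (by simp))
        (by omega)
      funext j
      simp only [Function.update_apply, reverse_num]
      split_ifs <;> first | omega | simp_all
  | natRec n e s, ρ, l, out, b, S, hρ, hb, hout, hS => by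
    set N := n.eval l with hN
    set V := recVal e s l with hV
    -- the stacks while the counter is `c`, the argument is `y`, and the current value is `z`
    let st : List G → ℕ → ℕ → ℕ → List G := fun c y z =>
      update (update (update S b c) (b + 1) (num g y)) (b + 2) (num g z)
    -- the cost of the first `y` rounds
    let LC : ℕ → ℕ := fun y => Nat.rec 0 (fun y c => c + (s.cost (y :: V y :: l) + 2 * V y +
        3 * V (y + 1) + 7)) y
    have hloop : ∀ c y t, LC (y + c) + 1 ≤ LC y + t → Exec (.loop Option.isSome <|
          .seq (compile g s ((b + 1) :: (b + 2) :: ρ) (b + 3) (b + 4)) <|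
          .seq (clear (b + 2)) <| .seq (move g (b + 3) (b + 2)) <|
          .seq (.push (b + 1) fun _ => g) (.pop b)) ((num g c).head?, st (num g c).tail y (V y))
        (none, st [] (y + c) (V (y + c))) t := by
      intro c
      induction c with
      | zero =>
        intro y t ht
        exact .loop_done rfl (by simpa using ht)
      | succ c ih =>
        intro y t ht
        have hLC : LC (y + 1) = LC y + (s.cost (y :: V y :: l) + 2 * V y + 3 * V (y + 1) + 7) := rfl
        have hmono : ∀ d, LC (y + 1) ≤ LC (y + 1 + d) := by
          intro d
          induction d with
          | zero => exact le_rfl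
          | succ d ihd => exact ihd.trans (Nat.le_add_right _ _)
        have hm := hmono c
        have hyc : y + (c + 1) = y + 1 + c := by omega
        rw [hyc] at ht ⊢
        have hs := does_compile g s ((b + 1) :: (b + 2) :: ρ) (y :: V y :: l) (b + 3) (b + 4)
          (st (num g c) y (V y)) (.cons ⟨by omega, by omega, by simp [st]⟩
            (.cons ⟨by omega, by omega, by simp [st]⟩ (hρ.imp fun r x h => ⟨by omega, by omega, by
              simp only [st]
              rw [Function.update_of_ne (by omega), Function.update_of_ne (by omega),
                Function.update_of_ne (by omega), h.2.2]⟩))) (by omega)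
          (by simp [st, hS]) (fun j hj => by
              simp only [st]
              rw [Function.update_of_ne (by omega), Function.update_of_ne (by omega),
                Function.update_of_ne (by omega), hS j (by omega)])
        have hV' : s.eval (y :: V y :: l) = V (y + 1) := rfl
        rw [hV'] at hs
        refine .loop_step (t₁ := s.cost (y :: V y :: l) + 2 * V y + 3 * V (y + 1) + 6)
          (t₂ := t - (s.cost (y :: V y :: l) + 2 * V y + 3 * V (y + 1) + 7)) rfl ?_
          (ih (y + 1) _ (by omega)) (by omega)
        refine Does.exec_seq hs (t₂ := 2 * V y + 3 * V (y + 1) + 6) (Does.exec_seq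
          (does_clear rfl (t := 2 * V y + 2) (by simp [st]))
          (Does.exec_seq (does_move (by omega) (l := num g (V (y + 1))) (by simp) rfl
            (t := 3 * V (y + 1) + 2) (by simp)) (Does.exec_seq (does_push _ _ _ le_rfl) (t₂ := 1) ?_
              (t := 2) (by omega)) (t := 3 * V (y + 1) + 4) (by omega))
              (by omega)) (by omega) _
        intro v
        refine exec_pop ?_ ?_ le_rfl v
        · simp [st]
        · funext j
          simp only [st, Function.update_apply, reverse_num]
          split_ifs <;> first | omega | simp_all [num_succ]
    have h1 := does_compile g n ρ l b (b + 1) S (hρ.imp fun r x h => ⟨by omega, by omega, h.2.2⟩)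
      (by omega) (hS b le_rfl) (fun j hj => hS j (by omega))
    have h2 := does_compile g e ρ l (b + 2) (b + 3) (update S b (num g N))
      (hρ.imp fun r x h => ⟨by omega, by omega, by rw [Function.update_of_ne (by omega), h.2.2]⟩)
      (by omega) (by simp [hS]) (fun j hj => by rw [Function.update_of_ne (by omega), hS j (by omega)])
    have h3 := hloop N 0 (LC N + 1) (by simp)
    have h0 : LC 0 = 0 := rfl
    have hcost : (natRec n e s).cost l = n.cost l + e.cost l + LC N + 2 * N + 3 * V N + 6 := rfl
    have heval : (natRec n e s).eval l = V N := rfl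
    rw [hcost, heval]
    refine h1.seq (t₂ := e.cost l + LC N + 2 * N + 3 * V N + 6) (h2.seq
      (t₂ := LC N + 2 * N + 3 * V N + 6) ?_ (by omega)) (by omega)
    intro v
    have hend : Does (.seq (clear (b + 1)) (move g (b + 2) out)) (st [] (0 + N) (V (0 + N)))
        (update S out (num g (V N))) (2 * N + 3 * V N + 4) := by
      refine Does.seq (does_clear rfl (t := 2 * N + 2) (by simp [st]))
        (does_move (by omega) (l := num g (V N)) (by simp [st]) ?_ (t := 3 * V N + 2) (by simp))
        (by omega)
      funext j
      simp only [st, Function.update_apply, reverse_num]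
      split_ifs <;> first | omega | simp_all
    obtain ⟨v', h4⟩ := Exec.does_seq h3 hend (t := LC N + 2 * N + 3 * V N + 5) (by omega)
    refine ⟨v', .seq (t₁ := 1) (t₂ := LC N + 2 * N + 3 * V N + 5) (.pop le_rfl) ?_ (by omega)⟩
    convert h4 using 2
    · simp
    · funext j
      simp only [st, Function.update_apply, hV, recVal]
      split_ifs <;> first | omega | simp_all

/-! ### A library of arithmetic expressions -/

/-- Insert `d` unused variables at the position `c`, as needed when an expression is placed below
the binders of a recursion. -/
def lift (d : ℕ) : ℕ → NExp → NExp
  | _, zero => zero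
  | c, succ e => succ (e.lift d c)
  | c, var i => var (if i < c then i else i + d)
  | c, natRec n b s => natRec (n.lift d c) (b.lift d c) (s.lift d (c + 2))

theorem eval_lift (l₂ l₃ : List ℕ) : ∀ (e : NExp) (l₁ : List ℕ),
    (e.lift l₂.length l₁.length).eval (l₁ ++ (l₂ ++ l₃)) = e.eval (l₁ ++ l₃)
  | zero, _ => rfl
  | succ e, l₁ => congrArg Nat.succ (eval_lift l₂ l₃ e l₁)
  | var i, l₁ => by
    simp only [lift, eval, List.getD_eq_getElem?_getD]
    split_ifs with h
    · rw [List.getElem?_append_left h, List.getElem?_append_left h]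
    · rw [List.getElem?_append_right (by omega), List.getElem?_append_right (by omega),
        List.getElem?_append_right (by omega)]
      congr 2
      omega
  | natRec n b s, l₁ => by
    simp only [lift, eval, eval_lift l₂ l₃ n l₁, eval_lift l₂ l₃ b l₁]
    congr 1
    funext y z
    exact eval_lift l₂ l₃ s (y :: z :: l₁)

@[simp] theorem eval_lift_one (e : NExp) (x : ℕ) (l : List ℕ) :
    (e.lift 1 0).eval (x :: l) = e.eval l := eval_lift [x] l e []

@[simp] theorem eval_lift_two (e : NExp) (x y : ℕ) (l : List ℕ) :
    (e.lift 2 0).eval (x :: y :: l) = e.eval l := eval_lift [x, y] l e []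

@[simp] theorem eval_lift_one_one (e : NExp) (x y : ℕ) (l : List ℕ) :
    (e.lift 1 1).eval (x :: y :: l) = e.eval (x :: l) := eval_lift [y] l e [x]

@[simp] theorem eval_zero (l : List ℕ) : zero.eval l = 0 := rfl

@[simp] theorem eval_succ (e : NExp) (l : List ℕ) : (succ e).eval l = e.eval l + 1 := rfl

@[simp] theorem eval_var (i : ℕ) (l : List ℕ) : (var i).eval l = l.getD i 0 := rfl

/-- The expression for the number `n`. -/
def const : ℕ → NExp
  | 0 => zero
  | n + 1 => succ (const n)

@[simp] theorem eval_const (n : ℕ) (l : List ℕ) : (const n).eval l = n := by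
  induction n with
  | zero => rfl
  | succ n ih => simp [const, ih]

/-- Addition. -/
def add (e f : NExp) : NExp := natRec f e (succ (var 1))

@[simp] theorem eval_add (e f : NExp) (l : List ℕ) : (add e f).eval l = e.eval l + f.eval l := by
  simp only [add, eval]
  induction f.eval l with
  | zero => rfl
  | succ n ih => simp_all [Nat.add_assoc]

/-- Multiplication. -/
def mul (e f : NExp) : NExp := natRec f zero (add (var 1) (e.lift 2 0))

@[simp] theorem eval_mul (e f : NExp) (l : List ℕ) : (mul e f).eval l = e.eval l * f.eval l := by
  simp only [mul, eval]
  induction f.eval l with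
  | zero => rfl
  | succ n ih => simp_all [Nat.mul_succ]

/-- Exponentiation. -/
def pow (e f : NExp) : NExp := natRec f (const 1) (mul (var 1) (e.lift 2 0))

@[simp] theorem eval_pow (e f : NExp) (l : List ℕ) : (pow e f).eval l = e.eval l ^ f.eval l := by
  simp only [pow, eval]
  induction f.eval l with
  | zero => simp
  | succ n ih => simp_all [Nat.pow_succ]

/-- The predecessor. -/
def pred (e : NExp) : NExp := natRec e zero (var 0)

@[simp] theorem eval_pred (e : NExp) (l : List ℕ) : (pred e).eval l = e.eval l - 1 := by
  simp only [pred, eval]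
  cases e.eval l <;> rfl

/-- Truncated subtraction. -/
def sub (e f : NExp) : NExp := natRec f e (pred (var 1))

@[simp] theorem eval_sub (e f : NExp) (l : List ℕ) : (sub e f).eval l = e.eval l - f.eval l := by
  simp only [sub, eval]
  induction f.eval l with
  | zero => rfl
  | succ n ih =>
    simp only [eval_pred, eval_var, List.getD_cons_succ, List.getD_cons_zero] at ih ⊢
    rw [ih, Nat.sub_succ]
    rfl

/-- The sum over all numbers below the bound `n`; variable `0` of the summand runs. -/
def sum (n f : NExp) : NExp := natRec n zero (add (var 1) (f.lift 1 1))

@[simp] theorem eval_sum (n f : NExp) (l : List ℕ) :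
    (sum n f).eval l = ∑ i ∈ Finset.range (n.eval l), f.eval (i :: l) := by
  simp only [sum, eval]
  induction n.eval l with
  | zero => rfl
  | succ n ih => simp_all [Finset.sum_range_succ]

/-- An expression, read as a condition, holds if its value is not `0`. -/
def Holds (e : NExp) (l : List ℕ) : Prop := e.eval l ≠ 0

/-- Negation. -/
def not (e : NExp) : NExp := sub (const 1) e

@[simp] theorem holds_not (e : NExp) (l : List ℕ) : (not e).Holds l ↔ ¬ e.Holds l := by
  simp [Holds, not, Nat.sub_eq_zero_iff_le]

/-- Conjunction. -/
def and (e f : NExp) : NExp := mul e f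

@[simp] theorem holds_and (e f : NExp) (l : List ℕ) :
    (and e f).Holds l ↔ e.Holds l ∧ f.Holds l := by
  simp [Holds, and]

/-- Disjunction; the value may exceed `1`. -/
def or (e f : NExp) : NExp := add e f

@[simp] theorem holds_or (e f : NExp) (l : List ℕ) : (or e f).Holds l ↔ e.Holds l ∨ f.Holds l := by
  simp only [Holds, or, eval_add]
  omega

/-- Implication. -/
def imp (e f : NExp) : NExp := or (not e) f

@[simp] theorem holds_imp (e f : NExp) (l : List ℕ) :
    (imp e f).Holds l ↔ (e.Holds l → f.Holds l) := by
  simp [imp, imp_iff_not_or]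

/-- Equivalence. -/
def iff (e f : NExp) : NExp := and (imp e f) (imp f e)

@[simp] theorem holds_iff (e f : NExp) (l : List ℕ) :
    (iff e f).Holds l ↔ (e.Holds l ↔ f.Holds l) := by
  simp [iff, iff_iff_implies_and_implies]

/-- The order relation. -/
def le (e f : NExp) : NExp := not (sub e f)

@[simp] theorem holds_le (e f : NExp) (l : List ℕ) : (le e f).Holds l ↔ e.eval l ≤ f.eval l := by
  rw [le, holds_not, Holds, eval_sub, not_not, Nat.sub_eq_zero_iff_le]

/-- Equality. -/
def eq (e f : NExp) : NExp := and (le e f) (le f e)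

@[simp] theorem holds_eq (e f : NExp) (l : List ℕ) : (eq e f).Holds l ↔ e.eval l = f.eval l := by
  simp [eq, le_antisymm_iff]

/-- Bounded existential quantification; the value is a sum of truth values. -/
def ex (n f : NExp) : NExp := sum n f

@[simp] theorem holds_ex (n f : NExp) (l : List ℕ) :
    (ex n f).Holds l ↔ ∃ i < n.eval l, f.Holds (i :: l) := by
  simp [Holds, ex]

/-- Bounded universal quantification. -/
def all (n f : NExp) : NExp := not (ex n (not f))

@[simp] theorem holds_all (n f : NExp) (l : List ℕ) :
    (all n f).Holds l ↔ ∀ i < n.eval l, f.Holds (i :: l) := by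
  simp [all]

/-- The truth value, `0` or `1`, of a condition. -/
def ind (e : NExp) : NExp := not (not e)

open Classical in
@[simp] theorem eval_ind (e : NExp) (l : List ℕ) :
    (ind e).eval l = if e.Holds l then 1 else 0 := by
  by_cases h : e.eval l = 0 <;> simp [ind, not, Holds, h]
  omega

/-- Division, as the number of the `i` below `e` with `(i + 1) * f ≤ e`. The factor `ind f` gives
the value `0` for the divisor `0`, as for natural numbers. -/
def div (e f : NExp) : NExp :=
  mul (ind f) (sum e (ind (le (mul (succ (var 0)) (f.lift 1 0)) (e.lift 1 0))))

@[simp] theorem eval_div (e f : NExp) (l : List ℕ) : (div e f).eval l = e.eval l / f.eval l := by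
  classical
  simp only [div, eval_mul, eval_ind, eval_sum, holds_le]
  rcases Nat.eq_zero_or_pos (f.eval l) with h | h
  · simp [Holds, h]
  · have hf : f.Holds l := h.ne'
    rw [if_pos hf, one_mul, ← Finset.card_filter]
    have : (Finset.range (e.eval l)).filter (fun i =>
        (succ (var 0)).eval (i :: l) * (f.lift 1 0).eval (i :: l) ≤ (e.lift 1 0).eval (i :: l)) =
        Finset.range (e.eval l / f.eval l) := by
      ext i
      simp only [Finset.mem_filter, Finset.mem_range]
      simp only [eval_succ, eval_var, List.getD_cons_zero, eval_lift_one]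
      rw [← Nat.succ_le_iff (n := e.eval l / f.eval l), Nat.le_div_iff_mul_le h]
      constructor
      · exact fun h => h.2
      · exact fun h' => ⟨by nlinarith, h'⟩
    rw [this, Finset.card_range]

/-- The remainder of a division. -/
def mod (e f : NExp) : NExp := sub e (mul f (div e f))

@[simp] theorem eval_mod (e f : NExp) (l : List ℕ) : (mod e f).eval l = e.eval l % f.eval l := by
  simp only [mod, eval_sub, eval_mul, eval_div]
  have := Nat.div_add_mod (e.eval l) (f.eval l)
  omega

/-- A finite table of values: `lookup F n e` is `F e` for arguments below `n`. -/
def lookup (F : ℕ → ℕ) : ℕ → NExp → NExp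
  | 0, _ => zero
  | n + 1, e => add (lookup F n e) (mul (const (F n)) (ind (eq e (const n))))

theorem eval_lookup (F : ℕ → ℕ) (n : ℕ) (e : NExp) (l : List ℕ) (h : e.eval l < n) :
    (lookup F n e).eval l = F (e.eval l) := by
  have : ∀ n, (lookup F n e).eval l = if e.eval l < n then F (e.eval l) else 0 := by
    intro n
    induction n with
    | zero => rfl
    | succ n ih =>
      simp only [lookup, eval_add, ih, eval_mul, eval_const, eval_ind, holds_eq]
      rcases lt_trichotomy (e.eval l) n with h | h | h
      · simp [h, h.ne, Nat.lt_succ_of_lt h]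
      · simp [h]
      · simp [h.ne', not_lt.2 h.le, not_lt.2 (Nat.succ_le_of_lt h)]
  rw [this, if_pos h]

end NExp

/-! ### Numbers as tables -/

/-- The digit at the position `i` of the number `c` in base `b`. -/
def dig (b c i : ℕ) : ℕ := c / b ^ i % b

/-- The bit at the position `i` of the number `c`. -/
def Bit (c i : ℕ) : Prop := dig 2 c i ≠ 0

/-- The number whose digits in base `b` are the values `g 0, …, g (n - 1)`. -/
def tab (n b : ℕ) (g : ℕ → ℕ) : ℕ := ∑ i ∈ Finset.range n, g i % b * b ^ i

theorem dig_lt {b : ℕ} (hb : 0 < b) (c i : ℕ) : dig b c i < b := Nat.mod_lt _ hb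

theorem tab_succ (n b : ℕ) (g : ℕ → ℕ) : tab (n + 1) b g = tab n b g + g n % b * b ^ n :=
  Finset.sum_range_succ _ _

theorem tab_lt {b : ℕ} (hb : 0 < b) (n : ℕ) (g : ℕ → ℕ) : tab n b g < b ^ n := by
  induction n with
  | zero => simp [tab]
  | succ n ih =>
    rw [tab_succ, Nat.pow_succ]
    have : g n % b + 1 ≤ b := Nat.mod_lt _ hb
    nlinarith [Nat.mul_le_mul_right (b ^ n) this]

theorem dig_tab {b : ℕ} (hb : 0 < b) {n i : ℕ} (g : ℕ → ℕ) (hi : i < n) :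
    dig b (tab n b g) i = g i % b := by
  induction n with
  | zero => omega
  | succ n ih =>
    rw [tab_succ]
    rcases Nat.lt_succ_iff_lt_or_eq.1 hi with h | rfl
    · rw [← ih h]
      obtain ⟨d, rfl⟩ := Nat.exists_eq_add_of_lt h
      rw [dig, dig, show g (i + d + 1) % b * b ^ (i + d + 1) = b ^ i * (b * (g (i + d + 1) % b * b ^ d)) by ring,
        Nat.add_mul_div_left _ _ (Nat.pow_pos hb), Nat.add_mul_mod_self_left]
    · rw [dig, Nat.add_mul_div_right _ _ (Nat.pow_pos hb), Nat.div_eq_of_lt (tab_lt hb _ _), zero_add,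
        Nat.mod_mod]

theorem dig_of_lt {b c n i : ℕ} (hc : c < b ^ n) (hi : n ≤ i) : dig b c i = 0 := by
  rcases Nat.eq_zero_or_pos b with rfl | hb
  · cases n with
    | zero => simp at hc; simp [hc, dig]
    | succ n => simp at hc
  · rw [dig, Nat.div_eq_of_lt (hc.trans_le (Nat.pow_le_pow_right hb hi)), Nat.zero_mod]

theorem tab_dig {b n c : ℕ} (hc : c < b ^ n) : tab n b (dig b c) = c := by
  have : ∀ n, tab n b (dig b c) = c % b ^ n := by
    intro n
    induction n with
    | zero => simp [tab, Nat.mod_one]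
    | succ n ih =>
      rw [tab_succ, ih, Nat.pow_succ, Nat.mod_mul, dig, Nat.mod_mod]
      ring
  rw [this, Nat.mod_eq_of_lt hc]

theorem eq_of_dig_eq {b n c c' : ℕ} (hc : c < b ^ n) (hc' : c' < b ^ n)
    (h : ∀ i < n, dig b c i = dig b c' i) : c = c' := by
  rw [← tab_dig hc, ← tab_dig hc']
  exact Finset.sum_congr rfl fun i hi => by rw [h i (Finset.mem_range.1 hi)]

open Classical in
theorem bit_tab {n i : ℕ} {p : ℕ → Prop} (hi : i < n) :
    Bit (tab n 2 fun j => if p j then 1 else 0) i ↔ p i := by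
  rw [Bit, dig_tab two_pos _ hi]
  split_ifs <;> simp_all

namespace NExp

/-- The digit of a number. -/
def digE (b c i : NExp) : NExp := mod (div c (pow b i)) b

@[simp] theorem eval_digE (b c i : NExp) (l : List ℕ) :
    (digE b c i).eval l = dig (b.eval l) (c.eval l) (i.eval l) := by
  simp [digE, dig]

/-- The bit of a number, as a condition. -/
def bitE (c i : NExp) : NExp := digE (const 2) c i

@[simp] theorem holds_bitE (c i : NExp) (l : List ℕ) :
    (bitE c i).Holds l ↔ Bit (c.eval l) (i.eval l) := by
  simp [bitE, Holds, Bit]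

/-- The number with given digits. -/
def tabE (n b g : NExp) : NExp := sum n (mul (mod g (b.lift 1 0)) (pow (b.lift 1 0) (var 0)))

@[simp] theorem eval_tabE (n b g : NExp) (l : List ℕ) :
    (tabE n b g).eval l = tab (n.eval l) (b.eval l) fun i => g.eval (i :: l) := by
  simp [tabE, tab]

/-! ### Primitive recursiveness of values and costs -/

theorem primrec_natRec {α : Type*} [Primcodable α] {n f : α → ℕ} {g : α → ℕ → ℕ → ℕ}
    (hn : Primrec n) (hf : Primrec f) (hg : Primrec fun p : α × ℕ × ℕ => g p.1 p.2.1 p.2.2) :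
    Primrec fun x => (Nat.rec (f x) (g x) (n x) : ℕ) :=
  Primrec.nat_rec' (h := fun x p => g x p.1 p.2) hn hf hg

theorem primrec_eval : ∀ e : NExp, Primrec e.eval
  | zero => Primrec.const 0
  | succ e => Primrec.succ.comp (primrec_eval e)
  | var i => (Primrec.list_getD 0).comp Primrec.id (Primrec.const i)
  | natRec n b s =>
    primrec_natRec (primrec_eval n) (primrec_eval b)
      ((primrec_eval s).comp (Primrec.list_cons.comp (Primrec.fst.comp Primrec.snd)
        (Primrec.list_cons.comp (Primrec.snd.comp Primrec.snd) Primrec.fst)))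

theorem primrec_recVal (b s : NExp) : Primrec₂ (recVal b s) :=
  primrec_natRec (α := List ℕ × ℕ) Primrec.snd ((primrec_eval b).comp Primrec.fst)
    ((primrec_eval s).comp (Primrec.list_cons.comp (Primrec.fst.comp Primrec.snd)
      (Primrec.list_cons.comp (Primrec.snd.comp Primrec.snd) (Primrec.fst.comp Primrec.fst))))

theorem primrec_mul_const {α : Type*} [Primcodable α] {f : α → ℕ} (hf : Primrec f) (c : ℕ) :
    Primrec fun x => c * f x := Primrec.nat_mul.comp (Primrec.const c) hf

theorem primrec_add {α : Type*} [Primcodable α] {f g : α → ℕ} (hf : Primrec f) (hg : Primrec g) :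
    Primrec fun x => f x + g x := Primrec.nat_add.comp hf hg

theorem primrec_cost : ∀ e : NExp, Primrec e.cost
  | zero => Primrec.const 1
  | succ e => Primrec.succ.comp (primrec_cost e)
  | var i => primrec_add (primrec_mul_const (primrec_eval (var i)) 7) (Primrec.const 4)
  | natRec n b s => by
    have hy : Primrec fun p : List ℕ × ℕ × ℕ => p.2.1 := Primrec.fst.comp Primrec.snd
    have hV : Primrec fun p : List ℕ × ℕ × ℕ => recVal b s p.1 p.2.1 :=
      (primrec_recVal b s).comp Primrec.fst hy
    have hV' : Primrec fun p : List ℕ × ℕ × ℕ => recVal b s p.1 (p.2.1 + 1) :=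
      (primrec_recVal b s).comp Primrec.fst (Primrec.succ.comp hy)
    have hs : Primrec fun p : List ℕ × ℕ × ℕ => s.cost (p.2.1 :: recVal b s p.1 p.2.1 :: p.1) :=
      (primrec_cost s).comp (Primrec.list_cons.comp hy (Primrec.list_cons.comp hV Primrec.fst))
    have hstep : Primrec fun p : List ℕ × ℕ × ℕ => p.2.2 + (s.cost (p.2.1 :: recVal b s p.1 p.2.1 :: p.1)
        + 2 * recVal b s p.1 p.2.1 + 3 * recVal b s p.1 (p.2.1 + 1) + 7) :=
      primrec_add (Primrec.snd.comp Primrec.snd) (primrec_add (primrec_add (primrec_add hs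
        (primrec_mul_const hV 2)) (primrec_mul_const hV' 3)) (Primrec.const 7))
    have hloop := primrec_natRec (g := fun l y c => c + (s.cost (y :: recVal b s l y :: l) +
      2 * recVal b s l y + 3 * recVal b s l (y + 1) + 7)) (primrec_eval n) (Primrec.const 0) hstep
    have hVn := (primrec_recVal b s).comp Primrec.id (primrec_eval n)
    exact primrec_add (primrec_add (primrec_add (primrec_add (primrec_add (primrec_cost n)
      (primrec_cost b)) hloop) (primrec_mul_const (primrec_eval n) 2)) (primrec_mul_const hVn 3))
      (Primrec.const 6)

theorem primrec_sum_range {α : Type*} [Primcodable α] {n : α → ℕ} {f : α → ℕ → ℕ} (hn : Primrec n)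
    (hf : Primrec₂ f) : Primrec fun x => ∑ i ∈ Finset.range (n x), f x i := by
  have h := primrec_natRec (g := fun x y c => c + f x y) hn (Primrec.const 0)
    (primrec_add (Primrec.snd.comp Primrec.snd)
      (hf.comp Primrec.fst (Primrec.fst.comp Primrec.snd)))
  refine h.of_eq fun x => ?_
  induction n x with
  | zero => rfl
  | succ n ih => rw [Finset.sum_range_succ, ← ih]

/-- The sum of the costs over all environments `[m, x, y]` with `x, y ≤ B`. It serves as a bound for
these costs that is primitive recursive in `m` and `B`; a monotone bound in closed form is not
needed. -/
def totalCost (e : NExp) (m B : ℕ) : ℕ :=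
  ∑ x ∈ Finset.range (B + 1), ∑ y ∈ Finset.range (B + 1), e.cost [m, x, y]

theorem cost_le_totalCost (e : NExp) {m B x y : ℕ} (hx : x ≤ B) (hy : y ≤ B) :
    e.cost [m, x, y] ≤ e.totalCost m B :=
  (Finset.single_le_sum (f := fun y => e.cost [m, x, y]) (fun _ _ => Nat.zero_le _)
    (Finset.mem_range.2 (Nat.lt_succ_of_le hy))).trans
    (Finset.single_le_sum (f := fun x => ∑ y ∈ Finset.range (B + 1), e.cost [m, x, y])
      (fun _ _ => Nat.zero_le _) (Finset.mem_range.2 (Nat.lt_succ_of_le hx)))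

theorem primrec_totalCost (e : NExp) : Primrec₂ e.totalCost := by
  have h1 : Primrec₂ fun (p : (ℕ × ℕ) × ℕ) (y : ℕ) => e.cost [p.1.1, p.2, y] :=
    (primrec_cost e).comp (Primrec.list_cons.comp
      (Primrec.fst.comp (Primrec.fst.comp Primrec.fst)) (Primrec.list_cons.comp
      (Primrec.snd.comp Primrec.fst) (Primrec.list_cons.comp Primrec.snd (Primrec.const []))))
  have hB : Primrec fun p : (ℕ × ℕ) × ℕ => p.1.2 + 1 :=
    Primrec.succ.comp (Primrec.snd.comp Primrec.fst)
  have hB' : Primrec fun p : ℕ × ℕ => p.2 + 1 := Primrec.succ.comp Primrec.snd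
  have h2 : Primrec₂ fun (p : ℕ × ℕ) (x : ℕ) =>
      ∑ y ∈ Finset.range (p.2 + 1), e.cost [p.1, x, y] := primrec_sum_range hB h1
  exact primrec_sum_range hB' h2

end NExp

/-! ### Team semantics over slots -/

section Slots

variable {L : FirstOrder.Language.{0, 0}} {A : Type*} [L.Structure A]

/-- The cylinder over the team `T` in the direction `x`. -/
def cyl (x : ℕ) (T : Set (ℕ → A)) : Set (ℕ → A) :=
  { s | ∃ s' ∈ T, ∃ a, s = update s' x a }

/-- The value of the term `t` if the variable `v` is stored in the slot `σ v` of `s`. -/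
def slotVal (σ : ℕ → ℕ) (s : ℕ → A) (t : L.Term ℕ) : A := t.realize fun v => s (σ v)

/-- Satisfaction in a team of assignments of all slots, where the variable `v` is stored in the
slot `σ v`. A team `T'` is of the form `T^x_f` with nonempty values of `f` iff `T` and `T'` have the
same cylinder in the direction of the slot of `x`: supplementation overwrites the old value of the
slot, and every element of `T'` comes from some element of `T`. -/
def SatS (σ : ℕ → ℕ) : DFormula L → Set (ℕ → A) → Prop
  | .eq t₁ t₂, T => ∀ s ∈ T, slotVal σ s t₁ = slotVal σ s t₂
  | .rel R t, T => ∀ s ∈ T, FirstOrder.Language.Structure.RelMap R fun i => slotVal σ s (t i)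
  | .nrel R t, T => ∀ s ∈ T, ¬ FirstOrder.Language.Structure.RelMap R fun i => slotVal σ s (t i)
  | .dep t u, T => ∀ s₁ ∈ T, ∀ s₂ ∈ T,
      (∀ r ∈ t, slotVal σ s₁ r = slotVal σ s₂ r) → ∀ r ∈ u, slotVal σ s₁ r = slotVal σ s₂ r
  | .and φ ψ, T => SatS σ φ T ∧ SatS σ ψ T
  | .or φ ψ, T => ∃ T₀ T₁ : Set (ℕ → A), T₀ ∪ T₁ = T ∧ SatS σ φ T₀ ∧ SatS σ ψ T₁
  | .ex x φ, T => ∃ T', cyl (σ x) T' = cyl (σ x) T ∧ SatS σ φ T'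
  | .all x φ, T => SatS σ φ (cyl (σ x) T)

variable [Nonempty A]

open Classical in
/-- Store the assignment `s` in the slots given by `σ`, with a default value elsewhere. -/
noncomputable def store (σ : ℕ → ℕ) {Y : Finset ℕ} (s : Y → A) : ℕ → A := fun i =>
  if h : ∃ x : Y, σ x = i then s h.choose else Classical.arbitrary A

theorem store_of_mem {σ : ℕ → ℕ} {V Y : Finset ℕ} (hσ : Set.InjOn σ V) (hY : Y ⊆ V) (s : Y → A)
    (x : Y) : store σ s (σ x) = s x := by
  have h : ∃ y : Y, σ y = σ x := ⟨x, rfl⟩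
  rw [store, dif_pos h]
  congr 1
  exact Subtype.ext (hσ (hY h.choose.2) (hY x.2) h.choose_spec)

/-- Variables outside the domain of a team have the default value, in agreement with `termVal`. -/
theorem store_of_notMem {σ : ℕ → ℕ} {V Y : Finset ℕ} (hσ : Set.InjOn σ V) (hY : Y ⊆ V) (s : Y → A)
    {x : ℕ} (hx : x ∈ V) (hxY : x ∉ Y) : store σ s (σ x) = Classical.arbitrary A := by
  rw [store, dif_neg]
  rintro ⟨y, hy⟩
  exact hxY (hσ (hY y.2) hx hy ▸ y.2)

theorem realize_congr {t : L.Term ℕ} {f g : ℕ → A} (h : ∀ v ∈ t.varFinset, f v = g v) :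
    t.realize f = t.realize g := by
  induction t with
  | var x => exact h x (by simp [FirstOrder.Language.Term.varFinset])
  | func F ts ih =>
    simp only [FirstOrder.Language.Term.realize]
    congr 1
    funext i
    exact ih i fun v hv => h v (by
      simp only [FirstOrder.Language.Term.varFinset, Finset.mem_biUnion]
      exact ⟨i, Finset.mem_univ _, hv⟩)

theorem termVal_eq_slotVal {σ : ℕ → ℕ} {V Y : Finset ℕ} (hσ : Set.InjOn σ V) (hY : Y ⊆ V)
    (s : Y → A) {t : L.Term ℕ} (ht : t.varFinset ⊆ V) :
    termVal s t = slotVal σ (store σ s) t := by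
  refine realize_congr fun v hv => ?_
  split_ifs with h
  · exact (store_of_mem hσ hY s ⟨v, h⟩).symm
  · exact (store_of_notMem hσ hY s (ht hv) h).symm

theorem store_updateAssignment {σ : ℕ → ℕ} {V Y : Finset ℕ} (hσ : Set.InjOn σ V) (hY : Y ⊆ V)
    (s : Y → A) {x : ℕ} (hx : x ∈ V) (a : A) :
    store σ (updateAssignment s x a) = update (store σ s) (σ x) a := by
  have hxY : insert x Y ⊆ V := Finset.insert_subset hx hY
  funext i
  by_cases hi : ∃ y : (insert x Y : Finset ℕ), σ y = i
  · obtain ⟨y, rfl⟩ := hi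
    rw [store_of_mem hσ hxY]
    by_cases hyx : y.1 = x
    · simp [updateAssignment, hyx]
    · have hne : σ y ≠ σ x := fun h => hyx (hσ (hxY y.2) hx h)
      rw [Function.update_of_ne hne, updateAssignment, dif_neg hyx]
      exact (store_of_mem hσ hY s ⟨y.1, _⟩).symm
  · have h1 : i ≠ σ x := fun h => hi ⟨⟨x, Finset.mem_insert_self _ _⟩, h.symm⟩
    have h2 : ¬ ∃ y : Y, σ y = i := fun ⟨y, hy⟩ => hi ⟨⟨y, Finset.mem_insert_of_mem y.2⟩, hy⟩
    rw [Function.update_of_ne h1, store, dif_neg hi, store, dif_neg h2]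

theorem mem_tupleVars {t : List (L.Term ℕ)} {v : ℕ} :
    v ∈ tupleVars t ↔ ∃ r ∈ t, v ∈ r.varFinset := by
  induction t with
  | nil => simp [tupleVars]
  | cons r t ih =>
    simp only [tupleVars, List.foldr_cons, Finset.mem_union, List.mem_cons, exists_eq_or_imp] at ih ⊢
    rw [ih]

theorem cyl_self {x : ℕ} {T : Set (ℕ → A)} {s : ℕ → A} (hs : s ∈ T) : s ∈ cyl x T :=
  ⟨s, hs, s x, by simp⟩

/-- Storing the assignments in slots preserves satisfaction if different variables are stored in
different slots. Here `V` contains all variables of the formula and the domain of the team, and so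
it stays the same at quantifiers, although the domain grows. -/
theorem sat_iff_satS {σ : ℕ → ℕ} {V : Finset ℕ} (hσ : Set.InjOn σ V) : ∀ (φ : DFormula L)
    (Y : Finset ℕ) (T : Set (Y → A)), φ.vars ⊆ V → Y ⊆ V → (Sat φ Y T ↔ SatS σ φ (store σ '' T))
  | .eq t₁ t₂, Y, T, hφ, hY => by
    simp only [DFormula.vars, Finset.union_subset_iff] at hφ
    simp only [Sat, SatS, Set.forall_mem_image, termVal_eq_slotVal hσ hY _ hφ.1,
      termVal_eq_slotVal hσ hY _ hφ.2]
  | .rel R t, Y, T, hφ, hY => by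
    simp only [DFormula.vars, Finset.biUnion_subset] at hφ
    simp only [Sat, SatS, Set.forall_mem_image,
      termVal_eq_slotVal hσ hY _ (hφ _ (Finset.mem_univ _))]
  | .nrel R t, Y, T, hφ, hY => by
    simp only [DFormula.vars, Finset.biUnion_subset] at hφ
    simp only [Sat, SatS, Set.forall_mem_image,
      termVal_eq_slotVal hσ hY _ (hφ _ (Finset.mem_univ _))]
  | .dep t u, Y, T, hφ, hY => by
    have hv : ∀ r, r ∈ t ∨ r ∈ u → ∀ s : Y → A, termVal s r = slotVal σ (store σ s) r := by
      intro r hr s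
      refine termVal_eq_slotVal hσ hY s fun v hv => hφ ?_
      simp only [DFormula.vars, Finset.mem_union, mem_tupleVars]
      exact hr.imp (fun h => ⟨r, h, hv⟩) (fun h => ⟨r, h, hv⟩)
    simp only [Sat, SatS, Set.forall_mem_image, List.map_inj_left]
    refine forall₂_congr fun s₁ _ => forall₂_congr fun s₂ _ => imp_congr ?_ ?_
    · exact forall₂_congr fun r hr => by rw [hv r (.inl hr), hv r (.inl hr)]
    · exact forall₂_congr fun r hr => by rw [hv r (.inr hr), hv r (.inr hr)]
  | .and φ ψ, Y, T, hφ, hY => by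
    simp only [DFormula.vars, Finset.union_subset_iff] at hφ
    simp only [Sat, SatS, sat_iff_satS hσ φ Y T hφ.1 hY, sat_iff_satS hσ ψ Y T hφ.2 hY]
  | .or φ ψ, Y, T, hφ, hY => by
    simp only [DFormula.vars, Finset.union_subset_iff] at hφ
    simp only [Sat, SatS]
    constructor
    · rintro ⟨T₀, T₁, rfl, h₀, h₁⟩
      exact ⟨_, _, (Set.image_union _ _ _).symm, (sat_iff_satS hσ φ Y T₀ hφ.1 hY).1 h₀,
        (sat_iff_satS hσ ψ Y T₁ hφ.2 hY).1 h₁⟩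
    · rintro ⟨T₀, T₁, h, h₀, h₁⟩
      -- storing is not needed to be injective: a part of the image is the image of its preimage
      have him : ∀ U, U ⊆ store σ '' T → store σ '' { s ∈ T | store σ s ∈ U } = U := by
        intro U hU
        ext s
        constructor
        · rintro ⟨s', hs', rfl⟩
          exact hs'.2
        · intro hs
          obtain ⟨s', hs', rfl⟩ := hU hs
          exact ⟨s', ⟨hs', hs⟩, rfl⟩
      refine ⟨{ s ∈ T | store σ s ∈ T₀ }, { s ∈ T | store σ s ∈ T₁ }, ?_,
        (sat_iff_satS hσ φ Y _ hφ.1 hY).2 ?_, (sat_iff_satS hσ ψ Y _ hφ.2 hY).2 ?_⟩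
      · ext s
        have : s ∈ T → store σ s ∈ T₀ ∪ T₁ := fun hs => h ▸ Set.mem_image_of_mem _ hs
        simp only [Set.mem_union, Set.mem_ofPred_eq] at this ⊢
        tauto
      · rwa [him T₀ (h ▸ Set.subset_union_left)]
      · rwa [him T₁ (h ▸ Set.subset_union_right)]
  | .ex x φ, Y, T, hφ, hY => by
    simp only [DFormula.vars, Finset.insert_subset_iff] at hφ
    obtain ⟨hx, hφ⟩ := hφ
    have hxY : insert x Y ⊆ V := Finset.insert_subset hx hY
    simp only [Sat, SatS]
    constructor
    · rintro ⟨f, hf, h⟩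
      refine ⟨_, ?_, (sat_iff_satS hσ φ _ _ hφ hxY).1 h⟩
      ext s
      constructor
      · rintro ⟨_, ⟨_, ⟨s', hs', a, _, rfl⟩, rfl⟩, b, rfl⟩
        exact ⟨_, ⟨s', hs', rfl⟩, b, by rw [store_updateAssignment hσ hY _ hx, Function.update_idem]⟩
      · rintro ⟨_, ⟨s', hs', rfl⟩, b, rfl⟩
        obtain ⟨a, ha⟩ := hf s' hs'
        exact ⟨_, ⟨_, ⟨s', hs', a, ha, rfl⟩, rfl⟩, b, by
          rw [store_updateAssignment hσ hY _ hx, Function.update_idem]⟩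
    · rintro ⟨T', hT', h⟩
      refine ⟨fun s => { a | update (store σ s) (σ x) a ∈ T' }, fun s hs => ?_,
        (sat_iff_satS hσ φ _ _ hφ hxY).2 ?_⟩
      · have : store σ s ∈ cyl (σ x) T' := hT' ▸ cyl_self (Set.mem_image_of_mem _ hs)
        obtain ⟨s', hs', a, ha⟩ := this
        refine ⟨s' (σ x), ?_⟩
        simpa [ha] using hs'
      · convert h
        ext s
        constructor
        · rintro ⟨_, ⟨s', hs', a, ha, rfl⟩, rfl⟩
          rw [store_updateAssignment hσ hY _ hx]
          exact ha
        · intro hs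
          have : s ∈ cyl (σ x) (store σ '' T) := hT' ▸ cyl_self hs
          obtain ⟨_, ⟨s', hs', rfl⟩, a, rfl⟩ := this
          exact ⟨_, ⟨s', hs', a, hs, rfl⟩, store_updateAssignment hσ hY _ hx a⟩
  | .all x φ, Y, T, hφ, hY => by
    simp only [DFormula.vars, Finset.insert_subset_iff] at hφ
    obtain ⟨hx, hφ⟩ := hφ
    simp only [Sat, SatS, sat_iff_satS hσ φ _ _ hφ (Finset.insert_subset hx hY)]
    have : store σ '' supplement T x (fun _ => Set.univ) = cyl (σ x) (store σ '' T) := by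
      ext s
      constructor
      · rintro ⟨_, ⟨s', hs', a, _, rfl⟩, rfl⟩
        exact ⟨_, ⟨s', hs', rfl⟩, a, store_updateAssignment hσ hY _ hx a⟩
      · rintro ⟨_, ⟨s', hs', rfl⟩, a, rfl⟩
        exact ⟨_, ⟨s', hs', a, trivial, rfl⟩, store_updateAssignment hσ hY _ hx a⟩
    rw [this]

end Slots

/-! ### Codes of assignments and teams -/

section Codes

variable {A : Type*} {a : ℕ} (e : A ≃ Fin a)

theorem pos_of_equiv [Nonempty A] (e : A ≃ Fin a) : 0 < a := Fin.pos (e (Classical.arbitrary A))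

variable [Nonempty A]

/-- The assignment of slots with the code `i`: its values are the digits of `i` in base `a`. -/
def dec (i : ℕ) : ℕ → A := fun y => e.symm ⟨dig a i y, dig_lt (pos_of_equiv e) i y⟩

/-- The team with the code `c`, in which `m` slots are in use: the bits of `c` say which
assignments it contains. -/
def team (m c : ℕ) : Set (ℕ → A) := { s | ∃ i < a ^ m, Bit c i ∧ s = dec e i }

theorem coe_apply_dec (i y : ℕ) : (e (dec e i y) : ℕ) = dig a i y := by simp [dec]

theorem dec_apply_eq_iff (i j y z : ℕ) : dec e i y = dec e j z ↔ dig a i y = dig a j z := by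
  rw [← coe_apply_dec e, ← coe_apply_dec e, ← Fin.ext_iff, e.apply_eq_iff_eq]

theorem dec_inj {m i j : ℕ} (hi : i < a ^ m) (hj : j < a ^ m) (h : dec e i = dec e j) : i = j :=
  eq_of_dig_eq hi hj fun y _ => (dec_apply_eq_iff e i j y y).1 (congrFun h y)

theorem dec_mem_team {m c i : ℕ} (hi : i < a ^ m) : dec e i ∈ team e m c ↔ Bit c i := by
  constructor
  · rintro ⟨j, hj, hc, h⟩
    rwa [dec_inj e hi hj h]
  · exact fun h => ⟨i, hi, h, rfl⟩

theorem exists_dec_eq {m : ℕ} (s : ℕ → A)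
    (hs : ∀ y, m ≤ y → s y = e.symm ⟨0, pos_of_equiv e⟩) : ∃ i < a ^ m, dec e i = s := by
  have ha := pos_of_equiv e
  refine ⟨tab m a fun y => e (s y), tab_lt ha _ _, ?_⟩
  funext y
  rw [← e.apply_eq_iff_eq, Fin.ext_iff, coe_apply_dec]
  rcases lt_or_ge y m with hy | hy
  · rw [dig_tab ha _ hy, Nat.mod_eq_of_lt (e (s y)).2]
  · rw [dig_of_lt (tab_lt ha _ _) hy, hs y hy]
    simp

theorem dec_of_le {m i y : ℕ} (hi : i < a ^ m) (hy : m ≤ y) :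
    dec e i y = e.symm ⟨0, pos_of_equiv e⟩ := by
  simp [dec, dig_of_lt hi hy]

theorem exists_dec_eq_update {m i x : ℕ} (hi : i < a ^ m) (hx : x < m) (v : A) :
    ∃ j < a ^ m, dec e j = update (dec e i) x v :=
  exists_dec_eq e _ fun y hy => by
    rw [Function.update_of_ne (by omega), dec_of_le e hi hy]

theorem exists_team_eq {m : ℕ} (U : Set (ℕ → A)) (hU : ∀ s ∈ U, ∃ i < a ^ m, dec e i = s) :
    ∃ c < 2 ^ a ^ m, team e m c = U := by
  classical
  refine ⟨tab (a ^ m) 2 fun i => if dec e i ∈ U then 1 else 0, tab_lt two_pos _ _, ?_⟩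
  ext s
  constructor
  · rintro ⟨i, hi, h, rfl⟩
    rwa [bit_tab hi] at h
  · intro hs
    obtain ⟨i, hi, rfl⟩ := hU s hs
    exact ⟨i, hi, (bit_tab (p := fun i => dec e i ∈ U) hi).2 hs, rfl⟩

theorem set_ext_dec {m : ℕ} {U U' : Set (ℕ → A)} (hU : ∀ s ∈ U, ∃ i < a ^ m, dec e i = s)
    (hU' : ∀ s ∈ U', ∃ i < a ^ m, dec e i = s) :
    U = U' ↔ ∀ i < a ^ m, dec e i ∈ U ↔ dec e i ∈ U' := by
  constructor
  · rintro rfl i _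
    rfl
  · intro h
    ext s
    constructor
    · intro hs
      obtain ⟨i, hi, rfl⟩ := hU s hs
      exact (h i hi).1 hs
    · intro hs
      obtain ⟨i, hi, rfl⟩ := hU' s hs
      exact (h i hi).2 hs

theorem exists_dec_of_mem_team {m c : ℕ} : ∀ s ∈ team e m c, ∃ i < a ^ m, dec e i = s := by
  rintro _ ⟨i, hi, _, rfl⟩
  exact ⟨i, hi, rfl⟩

theorem exists_dec_of_mem_cyl {m x : ℕ} (hx : x < m) {U : Set (ℕ → A)}
    (hU : ∀ s ∈ U, ∃ i < a ^ m, dec e i = s) : ∀ s ∈ cyl x U, ∃ i < a ^ m, dec e i = s := by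
  rintro _ ⟨s, hs, v, rfl⟩
  obtain ⟨i, hi, rfl⟩ := hU s hs
  exact exists_dec_eq_update e hi hx v

theorem dec_mem_cyl_team {m c x i : ℕ} (hi : i < a ^ m) :
    dec e i ∈ cyl x (team e m c) ↔
      ∃ j < a ^ m, Bit c j ∧ ∀ z < m, z ≠ x → dig a i z = dig a j z := by
  constructor
  · rintro ⟨_, ⟨j, hj, hc, rfl⟩, v, h⟩
    refine ⟨j, hj, hc, fun z _ hzx => ?_⟩
    rw [← dec_apply_eq_iff e, h, Function.update_of_ne hzx]
  · rintro ⟨j, hj, hc, h⟩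
    refine ⟨_, ⟨j, hj, hc, rfl⟩, dec e i x, ?_⟩
    funext z
    by_cases hzx : z = x
    · simp [hzx]
    · rw [Function.update_of_ne hzx]
      rcases lt_or_ge z m with hz | hz
      · exact (dec_apply_eq_iff e i j z z).2 (h z hz hzx)
      · rw [dec_of_le e hi hz, dec_of_le e hj hz]

end Codes

/-! ### The operations on codes -/

namespace NExp

/-- The number whose low `m` bits are given by `g'`, and above them the digits `g` in base `B`;
here `m` is the variable `0`. -/
def table (w B g g' : NExp) : NExp :=
  add (mul (tabE w B g) (pow (const 2) (var 0))) (tabE (var 0) (const 2) (ind g'))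

/-- A table of truth values. -/
def truth (w g g' : NExp) : NExp := table w (const 2) (ind g) g'

theorem eval_table_div (w B g g' : NExp) (m : ℕ) (l : List ℕ) :
    (table w B g g').eval (m :: l) / 2 ^ m =
      tab (w.eval (m :: l)) (B.eval (m :: l)) fun i => g.eval (i :: m :: l) := by
  simp only [table, eval_add, eval_mul, eval_tabE, eval_pow, eval_const, eval_var,
    List.getD_cons_zero]
  rw [Nat.add_comm, Nat.add_mul_div_right _ _ (by positivity), Nat.div_eq_of_lt (tab_lt two_pos _ _),
    zero_add]

theorem bit_eval_table_mod (w B g g' : NExp) (m : ℕ) (l : List ℕ) {j : ℕ} (hj : j < m) :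
    Bit ((table w B g g').eval (m :: l) % 2 ^ m) j ↔ g'.Holds (j :: m :: l) := by
  simp only [table, eval_add, eval_mul, eval_tabE, eval_pow, eval_const, eval_var,
    List.getD_cons_zero, eval_ind]
  rw [Nat.add_comm, Nat.add_mul_mod_self_right, Nat.mod_eq_of_lt (tab_lt two_pos _ _), bit_tab hj]

theorem eval_table_le (w B g g' : NExp) (m : ℕ) (l : List ℕ) (hB : 0 < B.eval (m :: l)) :
    (table w B g g').eval (m :: l) ≤ B.eval (m :: l) ^ w.eval (m :: l) * 2 ^ m := by
  simp only [table, eval_add, eval_mul, eval_tabE, eval_pow, eval_const, eval_var,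
    List.getD_cons_zero]
  have h1 := tab_lt hB (w.eval (m :: l)) fun i => g.eval (i :: m :: l)
  have h2 := tab_lt two_pos m fun i => (ind g').eval (i :: m :: l)
  nlinarith [Nat.mul_le_mul_right (2 ^ m) (Nat.succ_le_of_lt h1)]

theorem bit_eval_truth_div (w g g' : NExp) (m : ℕ) (l : List ℕ) {i : ℕ} (hi : i < w.eval (m :: l)) :
    Bit ((truth w g g').eval (m :: l) / 2 ^ m) i ↔ g.Holds (i :: m :: l) := by
  rw [truth, eval_table_div]
  simp only [eval_ind, eval_const]
  exact bit_tab hi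

/-- The high part of the variable `v`. Expressions for operations are evaluated in the environment
`[m, x, y]` of the number of slots and the two arguments. Below `d` binders the number `m` is the
variable `d`; then this expression is said to be at the depth `d`. -/
def hi (d v : ℕ) : NExp := div (var v) (pow (const 2) (var d))

/-- The low part of the variable `v`, at the depth `d`. -/
def lo (d v : ℕ) : NExp := mod (var v) (pow (const 2) (var d))

variable (a q : ℕ)

/-- The number of the assignments, at the depth `d`. -/
def numAsg (d : ℕ) : NExp := pow (const a) (var d)

/-- The number of the teams, at the depth `d`. -/
def numTeam (d : ℕ) : NExp := pow (const 2) (numAsg a d)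

/-- The union of the masks of both arguments. As in the following masks, variable `0` is the slot,
and `m`, `x` and `y` are the variables `1`, `2` and `3`. -/
def maskUnion : NExp := or (bitE (lo 1 2) (var 0)) (bitE (lo 1 3) (var 0))

/-- The mask of the first argument with the slot in the second argument inserted. -/
def maskInsert : NExp := or (bitE (lo 1 2) (var 0)) (eq (var 0) (var 3))

/-- The mask of the first argument. -/
def maskSame : NExp := bitE (lo 1 2) (var 0)

/-- The mask of the second argument without the slot in the first argument. -/
def maskErase : NExp := and (bitE (lo 1 3) (var 0)) (not (eq (var 0) (var 2)))

/-- Append the value of a term to a tuple. -/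
def opTup : NExp :=
  table (numAsg a 0) (const (a ^ q))
    (add (mul (digE (const (a ^ q)) (hi 1 2) (var 0)) (const a)) (digE (const (a ^ q)) (hi 1 3) (var 0)))
    maskUnion

/-- Append the value of a slot to a tuple. -/
def opTupVar : NExp :=
  table (numAsg a 0) (const (a ^ q))
    (add (mul (digE (const (a ^ q)) (hi 1 2) (var 0)) (const a)) (digE (const a) (var 0) (var 3)))
    maskInsert

/-- Apply the function with the table `F` to a tuple. -/
def opFun (F : ℕ → ℕ) : NExp :=
  table (numAsg a 0) (const (a ^ q)) (lookup F (a ^ q) (digE (const (a ^ q)) (hi 1 2) (var 0)))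
    maskSame

/-- The formula that says that the tuple lies in the relation with the table `F`. -/
def opRel (F : ℕ → ℕ) : NExp :=
  truth (numTeam a 0) (all (numAsg a 1) (imp (bitE (var 1) (var 0))
    (lookup F (a ^ q) (digE (const (a ^ q)) (hi 2 3) (var 0))))) maskSame

/-- The negation of a first-order atom: no assignment of the team satisfies it. Whether the
assignment `i` satisfies the atom is read off from the bit of the team `{i}`, whose code is `2 ^ i`,
in the code of the atom. -/
def opNeg : NExp :=
  truth (numTeam a 0) (all (numAsg a 1) (imp (bitE (var 1) (var 0))
    (not (bitE (hi 2 3) (pow (const 2) (var 0)))))) maskSame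

/-- Add the pairs of assignments that disagree on a term. -/
def opDis : NExp :=
  truth (mul (numAsg a 0) (numAsg a 0)) (or (bitE (hi 1 2) (var 0))
    (not (eq (digE (const (a ^ q)) (hi 1 3) (div (var 0) (numAsg a 1)))
      (digE (const (a ^ q)) (hi 1 3) (mod (var 0) (numAsg a 1)))))) maskUnion

/-- Add the pairs of assignments that disagree on a slot. -/
def opDisVar : NExp :=
  truth (mul (numAsg a 0) (numAsg a 0)) (or (bitE (hi 1 2) (var 0))
    (not (eq (digE (const a) (div (var 0) (numAsg a 1)) (var 3))
      (digE (const a) (mod (var 0) (numAsg a 1)) (var 3))))) maskInsert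

/-- The dependence atom of two tuples, given by the pairs of assignments that disagree. -/
def opDep : NExp :=
  truth (numTeam a 0) (all (numAsg a 1) (all (numAsg a 2)
    (imp (and (bitE (var 2) (var 1)) (bitE (var 2) (var 0)))
      (imp (not (bitE (hi 3 4) (add (mul (var 1) (numAsg a 3)) (var 0))))
        (not (bitE (hi 3 5) (add (mul (var 1) (numAsg a 3)) (var 0)))))))) maskUnion

/-- Conjunction. -/
def opAnd : NExp :=
  truth (numTeam a 0) (and (bitE (hi 1 2) (var 0)) (bitE (hi 1 3) (var 0))) maskUnion

/-- Disjunction. -/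
def opOr : NExp :=
  truth (numTeam a 0) (ex (numTeam a 1) (ex (numTeam a 2)
    (and (all (numAsg a 3) (iff (or (bitE (var 2) (var 0)) (bitE (var 1) (var 0)))
        (bitE (var 3) (var 0))))
      (and (bitE (hi 3 4) (var 1)) (bitE (hi 3 5) (var 0)))))) maskUnion

/-- The assignment `i` lies in the cylinder over the team `T` in the direction of the slot `x`:
some element of `T` agrees with it in all slots but `x`. The arguments are the indices of variables
at the depth `d`, and each of the two bounded quantifiers shifts them by one. -/
def cylE (d T i x : ℕ) : NExp :=
  ex (numAsg a d) (and (bitE (var (T + 1)) (var 0)) (all (var (d + 1)) (imp (not (eq (var 0)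
    (var (x + 2)))) (eq (digE (const a) (var (i + 2)) (var 0)) (digE (const a) (var 1) (var 0))))))

/-- Existential quantification of the slot in the first argument. -/
def opEx : NExp :=
  truth (numTeam a 0) (ex (numTeam a 1) (and
    (all (numAsg a 2) (iff (cylE a 3 1 0 4) (cylE a 3 2 0 4)))
    (bitE (hi 2 4) (var 0)))) maskErase

/-- Universal quantification of the slot in the first argument. -/
def opAll : NExp :=
  truth (numTeam a 0) (ex (numTeam a 1) (and
    (all (numAsg a 2) (iff (bitE (var 1) (var 0)) (cylE a 3 2 0 4)))
    (bitE (hi 2 4) (var 0)))) maskErase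

/-- The acceptance condition: the team with the code `τ` satisfies the formula, and its free
variables are among the first `r` slots. -/
def opFinal (τ r : ℕ) : NExp :=
  ind (and (bitE (hi 0 1) (const τ)) (all (var 0) (imp (bitE (lo 1 2) (var 0))
    (le (succ (var 0)) (const r)))))

/-- An upper bound for all codes, in the environment `[m]`: the summands of the first factor bound
the tables for terms and tuples, for formulas, and for pairs of assignments. -/
def codeBound : NExp :=
  add (mul (add (add (pow (const (a ^ q)) (numAsg a 0)) (pow (const 2) (numTeam a 0)))
    (pow (const 2) (mul (numAsg a 0) (numAsg a 0)))) (pow (const 2) (var 0)))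
    (add (var 0) (const 1))

end NExp

section Rep

open NExp

variable {L : FirstOrder.Language.{0, 0}} {A : Type*} [L.Structure A] [Nonempty A] {a : ℕ}
  (e : A ≃ Fin a) (q m : ℕ) (σ : ℕ → ℕ)

/-- The low part of `c` is the mask of the slots of the variables in `V`. -/
def RepMask (V : Finset ℕ) (c : ℕ) : Prop := ∀ j < m, Bit (c % 2 ^ m) j ↔ ∃ x ∈ V, σ x = j

/-- `c` is a code of the term `t`: its high part is the table of the values of `t` under all
assignments, as digits in base `a ^ q`, so that tables of terms and of tuples have the same
format. -/
def RepTerm (t : L.Term ℕ) (c : ℕ) : Prop :=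
  (∀ i < a ^ m, dig (a ^ q) (c / 2 ^ m) i = e (slotVal σ (dec e i) t)) ∧ RepMask m σ t.varFinset c

/-- The number with the digits `l` in base `a`, the most significant one first. -/
def tupVal (a : ℕ) : List ℕ → ℕ
  | [] => 0
  | v :: l => v * a ^ l.length + tupVal a l

/-- `c` is a code of the tuple `ts` of terms: its high part is the table of the values, where a
tuple of at most `q` elements is a number below `a ^ q`. -/
def RepTuple (ts : List (L.Term ℕ)) (c : ℕ) : Prop :=
  (∀ i < a ^ m, dig (a ^ q) (c / 2 ^ m) i = tupVal a (ts.map fun t => (e (slotVal σ (dec e i) t) : ℕ))) ∧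
    RepMask m σ (tupleVars ts) c

/-- `c` is a code of the pairs of assignments that disagree on the tuple `ts`; the pair `(i, j)` has
the number `i * a ^ m + j`. Unlike the table of values, the size of this code does not depend on the
length of the tuple, which is unbounded in dependence atoms. -/
def RepDis (ts : List (L.Term ℕ)) (c : ℕ) : Prop :=
  (∀ i < a ^ m, ∀ j < a ^ m, Bit (c / 2 ^ m) (i * a ^ m + j) ↔
    ∃ t ∈ ts, slotVal σ (dec e i) t ≠ slotVal σ (dec e j) t) ∧ RepMask m σ (tupleVars ts) c

/-- `c` is a code of the formula `φ`: its high part says which teams satisfy `φ`, and its low part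
is the mask of the slots of the free variables. -/
def RepFml (φ : DFormula L) (c : ℕ) : Prop :=
  (∀ T < 2 ^ a ^ m, Bit (c / 2 ^ m) T ↔ SatS σ φ (team e m T)) ∧ RepMask m σ φ.free c

variable {e q m σ}

theorem tupVal_append (l : List ℕ) (v : ℕ) : tupVal a (l ++ [v]) = tupVal a l * a + v := by
  induction l with
  | nil => simp [tupVal]
  | cons w l ih =>
    simp only [List.cons_append, tupVal, ih, List.length_append, List.length_singleton, pow_succ]
    ring

theorem tupVal_lt {l : List ℕ} (hl : ∀ v ∈ l, v < a) : tupVal a l < a ^ l.length := by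
  induction l with
  | nil => simp [tupVal]
  | cons w l ih =>
    have h1 : w + 1 ≤ a := hl w (by simp)
    have h2 := ih fun v hv => hl v (by simp [hv])
    simp only [tupVal, List.length_cons, pow_succ]
    nlinarith [Nat.mul_le_mul_right (a ^ l.length) h1]

theorem tupVal_inj {l l' : List ℕ} (hl : ∀ v ∈ l, v < a) (hl' : ∀ v ∈ l', v < a)
    (hlen : l.length = l'.length) (h : tupVal a l = tupVal a l') : l = l' := by
  induction l generalizing l' with
  | nil => exact (List.eq_nil_of_length_eq_zero hlen.symm).symm
  | cons w l ih =>
    cases l' with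
    | nil => simp at hlen
    | cons w' l' =>
      simp only [List.length_cons, Nat.add_right_cancel_iff] at hlen
      have hm : ∀ v ∈ l, v < a := fun v hv => hl v (by simp [hv])
      have hm' : ∀ v ∈ l', v < a := fun v hv => hl' v (by simp [hv])
      have h1 := tupVal_lt hm
      have h2 := tupVal_lt hm'
      simp only [tupVal, hlen] at h h1
      have hp : 0 < a ^ l'.length := by omega
      have hd := congrArg (· / a ^ l'.length) h
      simp only [Nat.add_comm (_ * _), Nat.add_mul_div_right _ _ hp, Nat.div_eq_of_lt h1,
        Nat.div_eq_of_lt h2, zero_add] at hd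
      subst hd
      rw [ih hm hm' hlen (by omega)]

theorem RepMask.union {V W : Finset ℕ} {x y c : ℕ} (hx : RepMask m σ V x) (hy : RepMask m σ W y)
    (h : ∀ j < m, Bit (c % 2 ^ m) j ↔ maskUnion.Holds [j, m, x, y]) : RepMask m σ (V ∪ W) c := by
  intro j hj
  rw [h j hj]
  simp [maskUnion, lo, hx j hj, hy j hj, Finset.mem_union, or_and_right, exists_or]

theorem RepMask.insert {V : Finset ℕ} {x v c : ℕ} (hx : RepMask m σ V x)
    (h : ∀ j < m, Bit (c % 2 ^ m) j ↔ maskInsert.Holds [j, m, x, σ v]) :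
    RepMask m σ (V ∪ {v}) c := by
  intro j hj
  rw [h j hj]
  simp [maskInsert, lo, hx j hj, or_and_right, exists_or, eq_comm, or_comm]

theorem RepMask.same {V : Finset ℕ} {x y c : ℕ} (hx : RepMask m σ V x)
    (h : ∀ j < m, Bit (c % 2 ^ m) j ↔ maskSame.Holds [j, m, x, y]) : RepMask m σ V c := by
  intro j hj
  rw [h j hj]
  simp [maskSame, lo, hx j hj]

theorem RepMask.erase {V : Finset ℕ} {v y c : ℕ} (hy : RepMask m σ V y)
    (hv : ∀ v' , σ v' = σ v → v' = v)
    (h : ∀ j < m, Bit (c % 2 ^ m) j ↔ maskErase.Holds [j, m, σ v, y]) :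
    RepMask m σ (V.erase v) c := by
  intro j hj
  rw [h j hj]
  simp only [maskErase, lo, holds_and, holds_bitE, eval_mod, eval_pow, eval_var, eval_const,
    holds_not, holds_eq, List.getD_cons_zero, List.getD_cons_succ, hy j hj, Finset.mem_erase]
  constructor
  · rintro ⟨⟨x, hx, rfl⟩, hne⟩
    exact ⟨x, ⟨fun h => hne (by rw [h]), hx⟩, rfl⟩
  · rintro ⟨x, ⟨hne, hx⟩, rfl⟩
    exact ⟨⟨x, hx, rfl⟩, fun h => hne (hv x h)⟩

end Rep

section Ops

open NExp

variable {L : FirstOrder.Language.{0, 0}} {A : Type*} [L.Structure A] [Nonempty A] {a : ℕ}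
  {e : A ≃ Fin a} {q m : ℕ} {σ : ℕ → ℕ}

theorem repMask_empty : RepMask m σ ∅ 0 := fun j _ => by simp [Bit, dig]

theorem repTuple_nil : RepTuple e q m σ ([] : List (L.Term ℕ)) 0 :=
  ⟨fun i _ => by simp [dig, tupVal], repMask_empty⟩

theorem repDis_nil : RepDis e m σ ([] : List (L.Term ℕ)) 0 :=
  ⟨fun i _ j _ => by simp [Bit, dig], repMask_empty⟩

theorem tupleVars_append_singleton (ts : List (L.Term ℕ)) (t : L.Term ℕ) :
    tupleVars (ts ++ [t]) = tupleVars ts ∪ t.varFinset := by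
  ext v
  simp only [Finset.mem_union, mem_tupleVars, List.mem_append, List.mem_singleton]
  constructor
  · rintro ⟨r, hr | rfl, hv⟩
    exacts [.inl ⟨r, hr, hv⟩, .inr hv]
  · rintro (⟨r, hr, hv⟩ | hv)
    exacts [⟨r, .inl hr, hv⟩, ⟨t, .inr rfl, hv⟩]

theorem tupVal_slotVal_lt (ts : List (L.Term ℕ)) (hl : ts.length ≤ q) (s : ℕ → A) :
    tupVal a (ts.map fun t => (e (slotVal σ s t) : ℕ)) < a ^ q := by
  refine lt_of_lt_of_le (tupVal_lt ?_) (Nat.pow_le_pow_right (pos_of_equiv e) (by simpa using hl))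
  simp

theorem RepTuple.append {ts : List (L.Term ℕ)} {t : L.Term ℕ} {x y : ℕ}
    (hx : RepTuple e q m σ ts x) (hy : RepTerm e q m σ t y) (hl : ts.length < q) :
    RepTuple e q m σ (ts ++ [t]) ((opTup a q).eval [m, x, y]) := by
  have ha := pos_of_equiv e
  refine ⟨fun i hi => ?_, ?_⟩
  · rw [opTup, eval_table_div]
    simp only [numAsg, eval_pow, eval_const, eval_var, List.getD_cons_zero]
    rw [dig_tab (by positivity) _ hi]
    simp only [hi, eval_add, eval_mul, eval_digE, NExp.hi, eval_div, eval_pow, eval_const, eval_var,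
      List.getD_cons_zero, List.getD_cons_succ, hx.1, hy.1]
    have := tupVal_slotVal_lt (e := e) (σ := σ) (q := q) (ts ++ [t]) (by simpa using hl) (dec e i)
    rw [List.map_append, List.map_singleton, tupVal_append] at this ⊢
    exact Nat.mod_eq_of_lt this
  · rw [tupleVars_append_singleton]
    exact hx.2.union hy.2 fun j hj => bit_eval_table_mod _ _ _ _ _ _ hj

theorem RepTuple.appendVar {ts : List (L.Term ℕ)} {v x : ℕ} (hx : RepTuple e q m σ ts x)
    (hl : ts.length < q) :
    RepTuple e q m σ (ts ++ [.var v]) ((opTupVar a q).eval [m, x, σ v]) := by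
  have ha := pos_of_equiv e
  refine ⟨fun i hi => ?_, ?_⟩
  · rw [opTupVar, eval_table_div]
    simp only [numAsg, eval_pow, eval_const, eval_var, List.getD_cons_zero]
    rw [dig_tab (by positivity) _ hi]
    simp only [hi, eval_add, eval_mul, eval_digE, NExp.hi, eval_div, eval_pow, eval_const, eval_var,
      List.getD_cons_zero, List.getD_cons_succ, hx.1]
    have := tupVal_slotVal_lt (e := e) (σ := σ) (q := q) (ts ++ [.var v]) (by simpa using hl) (dec e i)
    rw [List.map_append, List.map_singleton, tupVal_append, slotVal,
      FirstOrder.Language.Term.realize_var, coe_apply_dec] at this ⊢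
    exact Nat.mod_eq_of_lt this
  · rw [tupleVars_append_singleton]
    exact hx.2.insert fun j hj => bit_eval_table_mod _ _ _ _ _ _ hj

open Classical in
/-- The table of a function of a tuple, indexed by the code of the tuple. -/
noncomputable def tupTable (e : A ≃ Fin a) {n : ℕ} (f : (Fin n → A) → ℕ) (d : ℕ) : ℕ :=
  if h : ∃ v : Fin n → A, tupVal a (List.ofFn fun i => (e (v i) : ℕ)) = d then f h.choose else 0

theorem tupTable_apply {n : ℕ} (f : (Fin n → A) → ℕ) (v : Fin n → A) :
    tupTable e f (tupVal a (List.ofFn fun i => (e (v i) : ℕ))) = f v := by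
  have h : ∃ w : Fin n → A, tupVal a (List.ofFn fun i => (e (w i) : ℕ)) =
    tupVal a (List.ofFn fun i => (e (v i) : ℕ)) := ⟨v, rfl⟩
  rw [tupTable, dif_pos h]
  congr 1
  have := tupVal_inj (a := a) (by simp [List.mem_ofFn]) (by simp [List.mem_ofFn]) (by simp)
    h.choose_spec
  rw [List.ofFn_inj] at this
  funext i
  exact e.injective (Fin.ext (congrFun this i))

theorem map_ofFn_slotVal {n : ℕ} (ts : Fin n → L.Term ℕ) (s : ℕ → A) :
    (List.ofFn ts).map (fun t => (e (slotVal σ s t) : ℕ)) =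
      List.ofFn fun i => (e (slotVal σ s (ts i)) : ℕ) := by
  rw [List.map_ofFn]
  rfl

theorem tupleVars_ofFn {n : ℕ} (ts : Fin n → L.Term ℕ) :
    tupleVars (List.ofFn ts) = Finset.univ.biUnion fun i => (ts i).varFinset := by
  ext v
  simp [mem_tupleVars, List.mem_ofFn]

/-- The table of the function symbol `f`. -/
noncomputable def funTable (e : A ≃ Fin a) {n : ℕ} (f : L.Functions n) : ℕ → ℕ :=
  tupTable e fun v => (e (FirstOrder.Language.Structure.funMap f v) : ℕ)

open Classical in
/-- The table of the relation symbol `R`. -/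
noncomputable def relTable (e : A ≃ Fin a) {n : ℕ} (R : L.Relations n) : ℕ → ℕ :=
  tupTable e fun v => if FirstOrder.Language.Structure.RelMap R v then 1 else 0

open Classical in
/-- The table of equality. -/
noncomputable def eqTable (e : A ≃ Fin a) : ℕ → ℕ :=
  tupTable e fun v : Fin 2 → A => if v 0 = v 1 then 1 else 0

theorem RepTuple.func {n : ℕ} {f : L.Functions n} {ts : Fin n → L.Term ℕ} {x y : ℕ}
    (hx : RepTuple e q m σ (List.ofFn ts) x) (hn : n ≤ q) (hq : 0 < q) :
    RepTerm e q m σ (.func f ts) ((opFun a q (funTable e f)).eval [m, x, y]) := by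
  have ha := pos_of_equiv e
  refine ⟨fun i hi => ?_, ?_⟩
  · rw [opFun, eval_table_div]
    simp only [numAsg, eval_pow, eval_const, eval_var, List.getD_cons_zero]
    rw [dig_tab (by positivity) _ hi]
    have hd : (digE (const (a ^ q)) (NExp.hi 1 2) (var 0)).eval [i, m, x, y] =
        tupVal a (List.ofFn fun j => (e (slotVal σ (dec e i) (ts j)) : ℕ)) := by
      simp only [eval_digE, NExp.hi, eval_div, eval_pow, eval_const, eval_var,
        List.getD_cons_zero, List.getD_cons_succ, hx.1 i hi, map_ofFn_slotVal]
    have hlt := tupVal_slotVal_lt (e := e) (σ := σ) (q := q) (List.ofFn ts) (by simpa using hn) (dec e i)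
    rw [map_ofFn_slotVal] at hlt
    rw [eval_lookup _ _ _ _ (hd ▸ hlt), hd, funTable, tupTable_apply]
    refine Nat.mod_eq_of_lt (lt_of_lt_of_le (Fin.is_lt _) ?_)
    exact Nat.le_self_pow hq.ne' a
  · have : (FirstOrder.Language.Term.func f ts).varFinset = tupleVars (List.ofFn ts) := by
      rw [tupleVars_ofFn]
      rfl
    rw [this]
    exact hx.2.same fun j hj => bit_eval_table_mod _ _ _ _ _ _ hj

/-- The codes of the atoms that test a relation on a tuple; this covers relation symbols and
equality. -/
theorem RepTuple.flat {n : ℕ} {ts : Fin n → L.Term ℕ} {x y : ℕ} {p : (Fin n → A) → Prop}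
    {F : (Fin n → A) → ℕ} (hF : ∀ v, F v ≠ 0 ↔ p v) (hx : RepTuple e q m σ (List.ofFn ts) x)
    (hn : n ≤ q) {T : ℕ} (hT : T < 2 ^ a ^ m) :
    Bit ((opRel a q (tupTable e F)).eval [m, x, y] / 2 ^ m) T ↔
      ∀ s ∈ team e m T, p fun i => slotVal σ s (ts i) := by
  rw [opRel, bit_eval_truth_div _ _ _ _ _ (by simpa [numTeam, numAsg] using hT)]
  simp only [holds_all, numAsg, eval_pow, eval_const, eval_var, List.getD_cons_zero,
    List.getD_cons_succ, holds_imp, holds_bitE]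
  have key : ∀ i < a ^ m, (lookup (tupTable e F) (a ^ q) (digE (const (a ^ q)) (NExp.hi 2 3)
      (var 0))).Holds [i, T, m, x, y] ↔ p fun j => slotVal σ (dec e i) (ts j) := by
    intro i hi
    have hd : (digE (const (a ^ q)) (NExp.hi 2 3) (var 0)).eval [i, T, m, x, y] =
        tupVal a (List.ofFn fun j => (e (slotVal σ (dec e i) (ts j)) : ℕ)) := by
      simp only [eval_digE, NExp.hi, eval_div, eval_pow, eval_const, eval_var,
        List.getD_cons_zero, List.getD_cons_succ, hx.1 i hi, map_ofFn_slotVal]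
    have hlt := tupVal_slotVal_lt (e := e) (σ := σ) (q := q) (List.ofFn ts) (by simpa using hn) (dec e i)
    rw [map_ofFn_slotVal] at hlt
    rw [Holds, eval_lookup _ _ _ _ (hd ▸ hlt), hd, tupTable_apply, hF]
  constructor
  · rintro h _ ⟨i, hi, hb, rfl⟩
    exact (key i hi).1 (h i hi hb)
  · intro h i hi hb
    exact (key i hi).2 (h _ ⟨i, hi, hb, rfl⟩)

theorem RepTuple.rel {n : ℕ} {R : L.Relations n} {ts : Fin n → L.Term ℕ} {x y : ℕ}
    (hx : RepTuple e q m σ (List.ofFn ts) x) (hn : n ≤ q) :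
    RepFml e m σ (.rel R ts) ((opRel a q (relTable e R)).eval [m, x, y]) := by
  refine ⟨fun T hT => ?_, ?_⟩
  · exact hx.flat (p := fun v => FirstOrder.Language.Structure.RelMap R v) (by simp) hn hT
  · rw [DFormula.free, ← tupleVars_ofFn]
    exact hx.2.same fun j hj => bit_eval_table_mod _ _ _ _ _ _ hj

theorem RepTuple.eq {t₁ t₂ : L.Term ℕ} {x y : ℕ} (hx : RepTuple e q m σ [t₁, t₂] x) (hq : 2 ≤ q) :
    RepFml e m σ (.eq t₁ t₂) ((opRel a q (eqTable e)).eval [m, x, y]) := by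
  refine ⟨fun T hT => ?_, ?_⟩
  · exact RepTuple.flat (ts := ![t₁, t₂]) (p := fun v : Fin 2 → A => v 0 = v 1) (by simp)
      (by simpa [List.ofFn_succ] using hx) hq hT
  · have : (DFormula.eq t₁ t₂).free = tupleVars [t₁, t₂] := by
      simp [DFormula.free, tupleVars]
    rw [this]
    exact hx.2.same fun j hj => bit_eval_table_mod _ _ _ _ _ _ hj

theorem RepFml.neg {n : ℕ} {R : L.Relations n} {ts : Fin n → L.Term ℕ} {x y : ℕ}
    (hx : RepFml e m σ (.rel R ts) x) :
    RepFml e m σ (.nrel R ts) ((opNeg a).eval [m, x, y]) := by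
  refine ⟨fun T hT => ?_, hx.2.same fun j hj => bit_eval_table_mod _ _ _ _ _ _ hj⟩
  rw [opNeg, bit_eval_truth_div _ _ _ _ _ (by simpa [numTeam, numAsg] using hT)]
  simp only [holds_all, numAsg, eval_pow, eval_const, eval_var, List.getD_cons_zero,
    List.getD_cons_succ, holds_imp, holds_bitE, holds_not, NExp.hi, eval_div, SatS]
  have key : ∀ i < a ^ m, Bit (x / 2 ^ m) (2 ^ i) ↔
      FirstOrder.Language.Structure.RelMap R fun j => slotVal σ (dec e i) (ts j) := by
    intro i hi
    rw [hx.1 _ (Nat.pow_lt_pow_right one_lt_two hi)]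
    have hbit : ∀ j, Bit (2 ^ i) j ↔ j = i := by
      intro j
      rw [Bit, dig]
      rcases lt_trichotomy j i with h | rfl | h
      · obtain ⟨d, rfl⟩ := Nat.exists_eq_add_of_lt h
        rw [show 2 ^ (j + d + 1) = 2 ^ j * (2 * 2 ^ d) by ring, Nat.mul_div_cancel_left _ (by positivity)]
        simp
        omega
      · simp [Nat.div_self]
      · rw [Nat.div_eq_of_lt (Nat.pow_lt_pow_right one_lt_two h)]
        simp; omega
    constructor
    · exact fun h => h _ ⟨i, hi, (hbit i).2 rfl, rfl⟩
    · rintro h _ ⟨j, hj, hb, rfl⟩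
      rwa [(hbit j).1 hb]
  constructor
  · rintro h _ ⟨i, hi, hb, rfl⟩ hR
    exact h i hi hb ((key i hi).2 hR)
  · intro h i hi hb hR
    exact h _ ⟨i, hi, hb, rfl⟩ ((key i hi).1 hR)

theorem mul_add_lt {i j n : ℕ} (hi : i < n) (hj : j < n) : i * n + j < n * n := by nlinarith

theorem RepDis.append {ts : List (L.Term ℕ)} {t : L.Term ℕ} {x y : ℕ} (hx : RepDis e m σ ts x)
    (hy : RepTerm e q m σ t y) : RepDis e m σ (ts ++ [t]) ((opDis a q).eval [m, x, y]) := by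
  refine ⟨fun i hi j hj => ?_, ?_⟩
  · rw [opDis, bit_eval_truth_div _ _ _ _ _ (by simpa [numAsg] using mul_add_lt hi hj)]
    have hpos : 0 < a ^ m := by omega
    have h1 : (i * a ^ m + j) / a ^ m = i := by
      rw [Nat.add_comm, Nat.add_mul_div_right _ _ hpos, Nat.div_eq_of_lt hj, zero_add]
    have h2 : (i * a ^ m + j) % a ^ m = j := by
      rw [Nat.add_comm, Nat.add_mul_mod_self_right, Nat.mod_eq_of_lt hj]
    simp only [numAsg, eval_pow, eval_const, eval_var, List.getD_cons_zero, eval_mod,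
      List.getD_cons_succ, holds_or, holds_bitE, holds_not, NExp.hi, eval_div, holds_eq, eval_digE,
      h1, h2, hx.1 i hi j hj, hy.1 i hi, hy.1 j hj, List.mem_append, List.mem_singleton,
      or_and_right, exists_or, exists_eq_left, ← Fin.ext_iff, e.apply_eq_iff_eq, ne_eq]
  · rw [tupleVars_append_singleton]
    exact hx.2.union hy.2 fun j hj => bit_eval_table_mod _ _ _ _ _ _ hj

theorem RepDis.appendVar {ts : List (L.Term ℕ)} {v x : ℕ} (hx : RepDis e m σ ts x) :
    RepDis e m σ (ts ++ [.var v]) ((opDisVar a).eval [m, x, σ v]) := by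
  refine ⟨fun i hi j hj => ?_, ?_⟩
  · rw [opDisVar, bit_eval_truth_div _ _ _ _ _ (by simpa [numAsg] using mul_add_lt hi hj)]
    have hpos : 0 < a ^ m := by omega
    have h1 : (i * a ^ m + j) / a ^ m = i := by
      rw [Nat.add_comm, Nat.add_mul_div_right _ _ hpos, Nat.div_eq_of_lt hj, zero_add]
    have h2 : (i * a ^ m + j) % a ^ m = j := by
      rw [Nat.add_comm, Nat.add_mul_mod_self_right, Nat.mod_eq_of_lt hj]
    simp only [numAsg, eval_pow, eval_const, eval_var, List.getD_cons_zero, eval_mod,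
      List.getD_cons_succ, holds_or, holds_bitE, holds_not, NExp.hi, eval_div, holds_eq, eval_digE,
      h1, h2, hx.1 i hi j hj, List.mem_append, List.mem_singleton, slotVal,
      or_and_right, exists_or, exists_eq_left, ne_eq, FirstOrder.Language.Term.realize_var,
      dec_apply_eq_iff]
  · rw [tupleVars_append_singleton]
    exact hx.2.insert fun j hj => bit_eval_table_mod _ _ _ _ _ _ hj

theorem RepDis.dep {t u : List (L.Term ℕ)} {x y : ℕ} (hx : RepDis e m σ t x)
    (hy : RepDis e m σ u y) : RepFml e m σ (.dep t u) ((opDep a).eval [m, x, y]) := by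
  refine ⟨fun T hT => ?_, hx.2.union hy.2 fun j hj => bit_eval_table_mod _ _ _ _ _ _ hj⟩
  rw [opDep, bit_eval_truth_div _ _ _ _ _ (by simpa [numTeam, numAsg] using hT)]
  simp only [holds_all, numAsg, eval_pow, eval_const, eval_var, List.getD_cons_zero, holds_and,
    List.getD_cons_succ, holds_imp, holds_bitE, holds_not, NExp.hi, eval_div, eval_add, eval_mul]
  constructor
  · rintro h _ ⟨i, hi, hbi, rfl⟩ _ ⟨j, hj, hbj, rfl⟩ ht
    have := h i hi j hj ⟨hbi, hbj⟩
    rw [hx.1 i hi j hj, hy.1 i hi j hj] at this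
    push Not at this
    exact this ht
  · intro h i hi j hj hb
    have := h _ ⟨i, hi, hb.1, rfl⟩ _ ⟨j, hj, hb.2, rfl⟩
    rw [hx.1 i hi j hj, hy.1 i hi j hj]
    push Not
    exact this

theorem RepFml.and {φ ψ : DFormula L} {x y : ℕ} (hx : RepFml e m σ φ x) (hy : RepFml e m σ ψ y) :
    RepFml e m σ (.and φ ψ) ((opAnd a).eval [m, x, y]) := by
  refine ⟨fun T hT => ?_, hx.2.union hy.2 fun j hj => bit_eval_table_mod _ _ _ _ _ _ hj⟩
  rw [opAnd, bit_eval_truth_div _ _ _ _ _ (by simpa [numTeam, numAsg] using hT)]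
  simp only [eval_pow, eval_const, eval_var, List.getD_cons_zero, holds_and,
    List.getD_cons_succ, holds_bitE, NExp.hi, eval_div, hx.1 T hT, hy.1 T hT, SatS]

theorem union_team_eq_iff {T₀ T₁ T : ℕ} : team e m T₀ ∪ team e m T₁ = team e m T ↔
    ∀ i < a ^ m, (Bit T₀ i ∨ Bit T₁ i) ↔ Bit T i := by
  rw [set_ext_dec e (m := m) ?_ (exists_dec_of_mem_team e)]
  · refine forall₂_congr fun i hi => ?_
    rw [Set.mem_union, dec_mem_team e hi, dec_mem_team e hi, dec_mem_team e hi]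
  · rintro s (h | h)
    exacts [exists_dec_of_mem_team e s h, exists_dec_of_mem_team e s h]

theorem RepFml.or {φ ψ : DFormula L} {x y : ℕ} (hx : RepFml e m σ φ x) (hy : RepFml e m σ ψ y) :
    RepFml e m σ (.or φ ψ) ((opOr a).eval [m, x, y]) := by
  refine ⟨fun T hT => ?_, hx.2.union hy.2 fun j hj => bit_eval_table_mod _ _ _ _ _ _ hj⟩
  rw [opOr, bit_eval_truth_div _ _ _ _ _ (by simpa [numTeam, numAsg] using hT)]
  simp only [eval_pow, eval_const, eval_var, List.getD_cons_zero, holds_and, holds_ex, holds_all,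
    holds_iff, holds_or, List.getD_cons_succ, holds_bitE, NExp.hi, eval_div, SatS, numTeam, numAsg]
  constructor
  · rintro ⟨T₀, h₀, T₁, h₁, h, hφ, hψ⟩
    exact ⟨_, _, union_team_eq_iff.2 h, (hx.1 T₀ h₀).1 hφ, (hy.1 T₁ h₁).1 hψ⟩
  · rintro ⟨U₀, U₁, h, hφ, hψ⟩
    obtain ⟨T₀, h₀, rfl⟩ := exists_team_eq e (m := m) U₀ fun s hs =>
      exists_dec_of_mem_team e s (h ▸ .inl hs : s ∈ team e m T)
    obtain ⟨T₁, h₁, rfl⟩ := exists_team_eq e (m := m) U₁ fun s hs =>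
      exists_dec_of_mem_team e s (h ▸ .inr hs : s ∈ team e m T)
    exact ⟨T₀, h₀, T₁, h₁, union_team_eq_iff.1 h, (hx.1 T₀ h₀).2 hφ, (hy.1 T₁ h₁).2 hψ⟩

theorem holds_cylE {d T i x : ℕ} {l : List ℕ} (hm : l.getD d 0 = m) (hi : l.getD i 0 < a ^ m) :
    (cylE a d T i x).Holds l ↔ dec e (l.getD i 0) ∈ cyl (l.getD x 0) (team e m (l.getD T 0)) := by
  rw [dec_mem_cyl_team e hi, cylE]
  simp only [numAsg, eval_pow, eval_const, eval_var, holds_and, holds_ex, holds_all,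
    holds_imp, List.getD_cons_succ, holds_bitE, List.getD_cons_zero, holds_not, holds_eq, eval_digE,
    hm]

theorem RepFml.ex {φ : DFormula L} {v y : ℕ} (hv : σ v < m) (hinj : ∀ v', σ v' = σ v → v' = v)
    (hy : RepFml e m σ φ y) : RepFml e m σ (.ex v φ) ((opEx a).eval [m, σ v, y]) := by
  refine ⟨fun T hT => ?_, hy.2.erase hinj fun j hj => bit_eval_table_mod _ _ _ _ _ _ hj⟩
  rw [opEx, bit_eval_truth_div _ _ _ _ _ (by simpa [numTeam, numAsg] using hT)]
  simp only [eval_pow, eval_const, eval_var, List.getD_cons_zero, holds_and, holds_ex, holds_all,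
    holds_iff, List.getD_cons_succ, holds_bitE, NExp.hi, eval_div, SatS, numTeam, numAsg]
  have key : ∀ T', (∀ i < a ^ m, (cylE a 3 1 0 4).Holds [i, T', T, m, σ v, y] ↔
      (cylE a 3 2 0 4).Holds [i, T', T, m, σ v, y]) ↔
      cyl (σ v) (team e m T') = cyl (σ v) (team e m T) := by
    intro T'
    rw [set_ext_dec e (exists_dec_of_mem_cyl e hv (exists_dec_of_mem_team e))
      (exists_dec_of_mem_cyl e hv (exists_dec_of_mem_team e))]
    refine forall₂_congr fun i hi => ?_
    rw [holds_cylE (e := e) (m := m) (by simp) (by simpa using hi),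
      holds_cylE (e := e) (m := m) (by simp) (by simpa using hi)]
    simp
  constructor
  · rintro ⟨T', hT', h, hφ⟩
    exact ⟨_, (key T').1 h, (hy.1 T' hT').1 hφ⟩
  · rintro ⟨U, hU, hφ⟩
    obtain ⟨T', hT', rfl⟩ := exists_team_eq e (m := m) U fun s hs =>
      exists_dec_of_mem_cyl e hv (exists_dec_of_mem_team e) s (hU ▸ cyl_self hs)
    exact ⟨T', hT', (key T').2 hU, (hy.1 T' hT').2 hφ⟩

theorem RepFml.all {φ : DFormula L} {v y : ℕ} (hv : σ v < m) (hinj : ∀ v', σ v' = σ v → v' = v)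
    (hy : RepFml e m σ φ y) : RepFml e m σ (.all v φ) ((opAll a).eval [m, σ v, y]) := by
  refine ⟨fun T hT => ?_, hy.2.erase hinj fun j hj => bit_eval_table_mod _ _ _ _ _ _ hj⟩
  rw [opAll, bit_eval_truth_div _ _ _ _ _ (by simpa [numTeam, numAsg] using hT)]
  simp only [eval_pow, eval_const, eval_var, List.getD_cons_zero, holds_and, holds_ex, holds_all,
    holds_iff, List.getD_cons_succ, holds_bitE, NExp.hi, eval_div, SatS, numTeam, numAsg]
  have key : ∀ T', (∀ i < a ^ m, Bit T' i ↔ (cylE a 3 2 0 4).Holds [i, T', T, m, σ v, y]) ↔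
      team e m T' = cyl (σ v) (team e m T) := by
    intro T'
    rw [set_ext_dec e (exists_dec_of_mem_team e)
      (exists_dec_of_mem_cyl e hv (exists_dec_of_mem_team e))]
    refine forall₂_congr fun i hi => ?_
    rw [holds_cylE (e := e) (m := m) (by simp) (by simpa using hi), dec_mem_team e hi]
    simp
  constructor
  · rintro ⟨T', hT', h, hφ⟩
    rw [← (key T').1 h]
    exact (hy.1 T' hT').1 hφ
  · intro hφ
    obtain ⟨T', hT', h⟩ := exists_team_eq e (m := m) _
      (exists_dec_of_mem_cyl e hv (exists_dec_of_mem_team e (m := m) (c := T)))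
    exact ⟨T', hT', (key T').2 h, (hy.1 T' hT').2 (h ▸ hφ)⟩

theorem RepFml.final {φ : DFormula L} {x y τ r : ℕ} (hx : RepFml e m σ φ x) (hτ : τ < 2 ^ a ^ m)
    (hσ : ∀ v ∈ φ.free, σ v < m) : (opFinal τ r).Holds [m, x, y] ↔
      SatS σ φ (team e m τ) ∧ ∀ v ∈ φ.free, σ v < r := by
  simp only [opFinal, ind, holds_not, not_not, holds_and, holds_bitE, NExp.hi, lo, eval_div, eval_mod, eval_pow, eval_const, eval_var, holds_all,
    holds_imp, List.getD_cons_zero, List.getD_cons_succ, holds_le, eval_succ, hx.1 τ hτ]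
  refine and_congr_right fun _ => ⟨fun h v hv => h (σ v) (hσ v hv) ((hx.2 _ (hσ v hv)).2 ⟨v, hv, rfl⟩),
    fun h j hj hb => ?_⟩
  obtain ⟨v, hv, rfl⟩ := (hx.2 j hj).1 hb
  exact h v hv

end Ops

/-! ### Parsing from right to left -/

section Binary

open Computability

theorem encodePosNum_decodePosNum : ∀ {l : List Bool}, l.getLast? = some true →
    encodePosNum (decodePosNum l) = l
  | [], h => by simp at h
  | [true], _ => by simp [decodePosNum, encodePosNum]
  | [false], h => by simp at h
  | false :: b :: l, h => by
    rw [decodePosNum, encodePosNum, encodePosNum_decodePosNum (by simpa using h)]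
  | true :: b :: l, h => by
    rw [decodePosNum, if_neg (by simp), encodePosNum, encodePosNum_decodePosNum (by simpa using h)]

/-- A word of bits is the binary representation of a number iff it is empty or ends with `true`. -/
theorem encodeNat_decodeNat {l : List Bool} (h : l = [] ∨ l.getLast? = some true) :
    encodeNat (decodeNat l) = l := by
  have : encodeNat (decodeNat l) = encodeNum (decodeNum l) := by
    rw [encodeNat, decodeNat, Num.of_to_nat]
  rw [this, decodeNum]
  rcases h with rfl | h
  · rfl
  · have hl : l ≠ [] := by rintro rfl; simp at h
    rw [if_neg hl, PosNum.cast_to_num]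
    exact encodePosNum_decodePosNum h

theorem getLast?_encodePosNum (n : PosNum) : (encodePosNum n).getLast? = some true := by
  induction n with
  | one => rfl
  | bit0 n ih => rw [encodePosNum, List.getLast?_cons, ih]; rfl
  | bit1 n ih => rw [encodePosNum, List.getLast?_cons, ih]; rfl

theorem encodeNat_eq_nil_or (n : ℕ) :
    encodeNat n = [] ∨ (encodeNat n).getLast? = some true := by
  rw [encodeNat]
  cases (n : Num) with
  | zero => exact .inl rfl
  | pos n => exact .inr (getLast?_encodePosNum n)

end Binary

variable {L : FirstOrder.Language.{0, 0}}

/-- The objects on the stack of the parser: variables, compound terms, formulas, relational atoms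
(which may still be negated), and the two marks inside dependence atoms, where the semicolon
carries the terms to its right. -/
inductive Obj (L : FirstOrder.Language.{0, 0}) : Type
  | var (x : ℕ)
  | term (t : L.Term ℕ)
  | fml (φ : DFormula L)
  | atom {n : ℕ} (R : L.Relations n) (t : Fin n → L.Term ℕ)
  | close
  | semi (u : List (L.Term ℕ))

namespace Obj

/-- The term that an object stands for. -/
def term? : Obj L → Option (L.Term ℕ)
  | var x => some (.var x)
  | term t => some t
  | _ => none

/-- The formula that an object stands for. -/
def fml? : Obj L → Option (DFormula L)
  | fml φ => some φ
  | atom R t => some (.rel R t)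
  | _ => none

/-- The word that an object has been read from. -/
def enc : Obj L → List (Letter L)
  | var x => encodeVar L x
  | term t => encodeTerm t
  | fml φ => encodeFormula φ
  | atom R t => encodeFormula (.rel R t)
  | close => [.close]
  | semi u => .semicolon :: ((u.map encodeTerm).flatten ++ [.close])

/-- The object for a term. -/
def ofTerm : L.Term ℕ → Obj L
  | .var x => var x
  | .func f t => term (.func f t)

/-- The object for a formula. -/
def ofFml : DFormula L → Obj L
  | .rel R t => atom R t
  | φ => fml φ

@[simp] theorem term?_ofTerm (t : L.Term ℕ) : (ofTerm t).term? = some t := by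
  cases t <;> rfl

@[simp] theorem fml?_ofFml (φ : DFormula L) : (ofFml φ).fml? = some φ := by
  cases φ <;> rfl

theorem enc_of_term? {o : Obj L} {t : L.Term ℕ} (h : o.term? = some t) : o.enc = encodeTerm t := by
  cases o <;> simp [term?] at h <;> subst h <;> simp [enc, encodeTerm]

theorem enc_of_fml? {o : Obj L} {φ : DFormula L} (h : o.fml? = some φ) : o.enc = encodeFormula φ := by
  cases o <;> simp [fml?] at h <;> subst h <;> rfl

/-- Take exactly `n` terms. -/
def takeTerms : (n : ℕ) → List (Obj L) → Option ((Fin n → L.Term ℕ) × List (Obj L))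
  | 0, os => some (Fin.elim0, os)
  | _ + 1, [] => none
  | n + 1, o :: os =>
    o.term?.bind fun t => (takeTerms n os).map fun p => (Fin.cons t p.1, p.2)

/-- Take as many terms as possible. -/
def takeAll : List (Obj L) → List (L.Term ℕ) × List (Obj L)
  | [] => ([], [])
  | o :: os =>
    match o.term? with
    | some t => (t :: (takeAll os).1, (takeAll os).2)
    | none => ([], o :: os)

/-- The word that a stack of objects has been read from. -/
def encs (os : List (Obj L)) : List (Letter L) := (os.map enc).flatten

@[simp] theorem encs_cons (o : Obj L) (os : List (Obj L)) : encs (o :: os) = o.enc ++ encs os := by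
  simp [encs]

theorem encs_of_takeTerms : ∀ {n : ℕ} {os r : List (Obj L)} {t : Fin n → L.Term ℕ},
    takeTerms n os = some (t, r) → encs os = (List.ofFn fun i => encodeTerm (t i)).flatten ++ encs r
  | 0, os, r, t, h => by
    simp only [takeTerms, Option.some.injEq, Prod.mk.injEq] at h
    simp [h.2]
  | n + 1, [], r, t, h => by simp [takeTerms] at h
  | n + 1, o :: os, r, t, h => by
    simp only [takeTerms, Option.bind_eq_some_iff, Option.map_eq_some_iff, Prod.mk.injEq] at h
    obtain ⟨t₀, h₀, ⟨ts, r'⟩, h₁, rfl, rfl⟩ := h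
    rw [encs_cons, enc_of_term? h₀, encs_of_takeTerms h₁, List.ofFn_succ]
    simp

theorem encs_takeAll : ∀ os : List (Obj L),
    encs os = ((takeAll os).1.map encodeTerm).flatten ++ encs (takeAll os).2
  | [] => by simp [takeAll]
  | o :: os => by
    rw [takeAll]
    cases h : o.term? with
    | none => simp
    | some t => simp [enc_of_term? h, ← encs_takeAll os]

theorem takeTerms_map_ofTerm : ∀ {n : ℕ} (t : Fin n → L.Term ℕ) (r : List (Obj L)),
    takeTerms n ((List.ofFn t).map ofTerm ++ r) = some (t, r)
  | 0, t, r => by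
    simp only [List.ofFn_zero, List.map_nil, List.nil_append, takeTerms]
    congr 2
    exact funext fun i => i.elim0
  | n + 1, t, r => by
    rw [List.ofFn_succ, List.map_cons, List.cons_append, takeTerms, term?_ofTerm, Option.bind_some,
      takeTerms_map_ofTerm (fun i => t i.succ) r]
    simp only [Option.map_some]
    congr 2
    exact Fin.cons_self_tail t

theorem takeAll_map_ofTerm (t : List (L.Term ℕ)) {o : Obj L} (ho : o.term? = none)
    (r : List (Obj L)) : takeAll (t.map ofTerm ++ o :: r) = (t, o :: r) := by
  induction t with
  | nil => simp [takeAll, ho]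
  | cons t ts ih => simp [takeAll, ih]

/-- The effect of a letter, other than a variable sign or a bit, on the stack of objects. The
arguments of the letter stand to its right in the word, so that they lie on top of the stack, the
first one uppermost. -/
def reduce : Letter L → List (Obj L) → Option (List (Obj L))
  | .eq, os => (takeTerms 2 os).map fun p => fml (.eq (p.1 0) (p.1 1)) :: p.2
  | .sym (.inl ⟨n, f⟩), os => (takeTerms n os).map fun p => term (.func f p.1) :: p.2
  | .sym (.inr ⟨n, R⟩), os => (takeTerms n os).map fun p => atom R p.1 :: p.2
  | .neg, atom R t :: os => some (fml (.nrel R t) :: os)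
  | .close, os => some (close :: os)
  | .semicolon, os =>
    match takeAll os with
    | (u, close :: r) => some (semi u :: r)
    | _ => none
  | .dep, os =>
    match takeAll os with
    | (t, semi u :: r) => some (fml (.dep t u) :: r)
    | _ => none
  | .and, o :: o' :: os =>
    o.fml?.bind fun φ => o'.fml?.map fun ψ => fml (.and φ ψ) :: os
  | .or, o :: o' :: os =>
    o.fml?.bind fun φ => o'.fml?.map fun ψ => fml (.or φ ψ) :: os
  | .ex, var x :: o :: os => o.fml?.map fun φ => fml (.ex x φ) :: os
  | .all, var x :: o :: os => o.fml?.map fun φ => fml (.all x φ) :: os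
  | _, _ => none

/-- Reducing the stack reads off one more letter of the word; hence the parser is sound. -/
theorem encs_of_reduce {ℓ : Letter L} {os os' : List (Obj L)} (h : reduce ℓ os = some os') :
    encs os' = ℓ :: encs os := by
  unfold reduce at h
  split at h
  · simp only [Option.map_eq_some_iff] at h
    obtain ⟨⟨t, r⟩, h, rfl⟩ := h
    rw [encs_of_takeTerms h]
    simp [enc, encodeFormula, List.ofFn_succ]
  · simp only [Option.map_eq_some_iff] at h
    obtain ⟨⟨t, r⟩, h, rfl⟩ := h
    rw [encs_of_takeTerms h]
    simp [enc, encodeTerm]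
  · simp only [Option.map_eq_some_iff] at h
    obtain ⟨⟨t, r⟩, h, rfl⟩ := h
    rw [encs_of_takeTerms h]
    simp [enc, encodeFormula]
  · simp only [Option.some.injEq] at h
    subst h
    simp [enc, encodeFormula]
  · simp only [Option.some.injEq] at h
    subst h
    simp [enc]
  · split at h
    · rename_i u r hu
      simp only [Option.some.injEq] at h
      subst h
      rw [encs_takeAll os, hu]
      simp [enc]
    · simp at h
  · split at h
    · rename_i u r hu
      simp only [Option.some.injEq] at h
      subst h
      rw [encs_takeAll os, hu]
      simp [enc, encodeFormula]
    · simp at h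
  · simp only [Option.bind_eq_some_iff, Option.map_eq_some_iff] at h
    obtain ⟨φ, hφ, ψ, hψ, rfl⟩ := h
    rw [encs_cons, encs_cons, encs_cons, enc_of_fml? hφ, enc_of_fml? hψ]
    simp [enc, encodeFormula]
  · simp only [Option.bind_eq_some_iff, Option.map_eq_some_iff] at h
    obtain ⟨φ, hφ, ψ, hψ, rfl⟩ := h
    rw [encs_cons, encs_cons, encs_cons, enc_of_fml? hφ, enc_of_fml? hψ]
    simp [enc, encodeFormula]
  · simp only [Option.map_eq_some_iff] at h
    obtain ⟨φ, hφ, rfl⟩ := h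
    rw [encs_cons, encs_cons, encs_cons, enc_of_fml? hφ]
    simp [enc, encodeFormula]
  · simp only [Option.map_eq_some_iff] at h
    obtain ⟨φ, hφ, rfl⟩ := h
    rw [encs_cons, encs_cons, encs_cons, enc_of_fml? hφ]
    simp [enc, encodeFormula]
  · simp at h

end Obj

/-- Append `x` to a list without repetitions. -/
def addNew {α : Type*} [DecidableEq α] (x : α) (l : List α) : List α :=
  if x ∈ l then l else l ++ [x]

theorem toFinset_addNew (x : ℕ) (l : List ℕ) : (addNew x l).toFinset = insert x l.toFinset := by
  unfold addNew
  split_ifs with h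
  · rw [Finset.insert_eq_self.2 (by simpa using h)]
  · ext; simp

theorem nodup_addNew {x : ℕ} {l : List ℕ} (h : l.Nodup) : (addNew x l).Nodup := by
  unfold addNew
  split_ifs with hx
  · exact h
  · exact List.Nodup.append h (by simp) (by simpa using hx)

theorem prefix_addNew (x : ℕ) (l : List ℕ) : l <+: addNew x l := by
  unfold addNew
  split_ifs
  · exact List.prefix_rfl
  · exact List.prefix_append _ _

/-- The state of the parser: the bits that precede a variable sign, the stack of objects, the
variables that have occurred, and the list of all variables that have a slot. -/
structure PState (L : FirstOrder.Language.{0, 0}) : Type where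
  bits : List Bool
  objs : List (Obj L)
  seen : List ℕ
  dict : List ℕ

/-- Reading one more letter to the left, where at most `k` different variables may occur. -/
def pstep (k : ℕ) : Letter L → PState L → Option (PState L)
  | .bit b, s => if b = false ∧ s.bits = [] then none else some { s with bits := b :: s.bits }
  | .var, s =>
    let x := Computability.decodeNat s.bits
    if x ∈ s.seen ∨ s.seen.length < k then
      some ⟨[], .var x :: s.objs, addNew x s.seen, addNew x s.dict⟩
    else none
  | ℓ, s => if s.bits = [] then (Obj.reduce ℓ s.objs).map fun os => { s with objs := os } else none

/-- The state after reading a word from right to left, with the slots `d` given beforehand. -/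
def parse (k : ℕ) (d : List ℕ) : List (Letter L) → Option (PState L)
  | [] => some ⟨[], [], [], d⟩
  | ℓ :: w => (parse k d w).bind (pstep k ℓ)

theorem pstep_of_reduce {k : ℕ} {ℓ : Letter L} {s : PState L} {os : List (Obj L)} (hs : s.bits = [])
    (h : Obj.reduce ℓ s.objs = some os) : pstep k ℓ s = some { s with objs := os } := by
  cases ℓ with
  | var => simp [Obj.reduce] at h
  | bit b => simp [Obj.reduce] at h
  | _ => simp only [pstep, if_pos hs, h, Option.map_some]

theorem pstep_other {k : ℕ} {ℓ : Letter L} {s : PState L} (h₁ : ∀ b, ℓ ≠ .bit b) (h₂ : ℓ ≠ .var) :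
    pstep k ℓ s =
      if s.bits = [] then (Obj.reduce ℓ s.objs).map fun os => { s with objs := os } else none := by
  cases ℓ with
  | var => exact absurd rfl h₂
  | bit b => exact absurd rfl (h₁ b)
  | _ => rfl

/-- The word that has been read is determined by the state of the parser. The bits, moreover, are
a binary representation without leading zeros, which is where the test in `pstep` is used. -/
theorem parse_sound {k : ℕ} {d : List ℕ} {w : List (Letter L)} {s : PState L}
    (h : parse k d w = some s) :
    w = s.bits.map .bit ++ Obj.encs s.objs ∧ (s.bits = [] ∨ s.bits.getLast? = some true) := by
  induction w generalizing s with
  | nil =>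
    simp only [parse, Option.some.injEq] at h
    subst h
    simp [Obj.encs]
  | cons ℓ w ih =>
    simp only [parse, Option.bind_eq_some_iff] at h
    obtain ⟨s₀, h₀, h⟩ := h
    obtain ⟨hw, hb⟩ := ih h₀
    by_cases hbit : ∃ b, ℓ = .bit b
    · obtain ⟨b, rfl⟩ := hbit
      simp only [pstep] at h
      split_ifs at h with hn
      simp only [Option.some.injEq] at h
      subst h
      refine ⟨by simp [hw], .inr ?_⟩
      rcases hb with hb | hb
      · rw [hb]
        cases b with
        | true => rfl
        | false => exact absurd ⟨rfl, hb⟩ hn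
      · rw [List.getLast?_cons, hb]
        rfl
    · by_cases hv : ℓ = .var
      · subst hv
        simp only [pstep] at h
        split_ifs at h with hn
        simp only [Option.some.injEq] at h
        subst h
        simp [hw, Obj.enc, encodeVar, encodeNat_decodeNat hb]
      · rw [pstep_other (fun b hb => hbit ⟨b, hb⟩) hv] at h
        split_ifs at h with hn
        simp only [Option.map_eq_some_iff] at h
        obtain ⟨os, hos, rfl⟩ := h
        simp [hn, Obj.encs_of_reduce hos, hw]

/-- Allowing more variables does not change the run of a parser that succeeds. -/
theorem parse_mono {k k' : ℕ} (hk : k ≤ k') {d : List ℕ} {w : List (Letter L)} {s : PState L}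
    (h : parse k d w = some s) : parse k' d w = some s := by
  induction w generalizing s with
  | nil => exact h
  | cons ℓ w ih =>
    simp only [parse, Option.bind_eq_some_iff] at h ⊢
    obtain ⟨s₀, h₀, h⟩ := h
    refine ⟨s₀, ih h₀, ?_⟩
    cases ℓ with
    | var =>
      simp only [pstep] at h ⊢
      split_ifs at h with hn
      rw [if_pos (hn.imp_right fun h => h.trans_le hk)]
      exact h
    | _ => exact h

/-- The word `u`, in which the variables `V` occur, is read as the objects `o`, in every state in
which no bits are pending and no more than `k` variables occur altogether. -/
def Reads (k : ℕ) (d : List ℕ) (u : List (Letter L)) (V : Finset ℕ) (o : List (Obj L)) : Prop :=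
  ∀ (w : List (Letter L)) (s : PState L), parse k d w = some s → s.bits = [] → s.seen.Nodup →
    (s.seen.toFinset ∪ V).card ≤ k → ∃ s', parse k d (u ++ w) = some s' ∧ s'.bits = [] ∧
      s'.seen.Nodup ∧ s'.seen.toFinset = s.seen.toFinset ∪ V ∧ s'.objs = o ++ s.objs

section Reads

variable {k : ℕ} {d : List ℕ}

theorem Reads.nil : Reads k d ([] : List (Letter L)) ∅ [] :=
  fun _ s h₁ h₂ h₃ _ => ⟨s, h₁, h₂, h₃, by simp, rfl⟩

theorem Reads.append {u u' : List (Letter L)} {V V' : Finset ℕ} {o o' : List (Obj L)}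
    (h : Reads k d u V o) (h' : Reads k d u' V' o') : Reads k d (u ++ u') (V ∪ V') (o ++ o') := by
  intro w s h₁ h₂ h₃ h₄
  obtain ⟨s', h₁', h₂', h₃', hV', ho'⟩ := h' w s h₁ h₂ h₃
    ((Finset.card_le_card (Finset.union_subset_union_right Finset.subset_union_right)).trans h₄)
  obtain ⟨s'', h₁'', h₂'', h₃'', hV'', ho''⟩ := h _ s' h₁' h₂' h₃' (by
    rw [hV', Finset.union_assoc, Finset.union_comm V']
    exact h₄)
  refine ⟨s'', by rwa [List.append_assoc], h₂'', h₃'', ?_, by rw [ho'', ho', List.append_assoc]⟩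
  rw [hV'', hV', Finset.union_assoc, Finset.union_comm V']

theorem Reads.cons {ℓ : Letter L} {u : List (Letter L)} {V : Finset ℕ} {o o' : List (Obj L)}
    (h : Reads k d u V o) (hℓ : ∀ r, Obj.reduce ℓ (o ++ r) = some (o' ++ r)) :
    Reads k d (ℓ :: u) V o' := by
  intro w s h₁ h₂ h₃ h₄
  obtain ⟨s', h₁', h₂', h₃', hV', ho'⟩ := h w s h₁ h₂ h₃ h₄
  refine ⟨{ s' with objs := o' ++ s.objs }, ?_, h₂', h₃', hV', rfl⟩
  rw [List.cons_append, parse, h₁', Option.bind_some]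
  exact pstep_of_reduce h₂' (by rw [ho', hℓ])

theorem parse_bits {w : List (Letter L)} {s : PState L} (h : parse k d w = some s)
    (hs : s.bits = []) : ∀ {bs : List Bool}, bs = [] ∨ bs.getLast? = some true →
    parse k d (bs.map .bit ++ w) = some { s with bits := bs }
  | [], _ => by
    cases s
    cases hs
    exact h
  | b :: bs, hbs => by
    have hbs' : (b :: bs).getLast? = some true := hbs.resolve_left (by simp)
    rw [List.map_cons, List.cons_append, parse]
    cases bs with
    | nil =>
      simp only [List.getLast?_singleton, Option.some.injEq] at hbs'
      subst hbs'
      simp [h, pstep, hs]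
    | cons b' bs =>
      rw [parse_bits h hs (bs := b' :: bs) (.inr (by simpa using hbs'))]
      simp [pstep]

theorem reads_var (x : ℕ) : Reads k d (encodeVar L x) {x} [.var x] := by
  intro w s h₁ h₂ h₃ h₄
  rw [encodeVar, List.cons_append, parse, parse_bits h₁ h₂ (encodeNat_eq_nil_or x), Option.bind_some]
  have hx : x ∈ s.seen ∨ s.seen.length < k := by
    by_contra! hx
    rw [Finset.card_union_of_disjoint (by simpa using hx.1), Finset.card_singleton,
      List.toFinset_card_of_nodup h₃] at h₄
    omega
  simp only [pstep, Computability.decode_encodeNat, if_pos hx]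
  refine ⟨_, rfl, rfl, nodup_addNew h₃, ?_, rfl⟩
  rw [toFinset_addNew, Finset.union_comm]
  rfl

theorem reads_flatten {enc : L.Term ℕ → List (Letter L)} {ts : List (L.Term ℕ)}
    (h : ∀ t ∈ ts, Reads k d (enc t) t.varFinset [.ofTerm t]) :
    Reads k d (ts.map enc).flatten (tupleVars ts) (ts.map .ofTerm) := by
  induction ts with
  | nil => exact .nil
  | cons t ts ih => exact (h t (by simp)).append (ih fun t ht => h t (by simp [ht]))

theorem reads_ofFn {enc : L.Term ℕ → List (Letter L)} {n : ℕ} {ts : Fin n → L.Term ℕ}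
    (h : ∀ i, Reads k d (enc (ts i)) (ts i).varFinset [.ofTerm (ts i)]) :
    Reads k d (List.ofFn fun i => enc (ts i)).flatten (Finset.univ.biUnion fun i => (ts i).varFinset)
      ((List.ofFn ts).map .ofTerm) := by
  have := reads_flatten (k := k) (d := d) (enc := enc) (ts := List.ofFn ts) (by
    intro t ht
    obtain ⟨i, rfl⟩ := List.mem_ofFn.1 ht
    exact h i)
  rwa [tupleVars_ofFn, List.map_ofFn] at this

theorem reads_term : ∀ t : L.Term ℕ, Reads k d (encodeTerm t) t.varFinset [.ofTerm t]
  | .var x => by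
    simp only [encodeTerm]
    exact reads_var x
  | .func (l := l) f ts => by
    have := reads_ofFn (k := k) (d := d) fun i => reads_term (ts i)
    rw [encodeTerm]
    refine this.cons fun r => ?_
    rw [Obj.reduce, Obj.takeTerms_map_ofTerm]
    rfl

theorem reads_terms (ts : List (L.Term ℕ)) :
    Reads k d (ts.map encodeTerm).flatten (tupleVars ts) (ts.map .ofTerm) :=
  reads_flatten fun t _ => reads_term t

theorem reads_formula : ∀ φ : DFormula L, Reads k d (encodeFormula φ) φ.vars [.ofFml φ]
  | .eq t₁ t₂ => by
    refine ((reads_term t₁).append (reads_term t₂)).cons fun r => ?_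
    simp [Obj.reduce, Obj.takeTerms, Obj.ofFml]
  | .rel R t => by
    refine (reads_ofFn fun i => reads_term (t i)).cons fun r => ?_
    rw [Obj.reduce, Obj.takeTerms_map_ofTerm]
    rfl
  | .nrel R t => by
    refine ((reads_ofFn fun i => reads_term (t i)).cons (o' := [.atom R t]) fun r => ?_).cons
      fun r => ?_
    · rw [Obj.reduce, Obj.takeTerms_map_ofTerm]
      rfl
    · rfl
  | .dep t u => by
    have h1 : Reads k d [.close] ∅ [(.close : Obj L)] := Reads.nil.cons fun r => rfl
    have h2 := ((reads_terms (k := k) (d := d) u).append h1).cons (ℓ := .semicolon)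
      (o' := [.semi u]) fun r => by
        simp [Obj.reduce, Obj.takeAll_map_ofTerm u (o := .close) rfl]
    have h3 := ((reads_terms (k := k) (d := d) t).append h2).cons (ℓ := .dep)
      (o' := [.fml (.dep t u)]) fun r => by
        simp [Obj.reduce, Obj.takeAll_map_ofTerm t (o := .semi u) rfl]
    simpa [DFormula.vars, encodeFormula, Obj.ofFml] using h3
  | .and φ ψ => by
    refine ((reads_formula φ).append (reads_formula ψ)).cons fun r => ?_
    simp [Obj.reduce, show Obj.ofFml (.and φ ψ) = .fml (.and φ ψ) from rfl]
  | .or φ ψ => by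
    refine ((reads_formula φ).append (reads_formula ψ)).cons fun r => ?_
    simp [Obj.reduce, show Obj.ofFml (.or φ ψ) = .fml (.or φ ψ) from rfl]
  | .ex x φ => by
    refine ((reads_var x).append (reads_formula φ)).cons fun r => ?_
    simp [Obj.reduce, show Obj.ofFml (.ex x φ) = .fml (.ex x φ) from rfl]
  | .all x φ => by
    refine ((reads_var x).append (reads_formula φ)).cons fun r => ?_
    simp [Obj.reduce, show Obj.ofFml (.all x φ) = .fml (.all x φ) from rfl]

end Reads

/-- The parser is complete: it reads every formula with at most `k` variables. -/
theorem exists_parse_encodeFormula {k : ℕ} (d : List ℕ) {φ : DFormula L} (h : φ.vars.card ≤ k) :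
    ∃ s, parse k d (encodeFormula φ) = some s ∧ s.bits = [] ∧ s.objs = [.ofFml φ] ∧
      s.seen.Nodup ∧ s.seen.toFinset = φ.vars := by
  obtain ⟨s, h₁, h₂, h₃, h₄, h₅⟩ := reads_formula φ [] _ (rfl : parse k d [] = _) rfl (by simp)
    (by simpa using h)
  exact ⟨s, by simpa using h₁, h₂, h₅, h₃, by simpa using h₄⟩

/-- The parser is sound: if a single formula is left, then the word is the encoding of this
formula, and the variables seen are those of the formula. -/
theorem eq_encodeFormula_of_parse {k : ℕ} {d : List ℕ} {w : List (Letter L)} {s : PState L}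
    {o : Obj L} {φ : DFormula L} (h : parse k d w = some s) (hb : s.bits = []) (ho : s.objs = [o])
    (hφ : o.fml? = some φ) : w = encodeFormula φ ∧ s.seen.Nodup ∧ s.seen.toFinset = φ.vars := by
  have hw : w = encodeFormula φ := by
    rw [(parse_sound h).1, hb, ho]
    simp [Obj.encs, Obj.enc_of_fml? hφ]
  obtain ⟨s', h₁, -, -, h₂, h₃⟩ := exists_parse_encodeFormula d (φ := φ)
    (le_max_right k φ.vars.card)
  rw [← hw, parse_mono (le_max_left k φ.vars.card) h, Option.some.injEq] at h₁
  subst h₁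
  exact ⟨hw, h₂, h₃⟩

/-! ### The memory of the machine -/

/-- The types of the values on the value stack: terms, formulas, relational atoms, variables, and
the two marks inside dependence atoms. -/
inductive Tag : Type
  | term | fml | atom | var | close | semi
  deriving DecidableEq

/-- The auxiliary letters of the machine: the digit of unary numbers, the separator in lists of
words, bits, and tags. -/
inductive Mark : Type
  | one | sep | bit (b : Bool) | tag (t : Tag)

instance : Finite Tag :=
  Finite.of_injective
    (fun t : Tag => (match t with
      | .term => 0 | .fml => 1 | .atom => 2 | .var => 3 | .close => 4 | .semi => 5 : Fin 6))
    (by intro s t; cases s <;> cases t <;> simp)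

instance : Finite Mark :=
  Finite.of_injective
    (fun g : Mark => (match g with
      | .one => .inl true | .sep => .inl false | .bit b => .inr (.inl b) | .tag t => .inr (.inr t) :
      Bool ⊕ Bool ⊕ Tag))
    (by intro s t; cases s <;> cases t <;> simp)

theorem finite_letter (L : FirstOrder.Language.{0, 0}) [Finite L.Symbols] : Finite (Letter L) :=
  Finite.of_injective
    (fun g : Letter L => (match g with
      | .sym s => .inl s | .bit b => .inr (.inl b) | .var => .inr (.inr 0) | .eq => .inr (.inr 1)
      | .neg => .inr (.inr 2) | .dep => .inr (.inr 3) | .semicolon => .inr (.inr 4)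
      | .close => .inr (.inr 5) | .and => .inr (.inr 6) | .or => .inr (.inr 7)
      | .ex => .inr (.inr 8) | .all => .inr (.inr 9) : L.Symbols ⊕ Bool ⊕ Fin 10))
    (by intro s t; cases s <;> cases t <;> simp)

/-- The alphabet of the machine. -/
abbrev Sym (L : FirstOrder.Language.{0, 0}) : Type := Letter L ⊕ Mark

/-- The digit of unary numbers. -/
def one : Sym L := .inr .one

/-- The contents of the stacks `0` to `14`: the rest of the input, the number of new variables that
may still occur, the number of slots, the bits of the next variable, the variables that have
occurred, the variables that have a slot, the value stack, a stack that is empty after a failure,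
two arguments and a result of an operation, and four auxiliary stacks for searching in a list of
words: the letters read so far, the bits already compared, the disagreements, and the success. -/
structure Mem (L : FirstOrder.Language.{0, 0}) : Type where
  input : List (Sym L) := []
  budget : List (Sym L) := []
  slots : List (Sym L) := []
  bits : List (Sym L) := []
  seen : List (Sym L) := []
  dict : List (Sym L) := []
  vals : List (Sym L) := []
  ok : List (Sym L) := []
  x : List (Sym L) := []
  y : List (Sym L) := []
  z : List (Sym L) := []
  trail : List (Sym L) := []
  spent : List (Sym L) := []
  differ : List (Sym L) := []
  found : List (Sym L) := []

namespace Mem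

/-- The list of all stacks. -/
def toList (μ : Mem L) : List (List (Sym L)) :=
  [μ.input, μ.budget, μ.slots, μ.bits, μ.seen, μ.dict, μ.vals, μ.ok, μ.x, μ.y, μ.z, μ.trail, μ.spent,
    μ.differ, μ.found]

/-- The stacks as a function. -/
def toS (μ : Mem L) (i : ℕ) : List (Sym L) := μ.toList.getD i []

/-- The total length of the stacks, which bounds the time needed for clearing them. -/
def size (μ : Mem L) : ℕ := (μ.toList.map List.length).sum

theorem toS_of_le (μ : Mem L) {i : ℕ} (hi : 15 ≤ i) : μ.toS i = [] :=
  List.getD_eq_default _ _ hi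

theorem toS_empty : (({} : Mem L)).toS = fun _ => [] := by
  funext i
  by_cases hi : i < 15
  · interval_cases i <;> rfl
  · exact toS_of_le _ (not_lt.1 hi)

theorem update_toS {μ μ' : Mem L} {i : ℕ} {l : List (Sym L)} (hi : i < 15)
    (h : μ.toList.set i l = μ'.toList) : update μ.toS i l = μ'.toS := by
  funext j
  have hi' : i < μ.toList.length := hi
  rw [Function.update_apply, toS, toS, ← h, List.getD_eq_getElem?_getD, List.getD_eq_getElem?_getD,
    List.getElem?_set]
  by_cases hj : j = i
  · rw [if_pos hj, if_pos hj.symm, if_pos hi', Option.getD_some]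
  · rw [if_neg hj, if_neg (Ne.symm hj)]

variable (μ : Mem L) (l : List (Sym L))

@[simp] theorem toS_0 : μ.toS 0 = μ.input := rfl
@[simp] theorem toS_1 : μ.toS 1 = μ.budget := rfl
@[simp] theorem toS_2 : μ.toS 2 = μ.slots := rfl
@[simp] theorem toS_3 : μ.toS 3 = μ.bits := rfl
@[simp] theorem toS_4 : μ.toS 4 = μ.seen := rfl
@[simp] theorem toS_5 : μ.toS 5 = μ.dict := rfl
@[simp] theorem toS_6 : μ.toS 6 = μ.vals := rfl
@[simp] theorem toS_7 : μ.toS 7 = μ.ok := rfl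
@[simp] theorem toS_8 : μ.toS 8 = μ.x := rfl
@[simp] theorem toS_9 : μ.toS 9 = μ.y := rfl
@[simp] theorem toS_10 : μ.toS 10 = μ.z := rfl
@[simp] theorem toS_11 : μ.toS 11 = μ.trail := rfl
@[simp] theorem toS_12 : μ.toS 12 = μ.spent := rfl
@[simp] theorem toS_13 : μ.toS 13 = μ.differ := rfl
@[simp] theorem toS_14 : μ.toS 14 = μ.found := rfl

@[simp] theorem update_0 : update μ.toS 0 l = { μ with input := l }.toS := update_toS (by simp) rfl
@[simp] theorem update_1 : update μ.toS 1 l = { μ with budget := l }.toS := update_toS (by simp) rfl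
@[simp] theorem update_2 : update μ.toS 2 l = { μ with slots := l }.toS := update_toS (by simp) rfl
@[simp] theorem update_3 : update μ.toS 3 l = { μ with bits := l }.toS := update_toS (by simp) rfl
@[simp] theorem update_4 : update μ.toS 4 l = { μ with seen := l }.toS := update_toS (by simp) rfl
@[simp] theorem update_5 : update μ.toS 5 l = { μ with dict := l }.toS := update_toS (by simp) rfl
@[simp] theorem update_6 : update μ.toS 6 l = { μ with vals := l }.toS := update_toS (by simp) rfl
@[simp] theorem update_7 : update μ.toS 7 l = { μ with ok := l }.toS := update_toS (by simp) rfl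
@[simp] theorem update_8 : update μ.toS 8 l = { μ with x := l }.toS := update_toS (by simp) rfl
@[simp] theorem update_9 : update μ.toS 9 l = { μ with y := l }.toS := update_toS (by simp) rfl
@[simp] theorem update_10 : update μ.toS 10 l = { μ with z := l }.toS := update_toS (by simp) rfl
@[simp] theorem update_11 : update μ.toS 11 l = { μ with trail := l }.toS := update_toS (by simp) rfl
@[simp] theorem update_12 : update μ.toS 12 l = { μ with spent := l }.toS := update_toS (by simp) rfl
@[simp] theorem update_13 : update μ.toS 13 l = { μ with differ := l }.toS := update_toS (by simp) rfl
@[simp] theorem update_14 : update μ.toS 14 l = { μ with found := l }.toS := update_toS (by simp) rfl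

end Mem

open StackProg NExp

/-! ### Programs for the letters -/

/-- Clear the stacks below `n`. -/
def clearBelow : ℕ → StackProg (Sym L)
  | 0 => .load fun _ => none
  | n + 1 => .seq (clear n) (clearBelow n)

/-- Reject: empty all stacks and the register. Since the input is emptied too, the main loop ends
afterwards. -/
def fail : StackProg (Sym L) := clearBelow 15

theorem exec_clearBelow : ∀ (n : ℕ) (S : ℕ → List (Sym L)) (v : Option (Sym L)),
    (∀ i, n ≤ i → S i = []) → Exec (clearBelow n) (v, S) (none, fun _ => [])
      (2 * ∑ i ∈ Finset.range n, (S i).length + 2 * n + 1)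
  | 0, S, v, h => by
    have : S = fun _ => [] := funext fun i => h i (Nat.zero_le i)
    rw [this]
    exact .load (by simp)
  | n + 1, S, v, h => by
    refine .seq (exec_clear rfl le_rfl v) (exec_clearBelow n _ none ?_) ?_
    · intro i hi
      rcases hi.eq_or_lt with rfl | hi
      · simp
      · rw [Function.update_of_ne hi.ne']
        exact h i hi
    · rw [Finset.sum_range_succ]
      have : ∑ i ∈ Finset.range n, (update S n [] i).length
          = ∑ i ∈ Finset.range n, (S i).length :=
        Finset.sum_congr rfl fun i hi => by
          rw [Function.update_of_ne (Finset.mem_range.1 hi).ne]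
      omega

theorem exec_fail (μ : Mem L) {t : ℕ} (ht : 2 * μ.size + 31 ≤ t) (v : Option (Sym L)) :
    Exec fail (v, μ.toS) (none, fun _ => []) t := by
  refine (exec_clearBelow 15 μ.toS v fun i hi => μ.toS_of_le hi).mono ?_
  have : ∑ i ∈ Finset.range 15, (μ.toS i).length = μ.size := by
    simp [Finset.sum_range_succ, Mem.size, Mem.toList]
    omega
  omega

theorem does_fail (μ : Mem L) {t : ℕ} (ht : 2 * μ.size + 31 ≤ t) :
    Does fail μ.toS (fun _ => []) t := fun v => ⟨none, exec_fail μ ht v⟩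

/-- Replace the two arguments of an operation, on the stacks `8` and `9`, by its value on the stack
`8`; the stack `2` holds the number of slots. -/
def run (e : NExp) : StackProg (Sym L) :=
  .seq (compile one e [2, 8, 9] 10 15) (.seq (clear 8) (.seq (clear 9) (move one 10 8)))

theorem does_run (e : NExp) {μ : Mem L} {m x y t : ℕ} (hm : μ.slots = num one m)
    (hx : μ.x = num one x) (hy : μ.y = num one y) (hz : μ.z = [])
    (ht : e.cost [m, x, y] + 2 * x + 2 * y + 3 * e.eval [m, x, y] + 6 ≤ t) :
    Does (run e) μ.toS { μ with x := num one (e.eval [m, x, y]), y := [] }.toS t := by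
  have h := does_compile one e [2, 8, 9] [m, x, y] 10 15 μ.toS
    (by simp [hm, hx, hy]) (by simp) (by simp [hz]) (fun j hj => μ.toS_of_le hj)
  simp only [Mem.update_10] at h
  refine h.seq (t₂ := 2 * x + 2 * y + 3 * e.eval [m, x, y] + 6) ?_ (by omega)
  refine (does_clear (Mem.update_8 _ _).symm (t := 2 * x + 2) (by simp [hx])).seq
    ((does_clear (Mem.update_9 _ _).symm (t := 2 * y + 2) (by simp [hy])).seq
      (does_move (by simp) (l := num one (e.eval [m, x, y])) rfl ?_
        (t := 3 * e.eval [m, x, y] + 2) (by simp)) (t := 2 * y + 3 * e.eval [m, x, y] + 4) ?_) ?_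
  · simp [hz]
  · omega
  · omega

/-- The test for the digit of unary numbers. -/
def isOne : Option (Sym L) → Bool
  | some (.inr .one) => true
  | _ => false

/-- The letter for a tag. -/
def tag (t : Tag) : Sym L := .inr (.tag t)

/-- A value stack as a word. -/
def encVals (vs : List (Tag × ℕ)) : List (Sym L) := vs.flatMap fun p => num one p.2 ++ [tag p.1]

theorem encVals_cons (t : Tag) (c : ℕ) (vs : List (Tag × ℕ)) :
    (encVals ((t, c) :: vs) : List (Sym L)) = num one c ++ tag t :: encVals vs := by
  simp [encVals]

/-- Move the topmost number on the value stack to the stack `i` and its tag to the register. -/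
def popVal (i : ℕ) : StackProg (Sym L) := moveWhile one isOne 6 i

/-- Push the number on stack `8` with a tag onto the value stack. -/
def pushVal (t : Tag) : StackProg (Sym L) := .seq (.push 6 fun _ => tag t) (move one 8 6)

theorem exec_popVal {i : ℕ} (hi : i ≠ 6) {μ : Mem L} {t : Tag} {c : ℕ} {vs : List (Tag × ℕ)}
    {S' : ℕ → List (Sym L)} {n : ℕ} (hμ : μ.vals = encVals ((t, c) :: vs)) (hμi : μ.toS i = [])
    (hS' : S' = update (update μ.toS 6 (encVals vs)) i (num one c)) (hn : 3 * c + 2 ≤ n)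
    (v : Option (Sym L)) : Exec (popVal i) (v, μ.toS) (some (tag t), S') n := by
  refine exec_moveWhile (r := tag t :: encVals vs) hi.symm (by rw [Mem.toS_6, hμ, encVals_cons]) ?_ rfl
    ?_ (by simpa using hn) v
  · intro g hg
    rw [List.eq_of_mem_replicate hg]
    rfl
  · simp [hS', hμi]

theorem exec_popVal_nil {i : ℕ} (hi : i ≠ 6) {μ : Mem L} {n : ℕ} (hμ : μ.vals = [])
    (hμi : μ.toS i = []) (hn : 2 ≤ n) (v : Option (Sym L)) :
    Exec (popVal i) (v, μ.toS) (none, μ.toS) n := by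
  refine exec_moveWhile (l := []) (r := []) hi.symm (by simpa using hμ) (by simp) rfl ?_
    (by simpa using hn) v
  rw [Function.update_eq_self_iff.2, Function.update_eq_self_iff.2]
  · simp [hμ]
  · rw [Function.update_of_ne hi, hμi]
    rfl

theorem does_pushVal (t : Tag) {μ : Mem L} {c : ℕ} {vs : List (Tag × ℕ)} {n : ℕ}
    (hμ : μ.vals = encVals vs) (hx : μ.x = num one c) (hn : 3 * c + 3 ≤ n) :
    Does (pushVal t) μ.toS { μ with vals := encVals ((t, c) :: vs), x := [] }.toS n := by
  refine (does_push 6 (tag t) _ le_rfl).seq (t₂ := 3 * c + 2) ?_ (by omega)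
  rw [Mem.toS_6, Mem.update_6]
  refine does_move (by simp) (l := num one c) (by simp [hx]) ?_ (by simp)
  simp [encVals_cons, hμ]

/-! ### The letters that reduce the value stack -/

theorem does_switch {P : StackProg (Sym L)} {F : Option (Sym L) → StackProg (Sym L)}
    {v₁ : Option (Sym L)} {S S₁ S' : ℕ → List (Sym L)} {t₁ t₂ t : ℕ}
    (h₁ : ∀ v, Exec P (v, S) (v₁, S₁) t₁) (h₂ : Does (F v₁) S₁ S' t₂) (ht : t₁ + t₂ + 1 ≤ t) :
    Does (.seq P (.switch F)) S S' t := fun v =>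
  have ⟨v', h⟩ := h₂ v₁
  ⟨v', .seq (h₁ v) (.switch (t := t₂ + 1) h le_rfl) (by omega)⟩

/-- The program selected by the tag in the register; without a tag, the program fails. -/
def onTag (F : Tag → StackProg (Sym L)) : Option (Sym L) → StackProg (Sym L)
  | some (.inr (.tag t)) => F t
  | _ => fail

section Codes

variable (a q m : ℕ)

/-- How to append a value to a tuple. -/
def tupOp : Tag → Option NExp
  | .term => some (opTup a q)
  | .var => some (opTupVar a q)
  | _ => none

/-- How to add a value to a set of disagreements. -/
def disOp : Tag → Option NExp
  | .term => some (opDis a q)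
  | .var => some (opDisVar a)
  | _ => none

/-- The tags of the values that stand for formulas. -/
def Tag.isFml : Tag → Bool
  | .fml => true
  | .atom => true
  | _ => false

/-- Collect a tuple of a given length. -/
def collect : ℕ → ℕ → List (Tag × ℕ) → Option (ℕ × List (Tag × ℕ))
  | 0, acc, vs => some (acc, vs)
  | _ + 1, _, [] => none
  | l + 1, acc, (t, c) :: vs =>
    match tupOp a q t with
    | some e => collect l (e.eval [m, acc, c]) vs
    | none => none

/-- Collect the disagreements of a maximal tuple. -/
def gather : ℕ → List (Tag × ℕ) → ℕ × List (Tag × ℕ)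
  | acc, [] => (acc, [])
  | acc, (t, c) :: vs =>
    match disOp a q t with
    | some e => gather (e.eval [m, acc, c]) vs
    | none => (acc, (t, c) :: vs)

/-- The effect of a letter for a binary operation on the value stack. -/
def codeBinary (p p' : Tag → Bool) (e : NExp) : List (Tag × ℕ) → Option (List (Tag × ℕ))
  | (t, c) :: (t', c') :: vs =>
    if p t = true ∧ p' t' = true then some ((.fml, e.eval [m, c, c']) :: vs) else none
  | _ => none

variable (F : L.Symbols → ℕ → ℕ) (E : ℕ → ℕ)

/-- The effect of a letter, other than a variable sign or a bit, on the value stack. This is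
`Obj.reduce` with codes instead of objects. -/
def codeReduce : Letter L → List (Tag × ℕ) → Option (List (Tag × ℕ))
  | .eq, vs => (collect a q m 2 0 vs).map fun p => (.fml, (opRel a q E).eval [m, p.1, 0]) :: p.2
  | .sym (.inl f), vs => (collect a q m f.1 0 vs).map fun p =>
      (.term, (opFun a q (F (.inl f))).eval [m, p.1, 0]) :: p.2
  | .sym (.inr R), vs => (collect a q m R.1 0 vs).map fun p =>
      (.atom, (opRel a q (F (.inr R))).eval [m, p.1, 0]) :: p.2
  | .neg, (.atom, c) :: vs => some ((.fml, (opNeg a).eval [m, c, 0]) :: vs)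
  | .close, vs => some ((.close, 0) :: vs)
  | .semicolon, vs =>
    match gather a q m 0 vs with
    | (u, (.close, _) :: r) => some ((.semi, u) :: r)
    | _ => none
  | .dep, vs =>
    match gather a q m 0 vs with
    | (t, (.semi, u) :: r) => some ((.fml, (opDep a).eval [m, t, u]) :: r)
    | _ => none
  | .and, vs => codeBinary m Tag.isFml Tag.isFml (opAnd a) vs
  | .or, vs => codeBinary m Tag.isFml Tag.isFml (opOr a) vs
  | .ex, vs => codeBinary m (· = .var) Tag.isFml (opEx a) vs
  | .all, vs => codeBinary m (· = .var) Tag.isFml (opAll a) vs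
  | _, _ => none

/-- The operations that the machine performs, except for the test for acceptance. Their number does
not depend on the input. -/
def ops : Set NExp :=
  {opTup a q, opTupVar a q, opDis a q, opDisVar a, opNeg a, opDep a, opAnd a, opOr a, opEx a, opAll a,
    opRel a q E} ∪ Set.range (fun s => opFun a q (F s)) ∪ Set.range fun s => opRel a q (F s)

theorem finite_ops [Finite L.Symbols] : (ops a q F E).Finite := by
  unfold ops
  exact ((Set.toFinite _).union (Set.finite_range _)).union (Set.finite_range _)

/-- Collect a tuple of a given length and continue with `Q`. -/
def collectProg : ℕ → StackProg (Sym L) → StackProg (Sym L)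
  | 0, Q => Q
  | l + 1, Q => .seq (popVal 9) (.switch (onTag fun t =>
      match tupOp a q t with
      | some e => .seq (run e) (collectProg l Q)
      | none => fail))

/-- The test for the tag of a term. -/
def isTermTag : Option (Sym L) → Bool
  | some (.inr (.tag t)) => (disOp a q t).isSome
  | _ => false

/-- Continue collecting the disagreements as long as the register contains the tag of a term. -/
def gatherLoop : StackProg (Sym L) :=
  .loop (isTermTag a q) (.seq (.switch (onTag fun t =>
    match disOp a q t with
    | some e => run e
    | none => skip)) (popVal 9))

/-- Collect the disagreements of a maximal tuple; the next value goes to the register and to the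
stack `9`. -/
def gatherProg : StackProg (Sym L) := .seq (popVal 9) (gatherLoop a q)

/-- The program for a binary operation. -/
def binaryProg (p p' : Tag → Bool) (e : NExp) : StackProg (Sym L) :=
  .seq (popVal 8) (.switch (onTag fun t =>
    if p t then .seq (popVal 9) (.switch (onTag fun t' =>
      if p' t' then .seq (run e) (pushVal .fml) else fail))
    else fail))

/-- The program for a letter other than a variable sign or a bit. -/
def reduceProg : Letter L → StackProg (Sym L)
  | .eq => collectProg a q 2 (.seq (run (opRel a q E)) (pushVal .fml))
  | .sym (.inl f) => collectProg a q f.1 (.seq (run (opFun a q (F (.inl f)))) (pushVal .term))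
  | .sym (.inr R) => collectProg a q R.1 (.seq (run (opRel a q (F (.inr R)))) (pushVal .atom))
  | .neg => .seq (popVal 8) (.switch (onTag fun t =>
      if t = .atom then .seq (run (opNeg a)) (pushVal .fml) else fail))
  | .close => pushVal .close
  | .semicolon => .seq (gatherProg a q) (.switch (onTag fun t =>
      if t = .close then .seq (clear 9) (pushVal .semi) else fail))
  | .dep => .seq (gatherProg a q) (.switch (onTag fun t =>
      if t = .semi then .seq (run (opDep a)) (pushVal .fml) else fail))
  | .and => binaryProg Tag.isFml Tag.isFml (opAnd a)
  | .or => binaryProg Tag.isFml Tag.isFml (opOr a)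
  | .ex => binaryProg (· = .var) Tag.isFml (opEx a)
  | .all => binaryProg (· = .var) Tag.isFml (opAll a)
  | _ => fail

/-- `Z` bounds the number of steps of the operation `e`, and `B` its value, on arguments up to
`B`. -/
def OpBound (m B Z : ℕ) (e : NExp) : Prop :=
  ∀ x ≤ B, ∀ y ≤ B, e.cost [m, x, y] ≤ Z ∧ e.eval [m, x, y] ≤ B

variable {a q m F E} {B Z : ℕ}

/-- An operation on the arguments on the stacks, and then pushing the result. -/
theorem does_run_pushVal {e : NExp} (he : OpBound m B Z e) (t : Tag) {μ : Mem L} {x y : ℕ}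
    {vs : List (Tag × ℕ)} (hm : μ.slots = num one m) (hx : μ.x = num one x) (hy : μ.y = num one y)
    (hz : μ.z = []) (hvs : μ.vals = encVals vs) (hxB : x ≤ B) (hyB : y ≤ B) (hB : B ≤ Z) (hZ : 1 ≤ Z) :
    Does (.seq (run e) (pushVal t)) μ.toS
      { μ with vals := encVals ((t, e.eval [m, x, y]) :: vs), x := [], y := [] }.toS (20 * Z) := by
  obtain ⟨h1, h2⟩ := he x hxB y hyB
  exact (does_run e hm hx hy hz (t := 8 * Z + 6) (by omega)).seq
    (does_pushVal t (c := e.eval [m, x, y]) (n := 3 * Z + 3) hvs rfl (by omega)) (by omega)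

@[simp] theorem length_encVals_cons (t : Tag) (c : ℕ) (vs : List (Tag × ℕ)) :
    (encVals ((t, c) :: vs) : List (Sym L)).length =
      c + 1 + (encVals vs : List (Sym L)).length := by
  simp [encVals_cons]
  omega

/-- Collecting a tuple, for any continuation `Q` that is correct on all outcomes. -/
theorem does_collectProg (hop : ∀ t e, tupOp a q t = some e → OpBound m B Z e) (hB : B ≤ Z)
    (hZ : 1 ≤ Z) {Q : StackProg (Sym L)} {out : ℕ × List (Tag × ℕ) → ℕ → List (Sym L)} {n : ℕ} :
    ∀ (l : ℕ) {μ : Mem L} {acc : ℕ} {vs : List (Tag × ℕ)}, μ.slots = num one m →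
      μ.x = num one acc → μ.y = [] → μ.z = [] → μ.vals = encVals vs → acc ≤ B →
      (∀ p ∈ vs, p.2 ≤ B) → { μ with x := [] }.size ≤ Z →
      (∀ p : ℕ × List (Tag × ℕ), p.1 ≤ B →
        Does Q { μ with x := num one p.1, vals := encVals p.2 }.toS (out p) n) →
      Does (collectProg a q l Q) μ.toS
        ((collect a q m l acc vs).elim (fun _ => []) out) (l * (20 * Z) + 60 * Z + n) := by
  intro l
  induction l with
  | zero =>
    intro μ acc vs hm hx hy hz hvs hacc hle hsz hQ
    have := hQ (acc, vs) hacc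
    rw [← hx, ← hvs] at this
    exact this.mono (by omega)
  | succ l ih =>
    intro μ acc vs hm hx hy hz hvs hacc hle hsz hQ
    rcases vs with _ | ⟨⟨t, c⟩, vs⟩
    · refine does_switch (exec_popVal_nil (by simp) hvs hy le_rfl) (does_fail μ le_rfl) ?_
      simp [Mem.size, Mem.toList, hx] at hsz ⊢
      omega
    have hc : c ≤ B := hle (t, c) (by simp)
    have hpop := exec_popVal (i := 9) (n := 3 * Z + 2) (by simp) hvs hy rfl (by omega)
    simp only [Mem.update_6, Mem.update_9] at hpop
    rw [collect]
    rcases he : tupOp a q t with _ | e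
    · refine does_switch hpop (t₂ := 36 * Z) ?_ (by simp only [add_mul]; omega)
      simp only [onTag, tag, he]
      refine does_fail _ ?_
      simp [Mem.size, Mem.toList, hx, hvs] at hsz ⊢
      omega
    · have hb := (hop t e he acc hacc c hc)
      refine does_switch hpop (t₂ := 8 * Z + 6 + (l * (20 * Z) + 60 * Z + n)) ?_
        (by simp only [add_mul]; omega)
      simp only [onTag, tag, he]
      refine (does_run e (μ := { μ with vals := encVals vs, y := num one c }) (y := c)
        (t := 8 * Z + 6) hm hx rfl hz (by omega)).seq
        (ih (μ := { μ with vals := encVals vs, x := num one (e.eval [m, acc, c]), y := [] }) (vs := vs)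
        hm rfl rfl hz rfl hb.2 (fun p hp => hle p (by simp [hp])) ?_ ?_)
        le_rfl
      · simp [Mem.size, Mem.toList, hvs, hy] at hsz ⊢
        omega
      · intro p hp
        have := hQ p hp
        rwa [hy] at this

theorem collect_le (hop : ∀ t e, tupOp a q t = some e → OpBound m B Z e) :
    ∀ {l acc : ℕ} {vs vs' : List (Tag × ℕ)} {c : ℕ}, acc ≤ B → (∀ p ∈ vs, p.2 ≤ B) →
      collect a q m l acc vs = some (c, vs') → c ≤ B ∧ ∀ p ∈ vs', p.2 ≤ B
  | 0, acc, vs, vs', c, hacc, hle, h => by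
    simp only [collect, Option.some.injEq, Prod.mk.injEq] at h
    exact ⟨h.1 ▸ hacc, h.2 ▸ hle⟩
  | l + 1, acc, [], vs', c, hacc, hle, h => by simp [collect] at h
  | l + 1, acc, (t, d) :: vs, vs', c, hacc, hle, h => by
    rw [collect] at h
    rcases he : tupOp a q t with _ | e
    · simp [he] at h
    · simp only [he] at h
      exact collect_le hop (hop t e he acc hacc d (hle (t, d) (by simp))).2
        (fun p hp => hle p (by simp [hp])) h

/-- The tag and the number of the topmost value, and the other values. -/
def popped (vs : List (Tag × ℕ)) : Option (Sym L) × ℕ × List (Tag × ℕ) :=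
  match vs with
  | [] => (none, 0, [])
  | (t, c) :: vs => (some (tag t), c, vs)

theorem exec_gatherProg (hop : ∀ t e, disOp a q t = some e → OpBound m B Z e) (hB : B ≤ Z)
    (hZ : 1 ≤ Z) {μ : Mem L} {acc : ℕ} {vs : List (Tag × ℕ)} (hm : μ.slots = num one m)
    (hx : μ.x = num one acc) (hy : μ.y = []) (hz : μ.z = []) (hvs : μ.vals = encVals vs) (hacc : acc ≤ B)
    (hle : ∀ p ∈ vs, p.2 ≤ B) (v : Option (Sym L)) :
    Exec (gatherProg a q) (v, μ.toS) ((popped (gather a q m acc vs).2).1,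
      { μ with
        x := num one (gather a q m acc vs).1
        y := num one (popped (L := L) (gather a q m acc vs).2).2.1
        vals := encVals (popped (L := L) (gather a q m acc vs).2).2.2 }.toS)
      (vs.length * (30 * Z) + 10 * Z) := by
  have key : ∀ (vs : List (Tag × ℕ)) {μ : Mem L} {acc : ℕ}, μ.slots = num one m →
      μ.x = num one acc → μ.z = [] → acc ≤ B → (∀ p ∈ vs, p.2 ≤ B) →
      Exec (gatherLoop a q) ((popped (L := L) vs).1,
          { μ with
            y := num one (popped (L := L) vs).2.1
            vals := encVals (popped (L := L) vs).2.2 }.toS)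
        ((popped (gather a q m acc vs).2).1,
      { μ with
        x := num one (gather a q m acc vs).1
        y := num one (popped (L := L) (gather a q m acc vs).2).2.1
        vals := encVals (popped (L := L) (gather a q m acc vs).2).2.2 }.toS)
      (vs.length * (30 * Z) + 1) := by
    intro vs
    induction vs with
    | nil =>
      intro μ acc hm hx hz hacc hle
      simp only [gather, popped, ← hx]
      exact .loop_done rfl (by omega)
    | cons p vs ih =>
      intro μ acc hm hx hz hacc hle
      obtain ⟨t, c⟩ := p
      have hc : c ≤ B := hle (t, c) (by simp)
      rw [gather]
      rcases he : disOp a q t with _ | e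
      · simp only [popped, ← hx]
        exact .loop_done (by simp [isTermTag, tag, he]) (by omega)
      · simp only
        have hb := (hop t e he acc hacc c hc)
        have hih := ih (μ := { μ with x := num one (e.eval [m, acc, c]) }) hm rfl hz hb.2
          (fun p hp => hle p (by simp [hp]))
        have hpop : ∀ v, Exec (popVal 9) (v, { μ with
            x := num one (e.eval [m, acc, c]), y := [], vals := encVals vs }.toS)
            ((popped (L := L) vs).1, { μ with
              x := num one (e.eval [m, acc, c])
              y := num one (popped (L := L) vs).2.1
              vals := encVals (popped (L := L) vs).2.2 }.toS) (3 * Z + 2) := by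
          intro v
          rcases vs with _ | ⟨⟨t', c'⟩, vs⟩
          · exact exec_popVal_nil (by simp) rfl rfl (by omega) v
          · have hc' : c' ≤ B := hle (t', c') (by simp)
            exact exec_popVal (by simp) rfl rfl (by simp [popped]) (by omega) v
        refine .loop_step (t₁ := 11 * Z + 9) (by simp [popped, isTermTag, tag, he]) ?_ hih
          (by simp only [List.length_cons, add_mul]; omega)
        have hrun := does_run e (t := 8 * Z + 6)
          (μ := { μ with y := num one c, vals := encVals vs }) hm hx rfl hz (by omega)
        obtain ⟨v', hrun⟩ := hrun (some (tag t))
        refine .seq (t₁ := 8 * Z + 7) (t₂ := 3 * Z + 2) (.switch (t₁ := 8 * Z + 6) ?_ le_rfl) (hpop v')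
          (by omega)
        simp only [popped, onTag, tag, he]
        exact hrun
  have hpop : ∀ v, Exec (popVal 9) (v, μ.toS) ((popped (L := L) vs).1, { μ with
        y := num one (popped (L := L) vs).2.1
        vals := encVals (popped (L := L) vs).2.2 }.toS) (3 * Z + 2) := by
    intro v
    rcases vs with _ | ⟨⟨t', c'⟩, vs⟩
    · have : { μ with y := num one (popped (L := L) []).2.1, vals := encVals (popped (L := L) []).2.2 } =
          μ := by
        cases μ
        simp_all [popped]
      rw [this]
      exact exec_popVal_nil (i := 9) (by simp) (by simpa [encVals] using hvs) hy (by omega) v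
    · have hc' : c' ≤ B := hle (t', c') (by simp)
      exact exec_popVal (i := 9) (by simp) hvs hy (by simp [popped]) (by omega) v
  exact .seq (hpop v) (key vs hm hx hz hacc hle) (by omega)

theorem gather_le (hop : ∀ t e, disOp a q t = some e → OpBound m B Z e) :
    ∀ {vs : List (Tag × ℕ)} {acc : ℕ}, acc ≤ B → (∀ p ∈ vs, p.2 ≤ B) →
      (gather a q m acc vs).1 ≤ B ∧ (gather a q m acc vs).2 <:+ vs
  | [], acc, hacc, hle => ⟨hacc, List.suffix_rfl⟩
  | (t, d) :: vs, acc, hacc, hle => by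
    rw [gather]
    rcases he : disOp a q t with _ | e
    · exact ⟨hacc, List.suffix_rfl⟩
    · have := gather_le hop (hop t e he acc hacc d (hle (t, d) (by simp))).2
        (fun p (hp : p ∈ vs) => hle p (by simp [hp]))
      exact ⟨this.1, this.2.trans (List.suffix_cons _ _)⟩

theorem does_binaryProg {e : NExp} (he : OpBound m B Z e) (hB : B ≤ Z) (hZ : 1 ≤ Z)
    (p p' : Tag → Bool) {μ : Mem L} {vs : List (Tag × ℕ)} (hm : μ.slots = num one m)
    (hx : μ.x = []) (hy : μ.y = []) (hz : μ.z = []) (hvs : μ.vals = encVals vs)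
    (hle : ∀ p ∈ vs, p.2 ≤ B) (hsz : μ.size ≤ Z) :
    Does (binaryProg p p' e) μ.toS ((codeBinary m p p' e vs).elim (fun _ => [])
      fun vs' => { μ with vals := encVals vs' }.toS) (60 * Z) := by
  unfold binaryProg
  rcases vs with _ | ⟨⟨t, c⟩, vs⟩
  · exact does_switch (exec_popVal_nil (by simp) hvs hx le_rfl) (does_fail μ le_rfl) (by omega)
  have hc : c ≤ B := hle (t, c) (by simp)
  have hpop := exec_popVal (i := 8) (n := 3 * Z + 2) (by simp) hvs hx rfl (by omega)
  simp only [Mem.update_6, Mem.update_8] at hpop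
  refine does_switch hpop (t₂ := 50 * Z) ?_ (by omega)
  simp only [onTag, tag]
  by_cases hp : p t = true
  swap
  · have : codeBinary m p p' e ((t, c) :: vs) = none := by
      rcases vs with _ | ⟨⟨t', c'⟩, vs⟩
      · rfl
      · simp [codeBinary, hp]
    rw [if_neg hp, this]
    refine does_fail _ ?_
    simp [Mem.size, Mem.toList, hvs, hx] at hsz ⊢
    omega
  rw [if_pos hp]
  rcases vs with _ | ⟨⟨t', c'⟩, vs⟩
  · refine does_switch (exec_popVal_nil (by simp) rfl hy le_rfl) (does_fail _ le_rfl) ?_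
    simp [Mem.size, Mem.toList, hvs, hx] at hsz ⊢
    omega
  have hc' : c' ≤ B := hle (t', c') (by simp)
  have hpop' := exec_popVal (i := 9) (n := 3 * Z + 2) 
    (μ := { μ with vals := encVals ((t', c') :: vs), x := num one c }) (by simp) rfl hy rfl (by omega)
  simp only [Mem.update_6, Mem.update_9] at hpop'
  refine does_switch hpop' (t₂ := 36 * Z) ?_ (by omega)
  simp only [onTag, tag]
  by_cases hp' : p' t' = true
  · rw [if_pos hp', codeBinary, if_pos ⟨hp, hp'⟩]
    have h := (does_run_pushVal he .fml (μ := { μ with vals := encVals vs, x := num one c, y := num one c' })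
      (x := c) (y := c') (vs := vs) hm rfl rfl hz rfl hc hc' hB hZ).mono
      (t' := 36 * Z) (by omega)
    simp only [Option.elim_some]
    obtain ⟨⟩ := μ
    dsimp only at hx hy
    subst hx hy
    exact h
  · rw [if_neg hp', codeBinary, if_neg (by simp [hp'])]
    refine does_fail _ ?_
    simp [Mem.size, Mem.toList, hvs, hx, hy] at hsz ⊢
    omega

theorem codeBinary_le {e : NExp} (he : OpBound m B Z e) {p p' : Tag → Bool}
    {vs vs' : List (Tag × ℕ)} (hle : ∀ p ∈ vs, p.2 ≤ B) (h : codeBinary m p p' e vs = some vs') :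
    ∀ p ∈ vs', p.2 ≤ B := by
  unfold codeBinary at h
  split at h
  · rename_i t c t' c' vs
    split_ifs at h
    simp only [Option.some.injEq] at h
    subst h
    intro p hp
    rcases List.mem_cons.1 hp with rfl | hp
    · exact (he c (hle (t, c) (by simp)) c' (hle (t', c') (by simp))).2
    · exact hle p (by simp [hp])
  · simp at h

theorem OpBound.of_tupOp (hops : ∀ e ∈ ops a q F E, OpBound m B Z e) (t : Tag) (e : NExp)
    (h : tupOp a q t = some e) : OpBound m B Z e := by
  cases t <;> simp [tupOp] at h <;> subst h <;> exact hops _ (by simp [ops])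

theorem OpBound.of_disOp (hops : ∀ e ∈ ops a q F E, OpBound m B Z e) (t : Tag) (e : NExp)
    (h : disOp a q t = some e) : OpBound m B Z e := by
  cases t <;> simp [disOp] at h <;> subst h <;> exact hops _ (by simp [ops])

theorem does_collect_run (hops : ∀ e ∈ ops a q F E, OpBound m B Z e) (hB : B ≤ Z) (hZ : 1 ≤ Z)
    {e : NExp} (he : OpBound m B Z e) (t : Tag) (l : ℕ) {μ : Mem L} {vs : List (Tag × ℕ)}
    (hm : μ.slots = num one m) (hx : μ.x = []) (hy : μ.y = []) (hz : μ.z = [])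
    (hvs : μ.vals = encVals vs) (hle : ∀ p ∈ vs, p.2 ≤ B) (hsz : μ.size ≤ Z) :
    Does (collectProg a q l (.seq (run e) (pushVal t))) μ.toS
      (((collect a q m l 0 vs).map fun p => (t, e.eval [m, p.1, 0]) :: p.2).elim (fun _ => [])
        fun vs' => { μ with vals := encVals vs' }.toS) (l * (20 * Z) + 80 * Z) := by
  have h := does_collectProg (OpBound.of_tupOp hops) hB hZ (Q := .seq (run e) (pushVal t))
    (out := fun p => { μ with vals := encVals ((t, e.eval [m, p.1, 0]) :: p.2) }.toS) (n := 20 * Z) l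
    (acc := 0) hm hx hy hz hvs (Nat.zero_le _) hle (by rwa [← hx]) ?_
  · replace h := h.mono (t' := l * (20 * Z) + 80 * Z) (by omega)
    cases hc : collect a q m l 0 vs <;> simpa [hc] using h
  · intro p hp
    have := does_run_pushVal he t (μ := { μ with x := num one p.1, vals := encVals p.2 }) (x := p.1)
      (y := 0) (vs := p.2) hm rfl hy hz rfl hp (Nat.zero_le _) hB hZ
    obtain ⟨⟩ := μ
    dsimp only at hx hy
    subst hx hy
    exact this

theorem does_gather_switch (hops : ∀ e ∈ ops a q F E, OpBound m B Z e) (hB : B ≤ Z) (hZ : 1 ≤ Z)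
    (t₀ : Tag) {Q : StackProg (Sym L)} {μ : Mem L} {vs : List (Tag × ℕ)} {n : ℕ}
    {out : ℕ → ℕ → List (Tag × ℕ) → ℕ → List (Sym L)} (hm : μ.slots = num one m) (hx : μ.x = [])
    (hy : μ.y = []) (hz : μ.z = []) (hvs : μ.vals = encVals vs) (hle : ∀ p ∈ vs, p.2 ≤ B)
    (hsz : μ.size ≤ Z) (hn : 40 * Z ≤ n)
    (hQ : ∀ u c r, gather a q m 0 vs = (u, (t₀, c) :: r) → u ≤ B → c ≤ B →
      Does Q { μ with x := num one u, y := num one c, vals := encVals r }.toS (out u c r) n) :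
    Does (.seq (gatherProg a q) (.switch (onTag fun t => if t = t₀ then Q else fail))) μ.toS
      (match gather a q m 0 vs with
        | (u, (t, c) :: r) => if t = t₀ then out u c r else fun _ => []
        | _ => fun _ => []) (30 * (Z * Z) + 10 * Z + 1 + n) := by
  have hlen : vs.length ≤ Z := by
    have h1 : vs.length ≤ (encVals vs : List (Sym L)).length := by
      clear * -
      induction vs with
      | nil => simp
      | cons p vs ih =>
        rw [← Prod.mk.eta (p := p), length_encVals_cons, List.length_cons]
        omega
    have h2 : μ.vals.length ≤ μ.size := by
      simp [Mem.size, Mem.toList]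
      omega
    rw [hvs] at h2
    omega
  obtain ⟨hu, hsuf⟩ := gather_le (OpBound.of_disOp hops) (acc := 0) (Nat.zero_le B) hle
  have hlen' : (encVals (gather a q m 0 vs).2 : List (Sym L)).length ≤
      (encVals vs : List (Sym L)).length := by
    obtain ⟨r, hr⟩ := hsuf
    have h3 : (encVals vs : List (Sym L)) = encVals r ++ encVals (gather a q m 0 vs).2 := by
      conv_lhs => rw [← hr]
      simp [encVals]
    rw [h3]
    simp
  have h := fun v => exec_gatherProg (L := L) (OpBound.of_disOp hops) hB hZ hm (by simpa using hx) hy hz hvs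
    (Nat.zero_le B) hle v
  have hmul : vs.length * (30 * Z) ≤ 30 * (Z * Z) := by
    have := Nat.mul_le_mul_right Z hlen
    calc vs.length * (30 * Z) = 30 * (vs.length * Z) := by ring
      _ ≤ _ := by omega
  rcases hg : gather a q m 0 vs with ⟨u, _ | ⟨⟨t, c⟩, r⟩⟩
  · rw [hg] at hu
    refine does_switch h (t₂ := n) ?_ (by omega)
    simp only [hg, popped, onTag]
    refine does_fail _ ?_
    simp [Mem.size, Mem.toList, hx, hy, hvs, encVals] at hsz ⊢
    omega
  · rw [hg] at hu hlen' hsuf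
    rw [length_encVals_cons] at hlen'
    dsimp only at hu
    have hc : c ≤ B := hle (t, c) (hsuf.subset (by simp))
    refine does_switch h (t₂ := n) ?_ (by omega)
    simp only [hg, popped, onTag, tag]
    split_ifs with ht
    · subst ht
      exact hQ u c r hg hu hc
    · refine does_fail _ ?_
      simp [Mem.size, Mem.toList, hx, hy, hvs] at hsz ⊢
      omega

/-- The program for a letter computes its effect on the value stack, and rejects if there is none.
-/
theorem does_reduceProg (hops : ∀ e ∈ ops a q F E, OpBound m B Z e) (hB : B ≤ Z) (hZ : 1 ≤ Z)
    (hq : 2 ≤ q) (hqf : ∀ n, L.Functions n → n ≤ q) (hqR : ∀ n, L.Relations n → n ≤ q)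
    (ℓ : Letter L) {μ : Mem L} {vs : List (Tag × ℕ)}
    (hm : μ.slots = num one m) (hx : μ.x = []) (hy : μ.y = []) (hz : μ.z = [])
    (hvs : μ.vals = encVals vs) (hle : ∀ p ∈ vs, p.2 ≤ B) (hsz : μ.size ≤ Z) :
    Does (reduceProg a q F E ℓ) μ.toS ((codeReduce a q m F E ℓ vs).elim (fun _ => [])
        fun vs' => { μ with vals := encVals vs' }.toS) ((20 * q + 200) * (Z * Z)) := by
  have hZZ : Z ≤ Z * Z := Nat.le_mul_of_pos_left Z hZ
  have hcol : ∀ l ≤ q, l * (20 * Z) + 80 * Z ≤ (20 * q + 200) * (Z * Z) := by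
    intro l hl
    have h1 : l * (20 * Z) ≤ 20 * q * (Z * Z) := by
      calc l * (20 * Z) ≤ q * (20 * Z) := Nat.mul_le_mul_right _ hl
        _ = 20 * q * Z := by ring
        _ ≤ _ := Nat.mul_le_mul_left _ hZZ
    rw [add_mul]
    omega
  have h200 : 200 * (Z * Z) ≤ (20 * q + 200) * (Z * Z) := Nat.mul_le_mul_right _ (by omega)
  have hfail : Does fail μ.toS (fun _ => []) ((20 * q + 200) * (Z * Z)) :=
    does_fail μ (by omega)
  have hbin : ∀ p e, e ∈ ops a q F E → Does (binaryProg p Tag.isFml e) μ.toS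
      ((codeBinary m p Tag.isFml e vs).elim (fun _ => [])
        fun vs' => { μ with vals := encVals vs' }.toS) ((20 * q + 200) * (Z * Z)) := fun p e he =>
    (does_binaryProg (hops e he) hB hZ p Tag.isFml hm hx hy hz hvs hle hsz).mono (by omega)
  cases ℓ with
  | sym s =>
    rcases s with ⟨n, f⟩ | ⟨n, R⟩
    · exact (does_collect_run hops hB hZ (hops _ (by simp [ops])) _ n hm hx hy hz hvs hle hsz).mono
        (hcol n (hqf n f))
    · exact (does_collect_run hops hB hZ (hops _ (by simp [ops])) _ n hm hx hy hz hvs hle hsz).mono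
        (hcol n (hqR n R))
  | var => exact hfail
  | bit b => exact hfail
  | eq =>
    exact (does_collect_run hops hB hZ (hops _ (by simp [ops])) _ 2 hm hx hy hz hvs hle hsz).mono
      (hcol 2 hq)
  | neg =>
    rw [reduceProg]
    rcases vs with _ | ⟨⟨t, c⟩, vs⟩
    · exact does_switch (exec_popVal_nil (by simp) hvs hx le_rfl) (does_fail μ le_rfl) (by omega)
    have hc : c ≤ B := hle (t, c) (by simp)
    have hpop := exec_popVal (i := 8) (n := 3 * Z + 2) (by simp) hvs hx rfl (by omega)
    simp only [Mem.update_6, Mem.update_8] at hpop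
    refine does_switch hpop (t₂ := 36 * Z) ?_ (by omega)
    simp only [onTag, tag]
    split_ifs with ht
    · subst ht
      have h := (does_run_pushVal (hops (opNeg a) (by simp [ops])) .fml
        (μ := { μ with vals := encVals vs, x := num one c }) (x := c) (y := 0) (vs := vs) hm rfl hy hz
        rfl hc (Nat.zero_le _) hB hZ).mono (t' := 36 * Z) (by omega)
      simp only [codeReduce, Option.elim_some]
      obtain ⟨⟩ := μ
      dsimp only at hx hy
      subst hx hy
      exact h
    · have : codeReduce a q m F E .neg ((t, c) :: vs) = none := by
        cases t <;> simp_all [codeReduce]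
      rw [this]
      refine does_fail _ ?_
      simp [Mem.size, Mem.toList, hvs, hx] at hsz ⊢
      omega
  | dep =>
    refine ((does_gather_switch hops hB hZ .semi (Q := .seq (run (opDep a)) (pushVal .fml)) (n := 40 * Z) hm hx hy hz hvs hle hsz le_rfl
      (out := fun u c r => { μ with vals := encVals ((.fml, (opDep a).eval [m, u, c]) :: r) }.toS)
      ?_).mono (t' := (20 * q + 200) * (Z * Z)) (by omega)) |> fun h => ?_
    swap
    · intro u c r _ hu hc
      have h := (does_run_pushVal (hops (opDep a) (by simp [ops])) .fml
        (μ := { μ with vals := encVals r, x := num one u, y := num one c }) (x := u) (y := c)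
        (vs := r) hm rfl rfl hz rfl hu hc hB hZ).mono (t' := 40 * Z) (by omega)
      obtain ⟨⟩ := μ
      dsimp only at hx hy
      subst hx hy
      exact h
    · rw [codeReduce, reduceProg]
      rcases hg : gather a q m 0 vs with ⟨u, _ | ⟨⟨t, c⟩, r⟩⟩
      · simpa [hg] using h
      · cases t <;> simpa [hg] using h
  | semicolon =>
    refine ((does_gather_switch hops hB hZ .close (Q := .seq (clear 9) (pushVal .semi)) (n := 40 * Z) hm hx hy hz hvs hle hsz le_rfl
      (out := fun u _ r => { μ with vals := encVals ((.semi, u) :: r) }.toS)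
      ?_).mono (t' := (20 * q + 200) * (Z * Z)) (by omega)) |> fun h => ?_
    swap
    · intro u c r _ hu hc
      have h := Does.seq (does_clear (i := 9) (S := { μ with
          x := num one u, y := num one c, vals := encVals r }.toS) (Mem.update_9 _ _).symm
        (t := 2 * Z + 2) (by simp; omega)) (does_pushVal (L := L) .semi (c := u) (n := 3 * Z + 3) rfl rfl
          (by omega)) (t := 40 * Z) (by omega)
      obtain ⟨⟩ := μ
      dsimp only at hx hy
      subst hx hy
      exact h
    · rw [codeReduce, reduceProg]
      rcases hg : gather a q m 0 vs with ⟨u, _ | ⟨⟨t, c⟩, r⟩⟩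
      · simpa [hg] using h
      · cases t <;> simpa [hg] using h
  | close =>
    have h := (does_pushVal .close (c := 0) (n := 3) hvs (by simpa using hx) (by omega)).mono
      (t' := (20 * q + 200) * (Z * Z)) (by omega)
    obtain ⟨⟩ := μ
    dsimp only at hx hy
    subst hx hy
    exact h
  | and => exact hbin _ _ (by simp [ops])
  | or => exact hbin _ _ (by simp [ops])
  | ex => exact hbin _ _ (by simp [ops])
  | all => exact hbin _ _ (by simp [ops])

/-- The bound for the codes is an invariant of the value stack. -/
theorem codeReduce_le (hops : ∀ e ∈ ops a q F E, OpBound m B Z e) {ℓ : Letter L}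
    {vs vs' : List (Tag × ℕ)} (hle : ∀ p ∈ vs, p.2 ≤ B)
    (h : codeReduce a q m F E ℓ vs = some vs') : ∀ p ∈ vs', p.2 ≤ B := by
  have hcol : ∀ (t : Tag) (e : NExp) (l : ℕ), e ∈ ops a q F E →
      ((collect a q m l 0 vs).map fun p => (t, e.eval [m, p.1, 0]) :: p.2) = some vs' →
      ∀ p ∈ vs', p.2 ≤ B := by
    intro t e l he h
    simp only [Option.map_eq_some_iff] at h
    obtain ⟨⟨c, r⟩, hc, rfl⟩ := h
    obtain ⟨h1, h2⟩ := collect_le (OpBound.of_tupOp hops) (Nat.zero_le B) hle hc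
    intro p hp
    rcases List.mem_cons.1 hp with rfl | hp
    · exact (hops e he c h1 0 (Nat.zero_le _)).2
    · exact h2 p hp
  obtain ⟨hu, hsuf⟩ := gather_le (OpBound.of_disOp hops) (acc := 0) (Nat.zero_le B) hle
  unfold codeReduce at h
  split at h
  · exact hcol _ _ _ (by simp [ops]) h
  · exact hcol _ _ _ (by simp [ops]) h
  · exact hcol _ _ _ (by simp [ops]) h
  · rename_i c vs
    simp only [Option.some.injEq] at h
    subst h
    intro p hp
    rcases List.mem_cons.1 hp with rfl | hp
    · exact (hops (opNeg a) (by simp [ops]) c (hle _ List.mem_cons_self) 0 (Nat.zero_le _)).2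
    · exact hle p (by simp [hp])
  · simp only [Option.some.injEq] at h
    subst h
    simpa using hle
  · split at h
    · rename_i u c r hg
      simp only [Option.some.injEq] at h
      subst h
      rw [hg] at hu hsuf
      intro p hp
      rcases List.mem_cons.1 hp with rfl | hp
      · exact hu
      · exact hle p (hsuf.subset (by simp [hp]))
    · simp at h
  · split at h
    · rename_i u c r hg
      simp only [Option.some.injEq] at h
      subst h
      rw [hg] at hu hsuf
      intro p hp
      rcases List.mem_cons.1 hp with rfl | hp
      · exact (hops (opDep a) (by simp [ops]) u hu c (hle _ (hsuf.subset List.mem_cons_self))).2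
      · exact hle p (hsuf.subset (by simp [hp]))
    · simp at h
  · exact codeBinary_le (hops _ (by simp [ops])) hle h
  · exact codeBinary_le (hops _ (by simp [ops])) hle h
  · exact codeBinary_le (hops _ (by simp [ops])) hle h
  · exact codeBinary_le (hops _ (by simp [ops])) hle h
  · simp at h

end Codes

/-! ### Straight-line execution -/

section Exec

variable {G : Type} {P Q R : StackProg G} {F : Option G → StackProg G} {v : Option G}
  {S : ℕ → List G} {s : Option G × (ℕ → List G)} {t : ℕ}

theorem exec_seq_assoc (h : Exec (.seq P (.seq Q R)) (v, S) s t) :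
    Exec (.seq (.seq P Q) R) (v, S) s t := by
  cases h with
  | seq h₁ h₂ ht =>
    cases h₂ with
    | seq h₂ h₃ ht' => exact .seq (.seq h₁ h₂ le_rfl) h₃ (by omega)

theorem exec_push_seq {k : ℕ} {f : Option G → G} (h : Exec Q (v, update S k (f v :: S k)) s t) :
    Exec (.seq (.push k f) Q) (v, S) s (t + 1) := .seq (.push le_rfl) h (by omega)

theorem exec_pop_seq {k : ℕ} (h : Exec Q ((S k).head?, update S k (S k).tail) s t) :
    Exec (.seq (.pop k) Q) (v, S) s (t + 1) := .seq (.pop le_rfl) h (by omega)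

theorem exec_skip_seq (h : Exec Q (v, S) s t) : Exec (.seq skip Q) (v, S) s (t + 1) :=
  .seq (.load le_rfl) h (by omega)

theorem exec_switch_seq (h : Exec (.seq (F v) Q) (v, S) s t) :
    Exec (.seq (.switch F) Q) (v, S) s (t + 1) := by
  cases h with
  | seq h₁ h₂ ht => exact .seq (.switch h₁ le_rfl) h₂ (by omega)

end Exec

/-! ### Searching for a word in a list of words -/

/-- The letter for a bit. -/
def bitSym (b : Bool) : Sym L := .inr (.bit b)

/-- The letter behind each word of a list. -/
def sep : Sym L := .inr .sep

/-- A list of words of bits as one word. -/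
def encWords (ws : List (List Bool)) : List (Sym L) := ws.flatMap fun w => w.map bitSym ++ [sep]

theorem encWords_cons (w : List Bool) (ws : List (List Bool)) :
    (encWords (w :: ws) : List (Sym L)) = w.map bitSym ++ sep :: encWords ws := by
  simp [encWords]

theorem encWords_append (ws ws' : List (List Bool)) :
    (encWords (ws ++ ws') : List (Sym L)) = encWords ws ++ encWords ws' := by
  simp [encWords]

/-- At the end of a word of the list, which is equal to the word on stack `3` iff stack `13` is
empty: restore stack `3`, and report success on stack `14` if they are equal; otherwise, unless
the word has been found already, increase the number on stack `8`. -/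
def scanEnd : StackProg (Sym L) :=
  .seq (move one 12 3) (.seq (.pop 13) (.switch fun v =>
    match v with
    | none => .seq (.pop 14) (.push 14 fun _ => one)
    | some _ => .seq (clear 13) (.seq (.pop 14) (.switch fun v =>
      match v with
      | none => .push 8 fun _ => one
      | some _ => .push 14 fun _ => one))))

/-- Compare one letter of the list, which is in the register, with the next letter of the word on
stack `3`. Letters of the list go to stack `11`, compared letters of the word to stack `12`, and
each disagreement leaves a mark on stack `13`. -/
def scanLetter : Option (Sym L) → StackProg (Sym L)
  | some (.inr (.bit b)) => .seq (.push 11 fun _ => bitSym b) (.seq (.pop 3) (.switch fun v =>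
      match v with
      | some (.inr (.bit b')) =>
        if b = b' then .push 12 fun _ => bitSym b'
        else .seq (.push 12 fun _ => bitSym b') (.push 13 fun _ => one)
      | _ => .push 13 fun _ => one))
  | _ => .seq (.push 11 fun _ => sep) (.seq (.pop 3) (.seq (.switch fun v =>
      match v with
      | some g => .seq (.push 3 fun _ => g) (.push 13 fun _ => one)
      | none => skip) scanEnd))

/-- Compare the words on stack `10` with the word on stack `3`, beginning with the letter in the
register. -/
def scanLoop : StackProg (Sym L) := .loop Option.isSome (.seq (.switch scanLetter) (.pop 10))

/-- The number of positions at which `w` disagrees with the word that it is compared with. -/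
def disagree : List Bool → List Bool → ℕ
  | [], _ => 0
  | _ :: w, [] => disagree w [] + 1
  | b :: w, c :: v => disagree w v + if b = c then 0 else 1

theorem disagree_le (w v : List Bool) : disagree w v ≤ w.length := by
  induction w generalizing v with
  | nil => simp [disagree]
  | cons b w ih =>
    cases v with
    | nil => simpa [disagree] using ih []
    | cons c v =>
      have := ih v
      rw [disagree, List.length_cons]
      split_ifs <;> omega

theorem disagree_eq_zero {w v : List Bool} : disagree w v = 0 ↔ w <+: v := by
  induction w generalizing v with
  | nil => simp [disagree]
  | cons b w ih =>
    cases v with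
    | nil => simp [disagree]
    | cons c v =>
      rw [disagree, List.cons_prefix_cons, Nat.add_eq_zero_iff, ih, and_comm]
      simp

theorem eq_iff_disagree {w v : List Bool} : w = v ↔ disagree w v = 0 ∧ v.drop w.length = [] := by
  rw [disagree_eq_zero, List.drop_eq_nil_iff]
  constructor
  · rintro rfl
    simp
  · rintro ⟨h, h'⟩
    exact h.eq_of_length_le h'

theorem exec_scan_bit (b : Bool) {μ : Mem L} {v : List Bool} {d : ℕ} (hv : μ.bits = v.map bitSym)
    (hd : μ.differ = num one d) :
    Exec (.seq (.switch scanLetter) (.pop 10)) (some (bitSym b), μ.toS) (μ.z.head?, { μ with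
      z := μ.z.tail
      trail := bitSym b :: μ.trail
      bits := (v.drop 1).map bitSym
      spent := ((v.take 1).map bitSym).reverse ++ μ.spent
      differ := num one (d + disagree [b] v) }.toS) 8 := by
  refine exec_switch_seq (exec_seq_assoc (exec_push_seq (exec_seq_assoc (exec_pop_seq
    (exec_switch_seq ?_)))))
  rw [Mem.toS_11, Mem.update_11, Mem.toS_3, Mem.update_3]
  dsimp only
  rw [hv]
  rcases v with _ | ⟨c, v⟩
  · refine exec_push_seq ?_
    refine (exec_pop ?_ ?_ (t := 1) le_rfl _).mono (by omega)
    · simp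
    · simp [disagree, hd, num_succ]
  · simp only [List.map_cons, List.head?_cons, bitSym, List.tail_cons]
    split_ifs with hbc
    · refine exec_push_seq ?_
      refine (exec_pop ?_ ?_ (t := 1) le_rfl _).mono (by omega)
      · simp
      · simp [disagree, hd, hbc]
        rfl
    · refine exec_seq_assoc (exec_push_seq (exec_push_seq ?_))
      refine (exec_pop ?_ ?_ (t := 1) le_rfl _).mono (by omega)
      · simp
      · simp [disagree, hd, hbc, num_succ]
        rfl

theorem exec_scan_bits (r : List (Sym L)) {s' : Option (Sym L) × (ℕ → List (Sym L))} (w : List Bool) :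
    ∀ {μ : Mem L} {v : List Bool} {d t : ℕ}, μ.bits = v.map bitSym → μ.differ = num one d →
      Exec scanLoop (some sep, { μ with
        z := r
        trail := (w.map bitSym).reverse ++ μ.trail
        bits := (v.drop w.length).map bitSym
        spent := ((v.take w.length).map bitSym).reverse ++ μ.spent
        differ := num one (d + disagree w v) }.toS) s' t →
      Exec scanLoop ((w.map bitSym ++ sep :: r).head?, { μ with
        z := (w.map bitSym ++ sep :: r).tail }.toS) s' (t + 9 * w.length) := by
  induction w with
  | nil =>
    intro μ v d t hv hd h
    obtain ⟨⟩ := μ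
    dsimp only at hv hd
    subst hv hd
    exact h
  | cons b w ih =>
    intro μ v d t hv hd h
    have h1 := exec_scan_bit b (μ := { μ with z := w.map bitSym ++ sep :: r }) hv hd
    refine .loop_step rfl h1 (ih (μ := { μ with
      trail := bitSym b :: μ.trail
      bits := (v.drop 1).map bitSym
      spent := ((v.take 1).map bitSym).reverse ++ μ.spent
      differ := num one (d + disagree [b] v) }) (v := v.drop 1) (d := d + disagree [b] v) (t := t)
      rfl rfl ?_) (by simp only [List.length_cons]; omega)
    convert h using 3
    rcases v with _ | ⟨c, v⟩
    · simp [disagree]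
      congr 1
      omega
    · simp [disagree]
      congr 1
      omega

theorem exec_scanEnd {μ : Mem L} {u v : List Bool} {d f x : ℕ} (hv : μ.bits = v.map bitSym)
    (hu : μ.spent = (u.map bitSym).reverse) (hd : μ.differ = num one d) (hf : μ.found = num one f)
    (hx : μ.x = num one x) (hf1 : f ≤ 1) (w : Option (Sym L)) :
    Exec (.seq scanEnd (.pop 10)) (w, μ.toS) (μ.z.head?, { μ with
      z := μ.z.tail
      bits := (u ++ v).map bitSym
      spent := []
      differ := []
      found := num one (if d = 0 then 1 else f)
      x := num one (if d = 0 ∨ f = 1 then x else x + 1) }.toS) (3 * u.length + 2 * d + 12) := by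
  refine exec_seq_assoc (.seq (t₁ := 3 * u.length + 2) (t₂ := 2 * d + 10) (exec_move (by simp)
    (l := (u.map bitSym).reverse) (by simpa using hu) rfl (by simp) w) (exec_seq_assoc ?_) (by omega))
  simp only [Mem.toS_3, Mem.update_12, Mem.update_3, List.reverse_reverse]
  refine exec_pop_seq (t := 2 * d + 9) (exec_switch_seq (t := 2 * d + 8) ?_)
  simp only [Mem.toS_13, Mem.update_13, hd]
  rcases d with _ | d
  · refine exec_seq_assoc (exec_pop_seq (exec_push_seq ((exec_pop ?_ ?_ (t := 1) le_rfl _).mono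
      (by omega))))
    · simp
    · have : f = 0 ∨ f = 1 := by omega
      rcases this with rfl | rfl <;> simp [hf, hv, hx, num_succ]
  · refine exec_seq_assoc (.seq (t₁ := 2 * d + 2) (t₂ := 8) (exec_clear (Mem.update_13 _ _).symm
      (by simp [num_succ]) _) (exec_seq_assoc (exec_pop_seq (exec_switch_seq ?_))) (by omega))
    have : f = 0 ∨ f = 1 := by omega
    rcases this with rfl | rfl
    · simp only [Mem.toS_14, Mem.update_14, hf]
      refine exec_push_seq ((exec_pop ?_ ?_ (t := 1) le_rfl _).mono (by omega))
      · simp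
      · simp [hv, hx, num_succ]
    · simp only [Mem.toS_14, Mem.update_14, hf]
      refine exec_push_seq ((exec_pop ?_ ?_ (t := 1) le_rfl _).mono (by omega))
      · simp
      · simp [hv, hx, num_succ]

theorem exec_scan_sep {μ : Mem L} {u v : List Bool} {d f x : ℕ} (hv : μ.bits = v.map bitSym)
    (hu : μ.spent = (u.map bitSym).reverse) (hd : μ.differ = num one d) (hf : μ.found = num one f)
    (hx : μ.x = num one x) (hf1 : f ≤ 1) :
    Exec (.seq (.switch scanLetter) (.pop 10)) (some sep, μ.toS) (μ.z.head?, { μ with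
      z := μ.z.tail
      trail := sep :: μ.trail
      bits := (u ++ v).map bitSym
      spent := []
      differ := []
      found := num one (if d = 0 ∧ v = [] then 1 else f)
      x := num one (if (d = 0 ∧ v = []) ∨ f = 1 then x else x + 1) }.toS)
      (3 * u.length + 2 * d + 20) := by
  refine (exec_switch_seq (t := 3 * u.length + 2 * d + 19) (exec_seq_assoc (exec_push_seq
    (t := 3 * u.length + 2 * d + 18) (exec_seq_assoc (exec_pop_seq (t := 3 * u.length + 2 * d + 17)
    (exec_seq_assoc (exec_switch_seq (t := 3 * u.length + 2 * d + 16) ?_)))))))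
  rw [Mem.toS_11, Mem.update_11, Mem.toS_3, Mem.update_3]
  dsimp only
  rw [hv]
  rcases v with _ | ⟨c, v⟩
  · have h := exec_scanEnd (μ := { μ with bits := [], trail := sep :: μ.trail }) (u := u) (v := [])
      rfl hu hd hf hx hf1 none
    replace h := h.mono (t' := 3 * u.length + 2 * d + 15) (by omega)
    refine exec_skip_seq (t := 3 * u.length + 2 * d + 15) ?_
    simpa using h
  · have h := exec_scanEnd (μ := { μ with
        bits := (c :: v).map bitSym, trail := sep :: μ.trail, differ := num one (d + 1) }) (u := u)
      (v := c :: v) rfl hu rfl hf hx hf1 (some (bitSym c))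
    refine exec_seq_assoc (exec_push_seq (t := 3 * u.length + 2 * d + 15) (exec_push_seq
      (t := 3 * u.length + 2 * d + 14) (h.mono (t' := 3 * u.length + 2 * d + 14) (by omega) |>
        fun h => ?_)))
    simpa [hd, num_succ] using h

/-- All words on stack `10` are compared with the word `v`; in the end stack `14` says whether `v`
has been found, and the number on stack `8` has been increased by its position in the list. -/
theorem exec_scanLoop (v : List Bool) (ws : List (List Bool)) :
    ∀ {μ : Mem L} {f x : ℕ}, μ.bits = v.map bitSym → μ.spent = [] → μ.differ = [] →
      μ.found = num one f → μ.x = num one x → f ≤ 1 →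
      Exec scanLoop ((encWords ws : List (Sym L)).head?, { μ with z := (encWords ws).tail }.toS)
        (none, { μ with
          z := []
          trail := (encWords ws).reverse ++ μ.trail
          found := num one (if v ∈ ws then 1 else f)
          x := num one (if f = 1 then x else x + ws.idxOf v) }.toS)
        (23 * (encWords ws : List (Sym L)).length + 1) := by
  induction ws with
  | nil =>
    intro μ f x hv hu hd hf hx hf1
    obtain ⟨⟩ := μ
    dsimp only at hf hx
    subst hf hx
    simp only [encWords, List.flatMap_nil, List.reverse_nil, List.nil_append, List.not_mem_nil,
      if_false, List.idxOf_nil, add_zero, ite_self]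
    exact Exec.loop_done rfl (by simp)
  | cons w ws ih =>
    intro μ f x hv hu hd hf hx hf1
    rw [encWords_cons]
    have hdis := disagree_le w v
    have heq := eq_iff_disagree (w := w) (v := v)
    have h1 := exec_scan_sep (u := v.take w.length) (v := v.drop w.length) (μ := { μ with
        z := encWords ws
        trail := (w.map bitSym).reverse ++ μ.trail
        bits := (v.drop w.length).map bitSym
        spent := ((v.take w.length).map bitSym).reverse ++ μ.spent
        differ := num one (0 + disagree w v) }) rfl (by simp [hu]) rfl hf hx hf1
    simp only [zero_add, ← heq, List.take_append_drop] at h1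
    have h2 := ih (μ := { μ with
        trail := sep :: ((w.map bitSym).reverse ++ μ.trail)
        bits := v.map bitSym
        spent := []
        differ := []
        found := num one (if w = v then 1 else f)
        x := num one (if w = v ∨ f = 1 then x else x + 1) }) rfl rfl rfl rfl rfl (by split_ifs <;> omega)
    have h := exec_scan_bits (encWords ws) w (d := 0) hv hd (.loop_step rfl (by simpa using h1) h2 le_rfl)
    have hlen : (encWords (w :: ws) : List (Sym L)).length =
        w.length + 1 + (encWords ws : List (Sym L)).length := by
      simp [encWords_cons]
      omega
    rw [← encWords_cons] at h ⊢
    have hmin := List.length_take_le w.length v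
    replace h := h.mono (t' := 23 * (encWords (w :: ws) : List (Sym L)).length + 1) (by omega)
    convert h using 4
    · rw [List.idxOf_cons]
      have : f = 0 ∨ f = 1 := by omega
      congr 1
      by_cases hwv : w = v
      · simp [hwv]
      · rcases this with rfl | rfl
        · simp [hwv, beq_eq_false_iff_ne.2 hwv]
          omega
        · simp
    · simp [encWords_cons]
    · have : f = 0 ∨ f = 1 := by omega
      by_cases hwv : w = v
      · simp [hwv]
      · simp [hwv, show ¬v = w from fun h => hwv h.symm]

/-- Search for the word on stack `3` in the list on the stack `i`, write its position to the stack
`8`, and continue with `Q` if it has been found; otherwise append it to the list and continue with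
`Q'`. The list is moved twice at first, so that it can be scanned from its first letter on. -/
def look (i : ℕ) (Q Q' : StackProg (Sym L)) : StackProg (Sym L) :=
  .seq (move one i 11) (.seq (move one 11 10) (.seq (.seq (.pop 10) scanLoop) (.seq (.pop 14)
    (.switch fun v =>
      match v with
      | some _ => .seq (move one 11 i) Q
      | none => .seq (.push i fun _ => sep) (.seq (move one 3 12) (.seq (fork one 12 3 i)
          (.seq (move one 11 i) Q')))))))

theorem does_look {i : ℕ} (hi : i = 4 ∨ i = 5) {Q Q' : StackProg (Sym L)} {μ : Mem L}
    {v : List Bool} {ws : List (List Bool)} {t n : ℕ} {out : ℕ → List (Sym L)}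
    (hws : μ.toS i = encWords ws) (hv : μ.bits = v.map bitSym) (hx : μ.x = []) (hz : μ.z = [])
    (htr : μ.trail = []) (hsp : μ.spent = []) (hd : μ.differ = []) (hf : μ.found = [])
    (hQ : v ∈ ws → Does Q (update { μ with x := num one (ws.idxOf v) }.toS i (encWords ws)) out t)
    (hQ' : v ∉ ws →
      Does Q' (update { μ with x := num one (ws.idxOf v) }.toS i (encWords (ws ++ [v]))) out t)
    (hn : t + 50 * (encWords ws : List (Sym L)).length + 10 * v.length + 50 ≤ n) :
    Does (look i Q Q') μ.toS out n := by
  set N := (encWords ws : List (Sym L)).length with hN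
  have hscan := exec_scanLoop v ws (μ := { (if i = 4 then { μ with seen := [] } else
    { μ with dict := [] } : Mem L) with trail := [] }) (f := 0) (x := 0)
    (by split_ifs <;> exact hv) (by split_ifs <;> exact hsp) (by split_ifs <;> exact hd)
    (by split_ifs <;> exact hf) (by split_ifs <;> exact hx) zero_le_one
  simp only [zero_ne_one, if_false, zero_add, List.append_nil] at hscan
  unfold look
  have hi11 : i ≠ 11 := by omega
  have hi3 : i ≠ 3 := by omega
  have hi12 : i ≠ 12 := by omega
  refine Does.seq (t₁ := 3 * N + 2) (t₂ := n - (3 * N + 2)) (does_move hi11 hws rfl le_rfl) ?_ (by omega)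
  refine Does.seq (t₁ := 3 * N + 2) (t₂ := n - (6 * N + 4)) (does_move (l := (encWords ws).reverse)
    (by simp) (by simp [htr]) rfl (by simp [hN])) ?_ (by omega)
  refine Does.seq (t₁ := 23 * N + 2) (t₂ := n - (29 * N + 6))
    (S₁ := update { μ with
        x := num one (ws.idxOf v)
        trail := (encWords ws).reverse
        found := num one (if v ∈ ws then 1 else 0) }.toS i []) ?_ ?_ (by omega)
  · intro u
    refine ⟨none, .seq (t₁ := 1) (t₂ := 23 * N + 1) (.pop le_rfl) ?_ (by omega)⟩
    rcases hi with rfl | rfl <;> simpa [hz, htr] using hscan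
  refine does_switch (t₁ := 1) (t₂ := n - (29 * N + 8)) (S₁ := update { μ with
    x := num one (ws.idxOf v), trail := (encWords ws).reverse }.toS i [])
    (v₁ := if v ∈ ws then some one else none) (exec_pop ?_ ?_ le_rfl) ?_ (by omega)
  · rcases hi with rfl | rfl <;> by_cases hvw : v ∈ ws <;> simp [hvw, num_succ]
  · rcases hi with rfl | rfl <;> by_cases hvw : v ∈ ws <;> simp [hvw, num_succ, hf]
  by_cases hvw : v ∈ ws
  · rw [if_pos hvw]
    refine Does.seq (t₁ := 3 * N + 2) (t₂ := t) (does_move (l := (encWords ws).reverse) hi11.symm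
      (by simp [hi11.symm]) rfl (by simp [hN])) ?_ (by omega)
    have := hQ hvw
    obtain ⟨⟩ := μ
    dsimp only at htr hsp hv
    subst htr hsp hv
    rcases hi with rfl | rfl <;> simpa using this
  · rw [if_neg hvw]
    refine Does.seq (t₁ := 1) (t₂ := n - (29 * N + 9)) (does_push _ _ _ le_rfl) ?_ (by omega)
    refine Does.seq (t₁ := 3 * v.length + 2) (t₂ := n - (29 * N + 3 * v.length + 11))
      (does_move (by simp) (l := v.map bitSym) (by simp [hi3.symm, hv]) rfl (by simp)) ?_ (by omega)
    refine Does.seq (t₁ := 4 * v.length + 2) (t₂ := n - (29 * N + 7 * v.length + 13))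
      (does_fork (by simp) hi12.symm hi3.symm (l := (v.map bitSym).reverse)
        (by simp [hi12.symm, hsp]) rfl (by simp)) ?_ (by omega)
    refine Does.seq (t₁ := 3 * N + 2) (t₂ := t) (does_move hi11.symm (l := (encWords ws).reverse)
      (by simp [hi11.symm]) rfl (by simp [hN])) ?_ (by omega)
    have := hQ' hvw
    rw [encWords_append, encWords_cons] at this
    obtain ⟨⟩ := μ
    dsimp only at htr hsp hv
    subst htr hsp hv
    rcases hi with rfl | rfl <;> simpa [encWords] using this

/-! ### The run of the machine -/

/-- The configuration between two letters: the number of new variables that may still occur, the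
bits of the next variable, the variables that have occurred, the variables that have a slot, and the
value stack. -/
structure Conf : Type where
  budget : ℕ
  bits : List Bool
  seen : List (List Bool)
  dict : List (List Bool)
  vals : List (Tag × ℕ)

/-- The stacks of a configuration. -/
def Conf.mem (m : ℕ) (inp : List (Sym L)) (s : Conf) : Mem L where
  input := inp
  budget := num one s.budget
  slots := num one m
  bits := s.bits.map bitSym
  seen := encWords s.seen
  dict := encWords s.dict
  vals := encVals s.vals
  ok := [one]

section Run

variable (a q m : ℕ) (F : L.Symbols → ℕ → ℕ) (E : ℕ → ℕ)

/-- The effect of a letter on the configuration. Leading zeros of a binary representation, which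
are its letters furthest to the right, are refused. A variable that has not been seen yet costs one
unit of the budget, even if it belongs to the domain of the team and has a slot already. -/
def confStep : Letter L → Conf → Option Conf
  | .bit b, s => if b = false ∧ s.bits = [] then none else some { s with bits := b :: s.bits }
  | .var, s =>
    if s.bits ∈ s.seen ∨ 0 < s.budget then
      some ⟨if s.bits ∈ s.seen then s.budget else s.budget - 1, [], addNew s.bits s.seen,
        addNew s.bits s.dict, (.var, s.dict.idxOf s.bits) :: s.vals⟩
    else none
  | ℓ, s => if s.bits = [] then (codeReduce a q m F E ℓ s.vals).map fun vs => { s with vals := vs }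
    else none

/-- The effect of a sequence of letters on the configuration. -/
def confRun : List (Letter L) → Conf → Option Conf
  | [], s => some s
  | ℓ :: u, s => (confStep a q m F E ℓ s).bind (confRun u)

theorem confRun_append (u u' : List (Letter L)) (s : Conf) :
    confRun a q m F E (u ++ u') s = (confRun a q m F E u s).bind (confRun a q m F E u') := by
  induction u generalizing s with
  | nil => rfl
  | cons ℓ u ih =>
    simp only [List.cons_append, confRun, Option.bind_assoc]
    congr 1
    exact funext ih

/-- Push the slot of a variable, which is its position in the list on the stack `5`. -/
def slotProg : StackProg (Sym L) :=
  .seq (clear 8) (look 5 (.seq (clear 3) (pushVal .var)) (.seq (clear 3) (pushVal .var)))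

/-- The program for a variable sign. -/
def varProg : StackProg (Sym L) :=
  look 4 slotProg (.seq (.pop 1) (.switch fun v =>
    match v with
    | none => fail
    | some _ => slotProg))

/-- The program for a letter. -/
def letterProg : Letter L → StackProg (Sym L)
  | .bit b => .seq (.pop 3) (.switch fun v =>
      match v with
      | some g => .seq (.push 3 fun _ => g) (.push 3 fun _ => bitSym b)
      | none => if b then .push 3 fun _ => bitSym b else fail)
  | .var => varProg
  | ℓ => .seq (.pop 3) (.switch fun v =>
      match v with
      | some _ => fail
      | none => reduceProg a q F E ℓ)

variable {a q m F E} {B Z : ℕ}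

theorem length_le_length_encWords (ws : List (List Bool)) :
    ws.length ≤ (encWords ws : List (Sym L)).length := by
  induction ws with
  | nil => simp
  | cons w ws ih =>
    rw [encWords_cons]
    simp
    omega

theorem does_slotProg {μ : Mem L} {v : List Bool} {ds : List (List Bool)} {vs : List (Tag × ℕ)} {i : ℕ}
    (hv : μ.bits = v.map bitSym) (hds : μ.dict = encWords ds) (hvs : μ.vals = encVals vs)
    (hx : μ.x = num one i) (hz : μ.z = []) (htr : μ.trail = []) (hsp : μ.spent = [])
    (hd : μ.differ = []) (hf : μ.found = []) (hiZ : i ≤ Z) (hvZ : v.length ≤ Z)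
    (hdZ : (encWords ds : List (Sym L)).length ≤ Z) (hZ : 1 ≤ Z) :
    Does slotProg μ.toS { μ with
      x := []
      dict := encWords (addNew v ds)
      bits := []
      vals := encVals ((.var, ds.idxOf v) :: vs) }.toS (130 * Z) := by
  have hidx : ds.idxOf v ≤ Z :=
    (List.idxOf_le_length).trans ((length_le_length_encWords (L := L) ds).trans hdZ)
  refine Does.seq (t₁ := 2 * Z + 2) (t₂ := 120 * Z) (does_clear (Mem.update_8 _ _).symm
    (by simp [hx]; omega)) ?_ (by omega)
  have key : ∀ ds', Does (.seq (clear 3) (pushVal .var))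
      { μ with x := num one (ds.idxOf v), dict := encWords ds' }.toS { μ with
        x := []
        dict := encWords ds'
        bits := []
        vals := encVals ((.var, ds.idxOf v) :: vs) }.toS (5 * Z + 5) := fun ds' =>
    (does_clear (Mem.update_3 _ _).symm (t := 2 * Z + 2) (by simp [hv]; omega)).seq
      (does_pushVal .var (c := ds.idxOf v) (n := 3 * Z + 3) hvs rfl (by omega)) (by omega)
  refine does_look (.inr rfl) (t := 5 * Z + 5) hds hv rfl hz htr hsp hd hf ?_ ?_ (by omega)
  · intro h
    simpa [addNew, h] using key ds
  · intro h
    simpa [addNew, h] using key (ds ++ [v])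

theorem does_varProg {s : Conf} {inp : List (Sym L)} (hsz : (s.mem m inp).size ≤ Z) (hZ : 1 ≤ Z) :
    Does varProg (s.mem m inp).toS ((confStep a q m F E .var s).elim (fun _ => [])
      fun s' => (s'.mem m inp).toS) (300 * Z) := by
  have hsz' := hsz
  simp only [Mem.size, Mem.toList, Conf.mem, List.map_cons, List.map_nil, List.sum_cons, List.sum_nil,
    List.length_map, List.length_nil] at hsz'
  have hidx : s.seen.idxOf s.bits ≤ Z :=
    (List.idxOf_le_length).trans ((length_le_length_encWords (L := L) s.seen).trans (by omega))
  have key : ∀ es bud, Does slotProg { (s.mem m inp) with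
        x := num one (s.seen.idxOf s.bits), seen := encWords es, budget := num one bud }.toS
      ({ s with
        budget := bud
        seen := es
        dict := addNew s.bits s.dict
        bits := []
        vals := (.var, s.dict.idxOf s.bits) :: s.vals }.mem m inp).toS (130 * Z) := fun es bud =>
    does_slotProg (i := s.seen.idxOf s.bits) (v := s.bits) (ds := s.dict) (vs := s.vals) rfl rfl rfl rfl
      rfl rfl rfl rfl rfl hidx (by omega) (by omega) hZ
  refine does_look (.inl rfl) (t := 150 * Z) rfl rfl rfl rfl rfl rfl rfl rfl ?_ ?_ (by omega)
  · intro h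
    rw [confStep, if_pos (.inl h), if_pos h]
    have := (key s.seen s.budget).mono (t' := 150 * Z) (by omega)
    simpa [addNew, h, Conf.mem] using this
  · intro h
    rcases hb : s.budget with _ | b
    · rw [confStep, if_neg (by simp [h, hb])]
      refine does_switch (t₁ := 1) (t₂ := 40 * Z) (v₁ := none) (S₁ := { (s.mem m inp) with
        x := num one (s.seen.idxOf s.bits), seen := encWords (s.seen ++ [s.bits]) }.toS)
        (exec_pop ?_ ?_ le_rfl) (does_fail _ ?_) (by omega)
      · simp [Conf.mem, hb]
      · simp [Conf.mem, hb]
      · simp [Mem.size, Mem.toList, Conf.mem, encWords_append, encWords_cons, encWords] at hsz' ⊢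
        omega
    · rw [confStep, if_pos (by simp [hb]), if_neg h, hb]
      have h1 := key (s.seen ++ [s.bits]) b
      refine does_switch (t₁ := 1) (t₂ := 130 * Z) (v₁ := some one) (S₁ := { (s.mem m inp) with
        x := num one (s.seen.idxOf s.bits), seen := encWords (s.seen ++ [s.bits]),
        budget := num one b }.toS) (exec_pop ?_ ?_ le_rfl) ?_ (by omega)
      · simp [Conf.mem, hb, num_succ]
      · simp [Conf.mem, hb, num_succ]
      · simpa [addNew, h] using h1

theorem confStep_other {ℓ : Letter L} (h₁ : ∀ b, ℓ ≠ .bit b) (h₂ : ℓ ≠ .var) (s : Conf) :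
    confStep a q m F E ℓ s = if s.bits = [] then
      (codeReduce a q m F E ℓ s.vals).map fun vs => { s with vals := vs } else none := by
  cases ℓ with
  | var => exact absurd rfl h₂
  | bit b => exact absurd rfl (h₁ b)
  | _ => rfl

theorem letterProg_other {ℓ : Letter L} (h₁ : ∀ b, ℓ ≠ .bit b) (h₂ : ℓ ≠ .var) :
    letterProg a q F E ℓ = .seq (.pop 3) (.switch fun v =>
      match v with
      | some _ => fail
      | none => reduceProg a q F E ℓ) := by
  cases ℓ with
  | var => exact absurd rfl h₂
  | bit b => exact absurd rfl (h₁ b)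
  | _ => rfl

/-- The program for a letter carries out `confStep`, and rejects where that is undefined. -/
theorem does_letterProg (hops : ∀ e ∈ ops a q F E, OpBound m B Z e) (hB : B ≤ Z) (hZ : 1 ≤ Z)
    (hq : 2 ≤ q) (hqf : ∀ n, L.Functions n → n ≤ q) (hqR : ∀ n, L.Relations n → n ≤ q)
    (ℓ : Letter L) {s : Conf} {inp : List (Sym L)} (hle : ∀ p ∈ s.vals, p.2 ≤ B)
    (hsz : (s.mem m inp).size ≤ Z) :
    Does (letterProg a q F E ℓ) (s.mem m inp).toS ((confStep a q m F E ℓ s).elim (fun _ => [])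
      fun s' => (s'.mem m inp).toS) ((20 * q + 400) * (Z * Z)) := by
  have hZZ : Z ≤ Z * Z := Nat.le_mul_of_pos_left Z hZ
  have hC : (20 * q + 400) * (Z * Z) = (20 * q + 200) * (Z * Z) + 200 * (Z * Z) := by ring
  have h400 : 200 * (Z * Z) ≤ (20 * q + 200) * (Z * Z) := Nat.mul_le_mul_right _ (by omega)
  by_cases hbit : ∃ b, ℓ = .bit b
  · obtain ⟨b, rfl⟩ := hbit
    rw [letterProg]
    refine does_switch (t₁ := 1) (t₂ := 100 * Z) (exec_pop rfl rfl le_rfl) ?_ (by omega)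
    rcases hs : s.bits with _ | ⟨c, v⟩
    · have h3 : (s.mem m inp).toS 3 = [] := by simp [Conf.mem, hs]
      rw [h3, Function.update_eq_self_iff.2 (by rw [h3]; rfl)]
      cases b
      · have hc : confStep a q m F E (.bit false) s = none := if_pos ⟨rfl, hs⟩
        rw [hc]
        exact does_fail _ (by omega)
      · have hc : confStep a q m F E (.bit true) s = some { s with bits := [true] } := by
          simp [confStep, hs]
        rw [hc]
        have h := does_push 3 (bitSym true) (s.mem m inp).toS (t := 100 * Z) (by omega)
        simpa [Conf.mem, hs] using h
    · have hc : confStep a q m F E (.bit b) s = some { s with bits := b :: c :: v } := by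
        simp [confStep, hs]
      rw [hc]
      have h := (does_push 3 (bitSym c) (update (s.mem m inp).toS 3 (v.map bitSym)) (t := 1) le_rfl).seq
        (does_push 3 (bitSym b) _ le_rfl) (t := 100 * Z) (by omega)
      simpa [Conf.mem, hs] using h
  by_cases hv : ℓ = .var
  · subst hv
    exact (does_varProg hsz hZ).mono (by omega)
  rw [confStep_other (fun b hb => hbit ⟨b, hb⟩) hv, letterProg_other (fun b hb => hbit ⟨b, hb⟩) hv]
  refine does_switch (t₁ := 1) (t₂ := (20 * q + 200) * (Z * Z) + 100 * (Z * Z)) (exec_pop rfl rfl le_rfl)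
    ?_ (by omega)
  rcases hs : s.bits with _ | ⟨c, v⟩
  · have : (s.mem m inp).toS 3 = [] := by simp [Conf.mem, hs]
    rw [this, Function.update_eq_self_iff.2 (by rw [this]; rfl), if_pos rfl]
    have h := (does_reduceProg hops hB hZ hq hqf hqR ℓ (μ := s.mem m inp) rfl rfl rfl rfl rfl hle
      hsz).mono (t' := (20 * q + 200) * (Z * Z) + 100 * (Z * Z)) (by omega)
    cases hr : codeReduce a q m F E ℓ s.vals with
    | none => simpa [hr] using h
    | some vs => simpa [hr, Conf.mem, hs] using h
  · rw [if_neg (by simp)]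
    have h := does_fail ({ (s.mem m inp) with bits := v.map bitSym }) (t := (20 * q + 200) * (Z * Z) +
      100 * (Z * Z)) (by
        simp [Mem.size, Mem.toList, Conf.mem, hs] at hsz ⊢
        omega)
    simpa [Conf.mem, hs] using h

end Run

/-! ### The main program -/

section Run

variable (a q : ℕ) (F : L.Symbols → ℕ → ℕ) (E : ℕ → ℕ)

/-- Process the letters, beginning with the one in the register. -/
def mainLoop : StackProg (Sym L) :=
  .loop Option.isSome (.seq (.switch fun v =>
    match v with
    | some (.inl ℓ) => letterProg a q F E ℓ
    | _ => skip) (.pop 0))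

/-- Push a word onto the stack `i`. -/
def pushList (i : ℕ) : List (Sym L) → StackProg (Sym L)
  | [] => skip
  | g :: l => .seq (pushList i l) (.push i fun _ => g)

/-- Preload the variables `d` with `r` slots and a budget of `k₀` new variables; add the unary
number on top of the input to the budget and to the number of slots, and load the next letter. -/
def startProg (d : List (List Bool)) (r k₀ : ℕ) : StackProg (Sym L) :=
  .seq (pushList 5 (encWords d)) (.seq (pushList 2 (num one (r + k₀))) (.seq (pushList 1 (num one k₀))
    (.seq (pushList 7 [one]) (.seq (.pop 0) (.loop isOne (.seq (.push 1 fun _ => one)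
      (.seq (.push 2 fun _ => one) (.pop 0))))))))

/-- Fail unless the stack `i` is empty. -/
def requireEmpty (i : ℕ) (Q : StackProg (Sym L)) : StackProg (Sym L) :=
  .seq (.pop i) (.switch fun v =>
    match v with
    | some _ => fail
    | none => Q)

/-- Evaluate the acceptance condition `e` on the number on stack `8`, and empty the stacks. -/
def acceptProg (e : NExp) : StackProg (Sym L) :=
  .seq (run e) (.seq (clear 1) (.seq (clear 2) (.seq (clear 4) (.seq (clear 5) (.pop 8)))))

/-- Check whether the machine accepts; then the register contains a letter. With `exact`, the budget
of variables has to be exhausted. -/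
def finalProg (exact : Bool) (e : NExp) : StackProg (Sym L) :=
  .seq (.pop 7) (.switch fun v =>
    match v with
    | none => skip
    | some _ => requireEmpty 3 (.seq (popVal 8) (.switch (onTag fun t =>
        if t.isFml then
          requireEmpty 6 (if exact then requireEmpty 1 (acceptProg e) else acceptProg e)
        else fail))))

/-- The configuration is accepted: a single formula is left, and the condition `e` holds for its
code. With `exact`, the budget of variables is exhausted. -/
def Conf.Accepts (m : ℕ) (exact : Bool) (e : NExp) (s : Conf) : Prop :=
  s.bits = [] ∧ (exact = true → s.budget = 0) ∧
    ∃ t c, s.vals = [(t, c)] ∧ t.isFml = true ∧ e.Holds [m, c, 0]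

variable {a q F E} {m B Z : ℕ}

theorem does_pushList (i : ℕ) (l : List (Sym L)) (S : ℕ → List (Sym L)) :
    Does (pushList i l) S (update S i (l ++ S i)) (l.length + 1) := by
  induction l with
  | nil =>
    rw [List.nil_append, Function.update_eq_self]
    exact does_skip S le_rfl
  | cons g l ih =>
    refine ih.seq (t₂ := 1) ?_ (by simp)
    simpa using does_push i g (update S i (l ++ S i)) le_rfl

/-- The configuration before the first letter. -/
theorem exec_startProg (d : List (List Bool)) (r k₀ k : ℕ) (u : List (Letter L)) :
    Exec (startProg d r k₀) (none, update (fun _ => []) 0 (num one k ++ u.map Sum.inl))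
      ((u.map (Sum.inl : Letter L → Sym L)).head?,
        ((⟨k₀ + k, [], [], d, []⟩ : Conf).mem (r + k₀ + k) (u.map Sum.inl).tail).toS)
      ((encWords d : List (Sym L)).length + r + 2 * k₀ + 4 * k + 10) := by
  have hloop : ∀ (k k₁ m : ℕ), Exec (.loop isOne (.seq (.push 1 fun _ => one)
      (.seq (.push 2 fun _ => one) (.pop 0)))) ((num one k ++ u.map Sum.inl).head?,
      ((⟨k₁, [], [], d, []⟩ : Conf).mem m (num one k ++ u.map Sum.inl).tail).toS)
      ((u.map (Sum.inl : Letter L → Sym L)).head?,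
        ((⟨k₁ + k, [], [], d, []⟩ : Conf).mem (m + k) (u.map Sum.inl).tail).toS) (4 * k + 1) := by
    intro k
    induction k with
    | zero =>
      intro k₁ m
      refine .loop_done ?_ (by simp)
      rcases u with _ | ⟨ℓ, u⟩ <;> rfl
    | succ k ih =>
      intro k₁ m
      have h := ih (k₁ + 1) (m + 1)
      rw [show k₁ + 1 + k = k₁ + (k + 1) by omega, show m + 1 + k = m + (k + 1) by omega] at h
      refine .loop_step (t₁ := 3) (t₂ := 4 * k + 1) rfl ?_ h (by omega)
      refine exec_push_seq (exec_push_seq (exec_pop ?_ ?_ le_rfl _))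
      · simp [Conf.mem, num_succ]
      · simp [Conf.mem, num_succ]
  have h0 : (update (fun _ => []) 0 (num one k ++ u.map Sum.inl) : ℕ → List (Sym L)) =
      ({ input := num one k ++ u.map Sum.inl } : Mem L).toS := by
    rw [← Mem.toS_empty, Mem.update_0]
  rw [h0]
  refine Does.exec_seq (t₂ := r + 2 * k₀ + 4 * k + 9) (does_pushList 5 _ _) ?_ (by omega) none
  intro v
  refine Does.exec_seq (t₂ := k₀ + 4 * k + 8) (does_pushList 2 _ _) ?_ (by simp; omega) v
  intro v
  refine Does.exec_seq (t₂ := 4 * k + 7) (does_pushList 1 _ _) ?_ (by simp; omega) v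
  intro v
  refine Does.exec_seq (t₂ := 4 * k + 4) (does_pushList 7 _ _) ?_ (by simp; omega) v
  intro v
  refine exec_pop_seq (t := 4 * k + 3) ((hloop k k₀ (r + k₀)).mono (t' := 4 * k + 3) (by omega) |>
    fun h => ?_)
  simpa [Conf.mem, encWords, encVals] using h

/-- The invariants of the run of the machine on words of length at most `n`, where `j` letters are
left: bounds for the codes and for the lengths of the stacks. -/
structure Conf.Bounded (L : FirstOrder.Language.{0, 0}) (m B n d j : ℕ) (s : Conf) : Prop where
  codes : ∀ p ∈ s.vals, p.2 ≤ B
  vals : s.vals.length + j ≤ n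
  seen : s.bits.length + (encWords s.seen : List (Sym L)).length + j ≤ n
  dict : s.bits.length + (encWords s.dict : List (Sym L)).length + j ≤ n + d
  slots : s.dict.length + s.budget ≤ m
  subset : s.seen ⊆ s.dict

theorem collect_suffix : ∀ {l acc : ℕ} {vs vs' : List (Tag × ℕ)} {c : ℕ},
    collect a q m l acc vs = some (c, vs') → vs' <:+ vs
  | 0, acc, vs, vs', c, h => by
    simp only [collect, Option.some.injEq, Prod.mk.injEq] at h
    rw [h.2]
  | l + 1, acc, [], vs', c, h => by simp [collect] at h
  | l + 1, acc, (t, d) :: vs, vs', c, h => by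
    rw [collect] at h
    rcases he : tupOp a q t with _ | e
    · simp [he] at h
    · simp only [he] at h
      exact (collect_suffix h).trans (List.suffix_cons _ _)

theorem gather_suffix : ∀ {acc : ℕ} {vs : List (Tag × ℕ)}, (gather a q m acc vs).2 <:+ vs
  | acc, [] => List.suffix_rfl
  | acc, (t, d) :: vs => by
    rw [gather]
    rcases he : disOp a q t with _ | e
    · exact List.suffix_rfl
    · exact gather_suffix.trans (List.suffix_cons _ _)

theorem length_codeBinary {p p' : Tag → Bool} {e : NExp} {vs vs' : List (Tag × ℕ)}
    (h : codeBinary m p p' e vs = some vs') : vs'.length ≤ vs.length + 1 := by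
  unfold codeBinary at h
  split at h
  · split_ifs at h
    simp only [Option.some.injEq] at h
    subst h
    simp
  · simp at h

theorem length_codeReduce {ℓ : Letter L} {vs vs' : List (Tag × ℕ)}
    (h : codeReduce a q m F E ℓ vs = some vs') : vs'.length ≤ vs.length + 1 := by
  have hcol : ∀ (t : Tag) (e : NExp) (l : ℕ),
      ((collect a q m l 0 vs).map fun p => (t, e.eval [m, p.1, 0]) :: p.2) = some vs' →
      vs'.length ≤ vs.length + 1 := by
    intro t e l h
    simp only [Option.map_eq_some_iff] at h
    obtain ⟨⟨c, r⟩, hc, rfl⟩ := h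
    simpa using (collect_suffix hc).length_le
  have hg : ∀ {x}, gather a q m 0 vs = x → x.2.length ≤ vs.length := by
    rintro x rfl
    exact gather_suffix.length_le
  unfold codeReduce at h
  split at h
  · exact hcol _ _ _ h
  · exact hcol _ _ _ h
  · exact hcol _ _ _ h
  · simp only [Option.some.injEq] at h
    subst h
    simp
  · simp only [Option.some.injEq] at h
    subst h
    simp
  · split at h
    · rename_i u c r hu
      simp only [Option.some.injEq] at h
      subst h
      have := hg hu
      simp only [List.length_cons] at this ⊢
      omega
    · simp at h
  · split at h
    · rename_i u c r hu
      simp only [Option.some.injEq] at h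
      subst h
      have := hg hu
      simp only [List.length_cons] at this ⊢
      omega
    · simp at h
  · exact length_codeBinary h
  · exact length_codeBinary h
  · exact length_codeBinary h
  · exact length_codeBinary h
  · simp at h

theorem length_encWords_addNew_le (w : List Bool) (ws : List (List Bool)) :
    (encWords (addNew w ws) : List (Sym L)).length ≤
      (encWords ws : List (Sym L)).length + w.length + 1 := by
  unfold addNew
  split_ifs
  · omega
  · simp [encWords]
    omega

theorem Conf.Bounded.step (hops : ∀ e ∈ ops a q F E, OpBound m B Z e) (hmB : m ≤ B) {n d j : ℕ}
    {ℓ : Letter L} {s s' : Conf} (hs : s.Bounded L m B n d (j + 1))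
    (h : confStep a q m F E ℓ s = some s') : s'.Bounded L m B n d j := by
  obtain ⟨h1, h2, h3, h4, h5, h6⟩ := hs
  by_cases hbit : ∃ b, ℓ = .bit b
  · obtain ⟨b, rfl⟩ := hbit
    simp only [confStep] at h
    split_ifs at h
    simp only [Option.some.injEq] at h
    subst h
    exact ⟨h1, by dsimp only; omega, by simp; omega, by simp; omega, h5, h6⟩
  by_cases hv : ℓ = .var
  · subst hv
    simp only [confStep] at h
    split_ifs at h with h0 hb
    · simp only [Option.some.injEq] at h
      subst h
      have hd : s.bits ∈ s.dict := h6 hb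
      have e1 : addNew s.bits s.seen = s.seen := if_pos hb
      have e2 : addNew s.bits s.dict = s.dict := if_pos hd
      refine ⟨?_, by simp; omega, by simp [e1]; omega, by simp [e2]; omega, by simpa [e2] using h5,
        by simpa [e1, e2] using h6⟩
      intro p hp
      rcases List.mem_cons.1 hp with rfl | hp
      · exact List.idxOf_le_length.trans (by omega)
      · exact h1 p hp
    · simp only [Option.some.injEq] at h
      subst h
      have l1 := length_encWords_addNew_le (L := L) s.bits s.seen
      have l2 := length_encWords_addNew_le (L := L) s.bits s.dict
      have l3 : (addNew s.bits s.dict).length ≤ s.dict.length + 1 := by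
        unfold addNew
        split_ifs <;> simp
      have h0' := h0.resolve_left hb
      refine ⟨?_, by simp; omega, by simp; omega, by simp; omega, by simp; omega, ?_⟩
      · intro p hp
        rcases List.mem_cons.1 hp with rfl | hp
        · exact List.idxOf_le_length.trans (by omega)
        · exact h1 p hp
      · intro w hw
        have hw' : w ∈ s.seen ++ [s.bits] := by simpa [addNew, hb] using hw
        unfold addNew
        rcases List.mem_append.1 hw' with hw' | hw'
        · split_ifs
          · exact h6 hw'
          · exact List.mem_append_left _ (h6 hw')
        · rw [List.mem_singleton] at hw'
          subst hw'
          split_ifs with hd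
          · exact hd
          · simp
  · rw [confStep_other (fun b hb => hbit ⟨b, hb⟩) hv] at h
    split_ifs at h
    simp only [Option.map_eq_some_iff] at h
    obtain ⟨vs, hvs, rfl⟩ := h
    have := length_codeReduce hvs
    exact ⟨codeReduce_le hops h1 hvs, by dsimp only; omega, by dsimp only; omega,
      by dsimp only; omega, h5, h6⟩

theorem length_encVals_le {vs : List (Tag × ℕ)} (h : ∀ p ∈ vs, p.2 ≤ B) :
    (encVals vs : List (Sym L)).length ≤ vs.length * (B + 1) := by
  induction vs with
  | nil => simp [encVals]
  | cons p vs ih =>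
    obtain ⟨t, c⟩ := p
    have h1 := ih fun p hp => h p (by simp [hp])
    have h2 : c ≤ B := h (t, c) (by simp)
    rw [length_encVals_cons, List.length_cons, add_mul]
    omega

/-- The total length of the stacks is linear in the length of the word. -/
theorem Conf.Bounded.size_le {n d j : ℕ} {s : Conf} (hs : s.Bounded L m B n d j)
    {inp : List (Sym L)} (hinp : inp.length ≤ j)
    (hZ : n * (B + 1) + 3 * n + d + 2 * m + 1 ≤ Z) : (s.mem m inp).size ≤ Z := by
  obtain ⟨h1, h2, h3, h4, h5, h6⟩ := hs
  have h7 := length_encVals_le (L := L) h1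
  have h8 : s.vals.length * (B + 1) ≤ n * (B + 1) := Nat.mul_le_mul_right _ (by omega)
  simp only [Mem.size, Mem.toList, Conf.mem, List.map_cons, List.map_nil, List.sum_cons, List.sum_nil,
    List.length_map, List.length_nil, length_num, List.length_singleton]
  omega

theorem exec_mainLoop (hops : ∀ e ∈ ops a q F E, OpBound m B Z e) (hB : B ≤ Z) (hmB : m ≤ B)
    (hq : 2 ≤ q) (hqf : ∀ n, L.Functions n → n ≤ q) (hqR : ∀ n, L.Relations n → n ≤ q) {n d : ℕ}
    (hZ : n * (B + 1) + 3 * n + d + 2 * m + 1 ≤ Z) (u : List (Letter L)) :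
    ∀ {s : Conf}, s.Bounded L m B n d u.length →
      Exec (mainLoop a q F E) ((u.map (Sum.inl : Letter L → Sym L)).head?,
          (s.mem m (u.map Sum.inl).tail).toS)
        (none, (confRun a q m F E u s).elim (fun _ => []) fun s' => (s'.mem m []).toS)
        (u.length * ((20 * q + 400) * (Z * Z) + 3) + 2) := by
  induction u with
  | nil =>
    intro s hs
    exact .loop_done rfl (by simp)
  | cons ℓ u ih =>
    intro s hs
    obtain ⟨v', h⟩ := does_letterProg hops hB (by omega) hq hqf hqR ℓ (s := s) (inp := u.map .inl)
      hs.codes (hs.size_le (by simp) hZ) (some (.inl ℓ))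
    set C := (20 * q + 400) * (Z * Z)
    rcases hc : confStep a q m F E ℓ s with _ | s'
    · rw [hc] at h
      simp only [confRun, hc, Option.bind_none, Option.elim_none] at h ⊢
      refine .loop_step (t₁ := C + 2) (t₂ := 1) rfl (.seq (.switch h le_rfl) (exec_pop
        (v' := none) rfl (S' := fun _ => []) ?_ (t := 1) le_rfl _) (by omega))
        (.loop_done rfl le_rfl) (by simp only [List.length_cons, add_mul]; omega)
      exact (Function.update_eq_self_iff.2 rfl).symm
    · rw [hc] at h
      simp only [confRun, hc, Option.bind_some, Option.elim_some] at h ⊢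
      refine .loop_step (t₁ := C + 2) rfl (.seq (.switch h le_rfl) (exec_pop
        rfl rfl (t := 1) le_rfl _) (by omega)) ?_ (t₂ := u.length * (C + 3) + 2)
        (by simp only [List.length_cons, add_mul]; omega)
      have h' := ih (hs.step hops hmB hc)
      simpa [Conf.mem, mainLoop] using h'

/-- The program ends with empty stacks, and with a letter in the register iff `p` holds. -/
def Decides (P : StackProg (Sym L)) (S : ℕ → List (Sym L)) (p : Prop) (t : ℕ) : Prop :=
  ∀ v, ∃ v', Exec P (v, S) (v', fun _ => []) t ∧ (v'.isSome = true ↔ p)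

theorem decides_fail {S : ℕ → List (Sym L)} {p : Prop} {t : ℕ} (hS : ∀ i, 15 ≤ i → S i = [])
    (hp : ¬p) (ht : 2 * ∑ i ∈ Finset.range 15, (S i).length + 31 ≤ t) : Decides fail S p t :=
  fun v => ⟨none, (exec_clearBelow 15 S v hS).mono (by omega), by simp [hp]⟩

theorem decides_switch {P : StackProg (Sym L)} {Q : Option (Sym L) → StackProg (Sym L)}
    {v₁ : Option (Sym L)} {S S₁ : ℕ → List (Sym L)} {p : Prop} {t₁ t₂ t : ℕ}
    (h₁ : ∀ v, Exec P (v, S) (v₁, S₁) t₁) (h₂ : Decides (Q v₁) S₁ p t₂) (ht : t₁ + t₂ + 1 ≤ t) :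
    Decides (.seq P (.switch Q)) S p t := fun v =>
  have ⟨v', h, hv⟩ := h₂ v₁
  ⟨v', .seq (h₁ v) (.switch (t := t₂ + 1) h le_rfl) (by omega), hv⟩

theorem Mem.sum_length (μ : Mem L) : ∑ i ∈ Finset.range 15, (μ.toS i).length = μ.size := by
  simp [Finset.sum_range_succ, Mem.size, Mem.toList]
  omega

theorem decides_requireEmpty {i : ℕ} {Q : StackProg (Sym L)} {μ : Mem L} {p p' : Prop} {t n : ℕ}
    (hp : p ↔ μ.toS i = [] ∧ p') (hQ : μ.toS i = [] → Decides Q μ.toS p' t)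
    (hn : t + 2 * μ.size + 33 ≤ n) : Decides (requireEmpty i Q) μ.toS p n := by
  rcases h : μ.toS i with _ | ⟨g, l⟩
  · have hi : ∀ v, Exec (.pop i) (v, μ.toS) (none, μ.toS) 1 := exec_pop (by simp [h])
      (by rw [h, List.tail_nil, ← h, Function.update_eq_self]) le_rfl
    have hp' : p ↔ p' := by rw [hp, h]; simp
    rw [hp']
    exact decides_switch hi (hQ h) (by omega)
  · refine decides_switch (v₁ := some g) (exec_pop (by simp [h]) rfl le_rfl)
      (decides_fail (fun j hj => ?_) (by simp [hp, h]) (t := 2 * μ.size + 31) ?_) (by omega)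
    · rcases eq_or_ne j i with rfl | hji
      · rw [μ.toS_of_le hj] at h
        simp at h
      · rw [Function.update_of_ne hji, μ.toS_of_le hj]
    · rw [← μ.sum_length]
      have : ∑ j ∈ Finset.range 15, (update μ.toS i (μ.toS i).tail j).length ≤
          ∑ j ∈ Finset.range 15, (μ.toS j).length := Finset.sum_le_sum fun j _ => by
        rcases eq_or_ne j i with rfl | hji
        · simp
        · rw [Function.update_of_ne hji]
      omega

theorem decides_acceptProg {e : NExp} (he : OpBound m B Z e) (hB : B ≤ Z)
    (he1 : ∀ x, e.eval [m, x, 0] ≤ 1) {s : Conf} {c : ℕ} (hc : c ≤ B)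
    (hsz : ((s.mem m [] : Mem L)).size ≤ Z) (hZ : 1 ≤ Z) :
    Decides (acceptProg e) { (s.mem m [] : Mem L) with ok := [], bits := [], vals := [], x := num one c }.toS
      (e.Holds [m, c, 0]) (40 * Z) := by
  intro v
  simp only [Mem.size, Mem.toList, Conf.mem, List.map_cons, List.map_nil, List.sum_cons, List.sum_nil,
    List.length_map, List.length_nil, length_num, List.length_singleton] at hsz
  obtain ⟨h1, h2⟩ := he c hc 0 (Nat.zero_le _)
  set y := e.eval [m, c, 0] with hy
  let μ₄ : Mem L := { dict := encWords s.dict, x := num one y }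
  let μ₃ : Mem L := { μ₄ with seen := encWords s.seen }
  let μ₂ : Mem L := { μ₃ with slots := num one m }
  let μ₁ : Mem L := { μ₂ with budget := num one s.budget }
  have hrun : Does (run e)
      { (s.mem m [] : Mem L) with ok := [], bits := [], vals := [], x := num one c }.toS μ₁.toS
      (8 * Z + 6) :=
    does_run e (x := c) (y := 0) (t := 8 * Z + 6) rfl rfl rfl rfl (by omega)
  have hc1 : Does (clear 1) μ₁.toS μ₂.toS (2 * Z + 2) :=
    does_clear (by simp [μ₁, μ₂, μ₃, μ₄]) (by simp [μ₁]; omega)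
  have hc2 : Does (clear 2) μ₂.toS μ₃.toS (2 * Z + 2) :=
    does_clear (by simp [μ₂, μ₃, μ₄]) (by simp [μ₂]; omega)
  have hc4 : Does (clear 4) μ₃.toS μ₄.toS (2 * Z + 2) :=
    does_clear (by simp [μ₃, μ₄]) (by simp [μ₃]; omega)
  have hc5 : Does (clear 5) μ₄.toS ({ x := num one y } : Mem L).toS (2 * Z + 2) :=
    does_clear (by simp [μ₄]) (by simp [μ₄]; omega)
  refine ⟨(num (one : Sym L) y).head?, ?_, ?_⟩
  · refine hrun.exec_seq (t₂ := 20 * Z) (hc1.exec_seq (t₂ := 15 * Z) (hc2.exec_seq (t₂ := 11 * Z)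
      (hc4.exec_seq (t₂ := 7 * Z) (hc5.exec_seq (t₂ := 1) (exec_pop (by simp) ?_ le_rfl) (by omega))
      (by omega)) (by omega)) (by omega)) (by omega) v
    rw [Mem.toS_8, Mem.update_8, ← Mem.toS_empty]
    congr 1
    have h3 := he1 c
    have : y = 0 ∨ y = 1 := by omega
    rcases this with h | h <;> simp [h, num_succ]
  · rw [Holds, ← hy]
    rcases y with _ | k
    · simp
    · simp [num_succ]

theorem decides_finalProg {e : NExp} (he : OpBound m B Z e) (hB : B ≤ Z)
    (he1 : ∀ x, e.eval [m, x, 0] ≤ 1) (exact : Bool) {s : Conf}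
    (hle : ∀ p ∈ s.vals, p.2 ≤ B) (hsz : ((s.mem m [] : Mem L)).size ≤ Z) (hZ : 1 ≤ Z) :
    Decides (finalProg exact e) (s.mem m [] : Mem L).toS (s.Accepts m exact e) (300 * Z) := by
  have hsz' := hsz
  simp only [Mem.size, Mem.toList, Conf.mem, List.map_cons, List.map_nil, List.sum_cons, List.sum_nil,
    List.length_map, List.length_nil, length_num, List.length_singleton] at hsz'
  refine decides_switch (t₁ := 1) (t₂ := 280 * Z) (v₁ := some one)
    (S₁ := { (s.mem m [] : Mem L) with ok := [] }.toS) (exec_pop (by simp [Conf.mem])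
    (by simp [Conf.mem]) le_rfl) (decides_requireEmpty (t := 240 * Z)
    (p' := (exact = true → s.budget = 0) ∧
      ∃ t c, s.vals = [(t, c)] ∧ t.isFml = true ∧ e.Holds [m, c, 0]) ?_ ?_ ?_) (by omega)
  · simp [Conf.Accepts, Conf.mem]
  · intro hbits
    replace hbits : s.bits = [] := by simpa [Conf.mem] using hbits
    rcases hvs : s.vals with _ | ⟨⟨t, c⟩, vs⟩
    · refine decides_switch (t₁ := 2) (t₂ := 40 * Z) (exec_popVal_nil (by simp)
        (by simp [Conf.mem, hvs, encVals]) (by simp [Conf.mem]) le_rfl)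
        (decides_fail (fun i hi => Mem.toS_of_le _ hi) (by simp) ?_) (by omega)
      rw [Mem.sum_length]
      simp [Mem.size, Mem.toList, Conf.mem]
      omega
    have hc : c ≤ B := hle (t, c) (by simp [hvs])
    rw [hvs, length_encVals_cons] at hsz'
    have hpop := exec_popVal (i := 8) (n := 3 * Z + 2) (μ := { (s.mem m [] : Mem L) with ok := [] })
      (t := t) (c := c) (vs := vs) (by simp) (by simp [Conf.mem, hvs]) (by simp [Conf.mem]) rfl (by omega)
    simp only [Mem.update_6, Mem.update_8] at hpop
    refine decides_switch (t₂ := 220 * Z) hpop ?_ (by omega)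
    simp only [onTag, tag]
    by_cases ht : t.isFml = true
    swap
    · rw [if_neg ht]
      refine decides_fail (fun i hi => Mem.toS_of_le _ hi) (by simp [ht]) ?_
      rw [Mem.sum_length]
      simp [Mem.size, Mem.toList, Conf.mem]
      omega
    rw [if_pos ht]
    refine decides_requireEmpty (t := 100 * Z) (p' := (exact = true → s.budget = 0) ∧ e.Holds [m, c, 0])
      ?_ ?_ ?_
    · rcases vs with _ | ⟨⟨t', c'⟩, vs⟩
      · simp [encVals, ht]
      · simp [encVals]
    · intro hnil
      have hvs' : vs = [] := by
        rcases vs with _ | ⟨⟨t', c'⟩, vs⟩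
        · rfl
        · simp [encVals] at hnil
      subst hvs'
      have hacc := decides_acceptProg he hB he1 hc hsz hZ
      have hmem : ({ (s.mem m [] : Mem L) with ok := [], vals := encVals [], x := num one c } : Mem L) =
          { (s.mem m [] : Mem L) with ok := [], bits := [], vals := [], x := num one c } := by
        simp [Conf.mem, hbits, encVals]
      rw [hmem]
      cases exact
      · have : ((false = true → s.budget = 0) ∧ e.Holds [m, c, 0]) ↔ e.Holds [m, c, 0] := by simp
        rw [this]
        intro v
        obtain ⟨v', h1, h2⟩ := hacc v
        exact ⟨v', h1.mono (by omega), h2⟩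
      · refine decides_requireEmpty (t := 40 * Z) (p' := e.Holds [m, c, 0]) ?_ (fun _ => hacc) ?_
        · simp [Conf.mem, num]
        · simp [Mem.size, Mem.toList, Conf.mem]
          omega
    · simp [Mem.size, Mem.toList, Conf.mem]
      omega
  · simp [Mem.size, Mem.toList, Conf.mem]
    omega

/-- The program that decides whether a word is accepted. -/
def mainProg (a q : ℕ) (F : L.Symbols → ℕ → ℕ) (E : ℕ → ℕ) (d : List (List Bool)) (r k₀ : ℕ)
    (exact : Bool) (e : NExp) : StackProg (Sym L) :=
  .seq (startProg d r k₀) (.seq (mainLoop a q F E) (finalProg exact e))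

/-- The program decides whether the run `confRun` ends in an accepted configuration. The number of
steps is linear in the length `n` of the word, up to the factor `Z * Z`, where `Z` bounds the size
of the stacks and the cost of the operations. -/
theorem exec_mainProg (hops : ∀ e ∈ ops a q F E, OpBound m B Z e) (hB : B ≤ Z) (hmB : m ≤ B)
    (hq : 2 ≤ q) (hqf : ∀ n, L.Functions n → n ≤ q) (hqR : ∀ n, L.Relations n → n ≤ q) {n : ℕ}
    {e : NExp} (he : OpBound m B Z e) (he1 : ∀ x, e.eval [m, x, 0] ≤ 1) (exact : Bool)
    (d : List (List Bool)) (r k₀ k : ℕ) (hd : d.length ≤ r) (hm : m = r + k₀ + k)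
    (hZ : n * (B + 1) + 3 * n + (encWords d : List (Sym L)).length + 2 * m + 1 ≤ Z)
    (u : List (Letter L)) (hn : u.length = n) :
    ∃ v', Exec (mainProg a q F E d r k₀ exact e)
        (none, update (fun _ => []) 0 (num one k ++ u.map Sum.inl)) (v', fun _ => [])
        ((n + 1) * ((20 * q + 800) * (Z * Z))) ∧
      (v'.isSome = true ↔ ∃ s, confRun a q m F E u ⟨k₀ + k, [], [], d, []⟩ = some s ∧
        s.Accepts m exact e) := by
  have hZZ : Z ≤ Z * Z := Nat.le_mul_of_pos_left Z (by omega)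
  have hb : (⟨k₀ + k, [], [], d, []⟩ : Conf).Bounded L m B n (encWords d : List (Sym L)).length
      u.length := ⟨by simp, by simp [hn], by simp [encWords, hn], by simp [hn]; omega, by dsimp only; omega, by simp⟩
  have h1 := exec_startProg (L := L) d r k₀ k u
  rw [← hm] at h1
  have h2 := exec_mainLoop hops hB hmB hq hqf hqR hZ u hb
  have hbound : ∀ {u : List (Letter L)} {s s' : Conf},
      s.Bounded L m B n (encWords d : List (Sym L)).length u.length →
      confRun a q m F E u s = some s' →
      s'.Bounded L m B n (encWords d : List (Sym L)).length 0 := by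
    intro u
    induction u with
    | nil =>
      intro s s' hs h
      simp only [confRun, Option.some.injEq] at h
      exact h ▸ hs
    | cons ℓ u ih =>
      intro s s' hs h
      simp only [confRun, Option.bind_eq_some_iff] at h
      obtain ⟨s₁, h₁, h₂⟩ := h
      exact ih (hs.step hops hmB h₁) h₂
  have h3 : Decides (finalProg exact e) ((confRun a q m F E u ⟨k₀ + k, [], [], d, []⟩).elim
      (fun _ => []) fun s' => (s'.mem m [] : Mem L).toS)
      (∃ s, confRun a q m F E u ⟨k₀ + k, [], [], d, []⟩ = some s ∧ s.Accepts m exact e) (300 * Z) := by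
    rcases hr : confRun a q m F E u ⟨k₀ + k, [], [], d, []⟩ with _ | s
    · intro v
      refine ⟨none, .seq (t₁ := 1) (t₂ := 2) (exec_pop (v' := none) rfl (S' := fun _ => []) ?_ le_rfl _)
        (.switch (t₁ := 1) (.load le_rfl) le_rfl) (by omega), by simp⟩
      exact (Function.update_eq_self_iff.2 rfl).symm
    · have hs := hbound hb hr
      have := decides_finalProg he hB he1 exact hs.codes (hs.size_le (inp := []) (by simp) hZ) (by omega)
      simpa using this
  obtain ⟨v', h3, hv'⟩ := h3 none
  refine ⟨v', .seq h1 (.seq h2 h3 le_rfl) ?_, hv'⟩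
  have e1 : (n + 1) * ((20 * q + 800) * (Z * Z)) = n * ((20 * q + 400) * (Z * Z)) + n * (400 * (Z * Z)) +
    ((20 * q + 400) * (Z * Z) + 400 * (Z * Z)) := by ring
  have e2 : u.length * ((20 * q + 400) * (Z * Z) + 3) = n * ((20 * q + 400) * (Z * Z)) + 3 * n := by
    rw [hn]
    ring
  rw [e1, e2]
  have e3 : 400 * (Z * Z) ≤ (20 * q + 400) * (Z * Z) := Nat.mul_le_mul_right _ (by omega)
  have e4 : (encWords d : List (Sym L)).length + r + 2 * k₀ + 4 * k + 10 ≤ 20 * Z := by omega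
  omega

end Run

/-! ### The machine computes the codes of the parsed objects -/

section Simulation

variable {A : Type*} [L.Structure A] [Nonempty A] {a : ℕ} (e : A ≃ Fin a) (q m : ℕ) (σ : ℕ → ℕ)

/-- The table of a symbol. -/
noncomputable def symTable : L.Symbols → ℕ → ℕ
  | .inl ⟨_, f⟩ => funTable e f
  | .inr ⟨_, R⟩ => relTable e R

/-- The value `p` stands for the object `o`. For a variable its slot must be in use, and must not be
shared with another variable. -/
def RepObj : Obj L → Tag × ℕ → Prop
  | .var x, p => p = (.var, σ x) ∧ σ x < m ∧ ∀ v, σ v = σ x → v = x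
  | .term t, p => p.1 = .term ∧ RepTerm e q m σ t p.2
  | .fml φ, p => p.1 = .fml ∧ RepFml e m σ φ p.2
  | .atom R t, p => p.1 = .atom ∧ RepFml e m σ (.rel R t) p.2
  | .close, p => p.1 = .close
  | .semi u, p => p.1 = .semi ∧ RepDis e m σ u p.2

variable {e q m σ}

theorem RepObj.term {o : Obj L} {p : Tag × ℕ} (h : RepObj e q m σ o p) :
    (∃ t, o.term? = some t ∧ ((p.1 = .term ∧ RepTerm e q m σ t p.2) ∨
      ∃ x, t = .var x ∧ p = (.var, σ x))) ∨ (o.term? = none ∧ p.1 ≠ .term ∧ p.1 ≠ .var) := by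
  cases o with
  | var x => exact .inl ⟨_, rfl, .inr ⟨x, rfl, h.1⟩⟩
  | term t => exact .inl ⟨t, rfl, .inl h⟩
  | fml φ => exact .inr ⟨rfl, by rw [h.1]; simp, by rw [h.1]; simp⟩
  | atom R t => exact .inr ⟨rfl, by rw [h.1]; simp, by rw [h.1]; simp⟩
  | close => exact .inr ⟨rfl, by rw [show p.1 = _ from h]; simp, by rw [show p.1 = _ from h]; simp⟩
  | semi u => exact .inr ⟨rfl, by rw [h.1]; simp, by rw [h.1]; simp⟩

theorem RepObj.formula {o : Obj L} {p : Tag × ℕ} (h : RepObj e q m σ o p) :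
    (∃ φ, o.fml? = some φ ∧ p.1.isFml = true ∧ RepFml e m σ φ p.2) ∨
      (o.fml? = none ∧ p.1.isFml = false) := by
  cases o with
  | var x => exact .inr ⟨rfl, by rw [h.1]; rfl⟩
  | term t => exact .inr ⟨rfl, by rw [h.1]; rfl⟩
  | fml φ => exact .inl ⟨φ, rfl, by rw [h.1]; rfl, h.2⟩
  | atom R t => exact .inl ⟨_, rfl, by rw [h.1]; rfl, h.2⟩
  | close => exact .inr ⟨rfl, by rw [show p.1 = _ from h]; rfl⟩
  | semi u => exact .inr ⟨rfl, by rw [h.1]; rfl⟩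

theorem rel_takeTerms : ∀ {n : ℕ} {os : List (Obj L)} {vs : List (Tag × ℕ)} {ts : List (L.Term ℕ)}
    {acc : ℕ}, List.Forall₂ (RepObj e q m σ) os vs → RepTuple e q m σ ts acc → ts.length + n ≤ q →
    Option.Rel (fun p p' => RepTuple e q m σ (ts ++ List.ofFn p.1) p'.1 ∧
      List.Forall₂ (RepObj e q m σ) p.2 p'.2) (Obj.takeTerms n os) (collect a q m n acc vs)
  | 0, os, vs, ts, acc, h, hts, hl => by
    rw [Obj.takeTerms, collect]
    exact .some ⟨by simpa using hts, h⟩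
  | n + 1, _, _, ts, acc, .nil, hts, hl => .none
  | n + 1, o :: os, p :: vs, ts, acc, .cons ho h, hts, hl => by
    obtain ⟨t, c⟩ := p
    rw [Obj.takeTerms, collect]
    rcases ho.term with ⟨u, hu, hp⟩ | ⟨hu, hp⟩
    · have key : ∃ e', tupOp a q t = some e' ∧ RepTuple e q m σ (ts ++ [u]) (e'.eval [m, acc, c]) := by
        rcases hp with ⟨ht, hr⟩ | ⟨x, rfl, hx⟩
        · dsimp only at ht hr
          subst ht
          exact ⟨_, rfl, hts.append hr (by omega)⟩
        · simp only [Prod.mk.injEq] at hx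
          obtain ⟨rfl, rfl⟩ := hx
          exact ⟨_, rfl, hts.appendVar (by omega)⟩
      obtain ⟨e', he', hr⟩ := key
      have ih := rel_takeTerms h hr (n := n) (by simp; omega)
      rw [hu, he', Option.bind_some]
      dsimp only
      revert ih
      cases Obj.takeTerms n os <;> cases collect a q m n (e'.eval [m, acc, c]) vs
      · exact fun _ => .none
      · rintro ⟨⟩
      · rintro ⟨⟩
      · rintro (⟨ih⟩ | _)
        refine .some ⟨?_, ih.2⟩
        simpa [List.ofFn_succ] using ih.1
    · have : tupOp a q t = none := by
        cases t <;> simp_all [tupOp]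
      rw [hu, this]
      exact .none

theorem rep_takeAll : ∀ {os : List (Obj L)} {vs : List (Tag × ℕ)} {ts : List (L.Term ℕ)} {acc : ℕ},
    List.Forall₂ (RepObj e q m σ) os vs → RepDis e m σ ts acc →
    RepDis e m σ (ts ++ (Obj.takeAll os).1) (gather a q m acc vs).1 ∧
      List.Forall₂ (RepObj e q m σ) (Obj.takeAll os).2 (gather a q m acc vs).2
  | _, _, ts, acc, .nil, hts => by simpa [Obj.takeAll, gather] using hts
  | o :: os, p :: vs, ts, acc, .cons ho h, hts => by
    obtain ⟨t, c⟩ := p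
    rw [Obj.takeAll, gather]
    rcases ho.term with ⟨u, hu, hp⟩ | ⟨hu, hp⟩
    · have key : ∃ e', disOp a q t = some e' ∧ RepDis e m σ (ts ++ [u]) (e'.eval [m, acc, c]) := by
        rcases hp with ⟨ht, hr⟩ | ⟨x, rfl, hx⟩
        · dsimp only at ht hr
          subst ht
          exact ⟨_, rfl, hts.append hr⟩
        · simp only [Prod.mk.injEq] at hx
          obtain ⟨rfl, rfl⟩ := hx
          exact ⟨_, rfl, hts.appendVar⟩
      obtain ⟨e', he', hr⟩ := key
      have ih := rep_takeAll h hr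
      rw [hu, he']
      simpa using ih
    · have : disOp a q t = none := by
        cases t <;> simp_all [disOp]
      rw [hu, this]
      exact ⟨by simpa using hts, .cons ho h⟩

theorem rel_codeBinary {os : List (Obj L)} {vs : List (Tag × ℕ)}
    (h : List.Forall₂ (RepObj e q m σ) os vs) {op : NExp} {f : DFormula L → DFormula L → DFormula L}
    (hop : ∀ φ ψ x y, RepFml e m σ φ x → RepFml e m σ ψ y → RepFml e m σ (f φ ψ) (op.eval [m, x, y])) :
    Option.Rel (List.Forall₂ (RepObj e q m σ))
      (match os with
        | o :: o' :: os => o.fml?.bind fun φ => o'.fml?.map fun ψ => .fml (f φ ψ) :: os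
        | _ => none) (codeBinary m Tag.isFml Tag.isFml op vs) := by
  rcases h with _ | ⟨h1, _ | ⟨h2, h⟩⟩
  · exact .none
  · exact .none
  rename_i o p o' p' os vs
  obtain ⟨t, c⟩ := p
  obtain ⟨t', c'⟩ := p'
  rw [codeBinary]
  dsimp only
  rcases h1.formula with ⟨φ, hφ, ht, hr⟩ | ⟨hφ, ht⟩
  · rcases h2.formula with ⟨ψ, hψ, ht', hr'⟩ | ⟨hψ, ht'⟩
    · rw [if_pos ⟨ht, ht'⟩, hφ, hψ]
      exact .some (.cons ⟨rfl, hop _ _ _ _ hr hr'⟩ h)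
    · rw [if_neg (by simp_all), hφ, hψ]
      exact .none
  · rw [if_neg (by simp_all), hφ]
    exact .none

theorem rel_codeQuantifier {os : List (Obj L)} {vs : List (Tag × ℕ)}
    (h : List.Forall₂ (RepObj e q m σ) os vs) {op : NExp} {f : ℕ → DFormula L → DFormula L}
    (hop : ∀ x φ c, σ x < m → (∀ v, σ v = σ x → v = x) → RepFml e m σ φ c →
      RepFml e m σ (f x φ) (op.eval [m, σ x, c])) :
    Option.Rel (List.Forall₂ (RepObj e q m σ))
      (match os with
        | .var x :: o :: os => o.fml?.map fun φ => .fml (f x φ) :: os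
        | _ => none) (codeBinary m (· = .var) Tag.isFml op vs) := by
  rcases h with _ | ⟨h1, _ | ⟨h2, h⟩⟩
  · exact .none
  · rename_i o p
    cases o <;> exact .none
  rename_i o p o' p' os vs
  obtain ⟨t, c⟩ := p
  obtain ⟨t', c'⟩ := p'
  rw [codeBinary]
  cases o with
  | var x =>
    obtain ⟨h0, h1, h3⟩ := h1
    simp only [Prod.mk.injEq] at h0
    obtain ⟨rfl, rfl⟩ := h0
    dsimp only
    rcases h2.formula with ⟨ψ, hψ, ht', hr'⟩ | ⟨hψ, ht'⟩
    · rw [if_pos ⟨by simp, ht'⟩, hψ]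
      exact .some (.cons ⟨rfl, hop _ _ _ h1 h3 hr'⟩ h)
    · rw [if_neg (by simp_all), hψ]
      exact .none
  | term t => rw [if_neg (by have := h1.1; simp_all)]; exact .none
  | fml φ => rw [if_neg (by have := h1.1; simp_all)]; exact .none
  | atom R t => rw [if_neg (by have := h1.1; simp_all)]; exact .none
  | close => rw [if_neg (by have : t = .close := h1; simp_all)]; exact .none
  | semi u => rw [if_neg (by have := h1.1; simp_all)]; exact .none

theorem rel_collect {n : ℕ} (hn : n ≤ q) {os : List (Obj L)} {vs : List (Tag × ℕ)}
    (h : List.Forall₂ (RepObj e q m σ) os vs) {f : (Fin n → L.Term ℕ) → Obj L} {g : ℕ → Tag × ℕ}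
    (hfg : ∀ ts c, RepTuple e q m σ (List.ofFn ts) c → RepObj e q m σ (f ts) (g c)) :
    Option.Rel (List.Forall₂ (RepObj e q m σ)) ((Obj.takeTerms n os).map fun p => f p.1 :: p.2)
      ((collect a q m n 0 vs).map fun p => g p.1 :: p.2) := by
  have := rel_takeTerms h repTuple_nil (n := n) (by simpa using hn)
  revert this
  cases Obj.takeTerms n os <;> cases collect a q m n 0 vs
  · exact fun _ => .none
  · rintro ⟨⟩
  · rintro ⟨⟩
  · rintro (⟨ih⟩ | _)
    exact .some (.cons (hfg _ _ (by simpa using ih.1)) ih.2)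

/-- Computing with codes follows the parser: both fail together, and otherwise the new codes
represent the new objects. -/
theorem rel_reduce (hq : 2 ≤ q) (hqf : ∀ n, L.Functions n → n ≤ q) (hqR : ∀ n, L.Relations n → n ≤ q)
    (ℓ : Letter L) {os : List (Obj L)} {vs : List (Tag × ℕ)}
    (h : List.Forall₂ (RepObj e q m σ) os vs) :
    Option.Rel (List.Forall₂ (RepObj e q m σ)) (Obj.reduce ℓ os)
      (codeReduce a q m (symTable e) (eqTable e) ℓ vs) := by
  obtain ⟨hg1, hg2⟩ := rep_takeAll h repDis_nil
  rw [List.nil_append] at hg1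
  cases ℓ with
  | sym s =>
    rcases s with ⟨n, f⟩ | ⟨n, R⟩
    · rw [Obj.reduce, codeReduce]
      refine rel_collect (hqf n f) h (f := fun ts => .term (.func f ts))
        (g := fun c => (.term, (opFun a q (symTable e (.inl ⟨n, f⟩))).eval [m, c, 0]))
        fun ts c hts => ?_
      exact ⟨rfl, hts.func (hqf n f) (by omega)⟩
    · rw [Obj.reduce, codeReduce]
      refine rel_collect (hqR n R) h (f := fun ts => .atom R ts)
        (g := fun c => (.atom, (opRel a q (symTable e (.inr ⟨n, R⟩))).eval [m, c, 0]))
        fun ts c hts => ?_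
      exact ⟨rfl, hts.rel (hqR n R)⟩
  | var => simp only [Obj.reduce, codeReduce]; exact .none
  | bit b => simp only [Obj.reduce, codeReduce]; exact .none
  | eq =>
    rw [Obj.reduce, codeReduce]
    refine rel_collect hq h (f := fun ts => .fml (.eq (ts 0) (ts 1)))
      (g := fun c => (.fml, (opRel a q (eqTable e)).eval [m, c, 0])) fun ts c hts => ?_
    exact ⟨rfl, RepTuple.eq (by simpa [List.ofFn_succ] using hts) hq⟩
  | neg =>
    rcases h with _ | ⟨h1, h⟩
    · simp only [Obj.reduce, codeReduce]; exact .none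
    rename_i o p os vs
    obtain ⟨t, c⟩ := p
    cases o with
    | atom R ts =>
      obtain ⟨rfl, hr⟩ := h1
      rw [Obj.reduce, codeReduce]
      exact .some (.cons ⟨rfl, hr.neg⟩ h)
    | var x =>
      obtain ⟨rfl, -⟩ := h1.1
      simp only [Obj.reduce, codeReduce]; exact .none
    | term t => obtain ⟨rfl, -⟩ := h1; simp only [Obj.reduce, codeReduce]; exact .none
    | fml φ => obtain ⟨rfl, -⟩ := h1; simp only [Obj.reduce, codeReduce]; exact .none
    | close => obtain rfl : t = .close := h1; simp only [Obj.reduce, codeReduce]; exact .none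
    | semi u => obtain ⟨rfl, -⟩ := h1; simp only [Obj.reduce, codeReduce]; exact .none
  | close => rw [Obj.reduce, codeReduce]; exact .some (.cons rfl h)
  | semicolon =>
    rw [Obj.reduce, codeReduce]
    revert hg1 hg2
    rcases Obj.takeAll os with ⟨ts, r⟩
    rcases gather a q m 0 vs with ⟨u, r'⟩
    intro hg1 hg2
    rcases hg2 with _ | ⟨h1, h⟩
    · exact .none
    rename_i o p os vs
    obtain ⟨t, c⟩ := p
    cases o with
    | close =>
      obtain rfl : t = .close := h1
      exact .some (.cons ⟨rfl, hg1⟩ h)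
    | atom R ts => obtain ⟨rfl, -⟩ := h1; exact .none
    | var x => obtain ⟨rfl, -⟩ := h1.1; exact .none
    | term t => obtain ⟨rfl, -⟩ := h1; exact .none
    | fml φ => obtain ⟨rfl, -⟩ := h1; exact .none
    | semi u => obtain ⟨rfl, -⟩ := h1; exact .none
  | dep =>
    rw [Obj.reduce, codeReduce]
    revert hg1 hg2
    rcases Obj.takeAll os with ⟨ts, r⟩
    rcases gather a q m 0 vs with ⟨u, r'⟩
    intro hg1 hg2
    rcases hg2 with _ | ⟨h1, h⟩
    · exact .none
    rename_i o p os vs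
    obtain ⟨t, c⟩ := p
    cases o with
    | semi u =>
      obtain ⟨rfl, hr⟩ := h1
      exact .some (.cons ⟨rfl, hg1.dep hr⟩ h)
    | atom R ts => obtain ⟨rfl, -⟩ := h1; exact .none
    | var x => obtain ⟨rfl, -⟩ := h1.1; exact .none
    | term t => obtain ⟨rfl, -⟩ := h1; exact .none
    | fml φ => obtain ⟨rfl, -⟩ := h1; exact .none
    | close => obtain rfl : t = .close := h1; exact .none
  | and =>
    have := rel_codeBinary h (f := .and) (op := opAnd a) fun φ ψ x y hx hy => hx.and hy
    rw [codeReduce]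
    revert this
    generalize codeBinary m Tag.isFml Tag.isFml (opAnd a) vs = r
    rcases os with _ | ⟨o, _ | ⟨o', os⟩⟩ <;> exact id
  | or =>
    have := rel_codeBinary h (f := .or) (op := opOr a) fun φ ψ x y hx hy => hx.or hy
    rw [codeReduce]
    revert this
    generalize codeBinary m Tag.isFml Tag.isFml (opOr a) vs = r
    rcases os with _ | ⟨o, _ | ⟨o', os⟩⟩ <;> exact id
  | ex =>
    have := rel_codeQuantifier h (f := .ex) (op := opEx a) fun x φ c hx hinj hc => hc.ex hx hinj
    rw [codeReduce]
    revert this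
    generalize codeBinary m _ Tag.isFml (opEx a) vs = r
    rcases os with _ | ⟨_ | _, _ | ⟨o', os⟩⟩ <;> exact id
  | all =>
    have := rel_codeQuantifier h (f := .all) (op := opAll a) fun x φ c hx hinj hc => hc.all hx hinj
    rw [codeReduce]
    revert this
    generalize codeBinary m _ Tag.isFml (opAll a) vs = r
    rcases os with _ | ⟨_ | _, _ | ⟨o', os⟩⟩ <;> exact id

end Simulation

open Computability

theorem encodeNat_injective : Function.Injective encodeNat :=
  Function.LeftInverse.injective decode_encodeNat

theorem idxOf_map {α β : Type*} [BEq α] [LawfulBEq α] [BEq β] [LawfulBEq β] {f : α → β}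
    (hf : Function.Injective f) (x : α) (l : List α) : (l.map f).idxOf (f x) = l.idxOf x := by
  induction l with
  | nil => rfl
  | cons y l ih =>
    by_cases h : y = x
    · simp [h]
    · rw [List.map_cons, List.idxOf_cons_ne _ (hf.ne h), List.idxOf_cons_ne _ h, ih]

theorem addNew_map {α β : Type*} [DecidableEq α] [DecidableEq β] {f : α → β}
    (hf : Function.Injective f) (x : α) (l : List α) : addNew (f x) (l.map f) = (addNew x l).map f := by
  unfold addNew
  simp only [List.mem_map_of_injective hf]
  split_ifs <;> simp

section Parse

theorem mem_addNew {α : Type*} [DecidableEq α] {x y : α} {l : List α} :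
    y ∈ addNew x l ↔ y = x ∨ y ∈ l := by
  unfold addNew
  split_ifs with h
  · constructor
    · exact .inr
    · rintro (rfl | h')
      exacts [h, h']
  · simp [or_comm]

theorem idxOf_eq_of_prefix {α : Type*} [BEq α] [LawfulBEq α] {x : α} {l l' : List α} (h : l <+: l')
    (hx : x ∈ l) : l'.idxOf x = l.idxOf x := by
  obtain ⟨r, rfl⟩ := h
  exact List.idxOf_append_of_mem hx

/-- The position of a variable in a list without it is the position where it would be added. -/
theorem idxOf_addNew {α : Type*} [DecidableEq α] [BEq α] [LawfulBEq α] (x : α) (l : List α) :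
    (addNew x l).idxOf x = l.idxOf x := by
  unfold addNew
  split_ifs with h
  · rfl
  · rw [List.idxOf_append_of_notMem h, List.idxOf_eq_length h]
    simp

theorem prefix_of_pstep {k : ℕ} {ℓ : Letter L} {s s' : PState L} (h : pstep k ℓ s = some s') :
    s.dict <+: s'.dict := by
  by_cases hbit : ∃ b, ℓ = .bit b
  · obtain ⟨b, rfl⟩ := hbit
    simp only [pstep] at h
    split_ifs at h
    simp only [Option.some.injEq] at h
    subst h
    exact List.prefix_rfl
  · by_cases hv : ℓ = .var
    · subst hv
      simp only [pstep] at h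
      split_ifs at h
      simp only [Option.some.injEq] at h
      subst h
      exact prefix_addNew _ _
    · rw [pstep_other (fun b hb => hbit ⟨b, hb⟩) hv] at h
      split_ifs at h
      simp only [Option.map_eq_some_iff] at h
      obtain ⟨os, -, rfl⟩ := h
      exact List.prefix_rfl

/-- The invariants of the lists of variables that the parser keeps. -/
structure PState.Wf (k : ℕ) (d : List ℕ) (s : PState L) : Prop where
  length_seen : s.seen.length ≤ k
  length_dict : s.dict.length ≤ d.length + s.seen.length
  mem_dict : ∀ x, x ∈ s.dict ↔ x ∈ d ∨ x ∈ s.seen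
  prefix_dict : d <+: s.dict

theorem wf_of_pstep {k : ℕ} {d : List ℕ} {ℓ : Letter L} {s s' : PState L} (hs : s.Wf k d)
    (h : pstep k ℓ s = some s') : s'.Wf k d := by
  have hp := prefix_of_pstep h
  by_cases hbit : ∃ b, ℓ = .bit b
  · obtain ⟨b, rfl⟩ := hbit
    simp only [pstep] at h
    split_ifs at h
    simp only [Option.some.injEq] at h
    subst h
    exact ⟨hs.1, hs.2, hs.3, hs.4⟩
  · by_cases hv : ℓ = .var
    · subst hv
      simp only [pstep] at h
      split_ifs at h with hn
      simp only [Option.some.injEq] at h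
      subst h
      obtain ⟨h1, h2, h3, h4⟩ := hs
      refine ⟨?_, ?_, fun x => ?_, h4.trans hp⟩
      · dsimp only
        unfold addNew
        split_ifs with hx
        · exact h1
        · simpa using hn.resolve_left hx
      · dsimp only
        unfold addNew
        split_ifs with hx hy hy
        · exact h2
        · simp; omega
        · exact absurd ((h3 _).2 (.inr hy)) hx
        · simp; omega
      · dsimp only
        rw [mem_addNew, mem_addNew, h3]
        tauto
    · rw [pstep_other (fun b hb => hbit ⟨b, hb⟩) hv] at h
      split_ifs at h
      simp only [Option.map_eq_some_iff] at h
      obtain ⟨os, -, rfl⟩ := h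
      exact ⟨hs.1, hs.2, hs.3, hs.4⟩

theorem wf_of_parse {k : ℕ} {d : List ℕ} {w : List (Letter L)} {s : PState L}
    (h : parse k d w = some s) : s.Wf k d := by
  induction w generalizing s with
  | nil =>
    simp only [parse, Option.some.injEq] at h
    subst h
    exact ⟨by simp, by simp, by simp, List.prefix_rfl⟩
  | cons ℓ w ih =>
    simp only [parse, Option.bind_eq_some_iff] at h
    obtain ⟨s₀, h₀, h⟩ := h
    exact wf_of_pstep (ih h₀) h

end Parse

section Simulation

variable {A : Type*} [L.Structure A] [Nonempty A] {a : ℕ} (e : A ≃ Fin a) (q m k : ℕ)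

/-- The configuration `c` of the machine represents the state `s` of the parser, where the variables
have the slots given by their positions in `D`. Since `D` may extend the current list of variables,
the same slots can be used throughout a run. -/
structure Sim (D : List ℕ) (s : PState L) (c : Conf) : Prop where
  bits : c.bits = s.bits
  seen : c.seen = s.seen.map encodeNat
  dict : c.dict = s.dict.map encodeNat
  budget : c.budget + s.seen.length = k
  vals : List.Forall₂ (RepObj e q m (D.idxOf ·)) s.objs c.vals

variable {e q m k}

theorem Sim.step (hq : 2 ≤ q) (hqf : ∀ n, L.Functions n → n ≤ q) (hqR : ∀ n, L.Relations n → n ≤ q)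
    {D : List ℕ} (hm : D.length ≤ m) {ℓ : Letter L} {s : PState L} {c : Conf} (h : Sim e q m k D s c)
    (hb : s.bits = [] ∨ s.bits.getLast? = some true)
    (hD : ∀ s', pstep k ℓ s = some s' → s'.dict <+: D) :
    Option.Rel (Sim e q m k D) (pstep k ℓ s) (confStep a q m (symTable e) (eqTable e) ℓ c) := by
  obtain ⟨h1, h2, h3, h4, h5⟩ := h
  by_cases hbit : ∃ b, ℓ = .bit b
  · obtain ⟨b, rfl⟩ := hbit
    simp only [pstep, confStep, h1]
    split_ifs with hn
    · exact .none
    · exact .some ⟨rfl, h2, h3, h4, h5⟩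
  · by_cases hv : ℓ = .var
    · subst hv
      have hx : c.bits = encodeNat (decodeNat s.bits) := by rw [encodeNat_decodeNat hb, h1]
      have hcond : (c.bits ∈ c.seen ∨ 0 < c.budget) ↔
          (decodeNat s.bits ∈ s.seen ∨ s.seen.length < k) := by
        rw [hx, h2, List.mem_map_of_injective encodeNat_injective]
        refine or_congr_right ?_
        omega
      simp only [pstep, confStep, hcond] at hD ⊢
      by_cases hn : decodeNat s.bits ∈ s.seen ∨ s.seen.length < k
      · rw [if_pos hn] at hD
        rw [if_pos hn, if_pos hn]
        have hD := hD _ rfl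
        dsimp only at hD
        set x := decodeNat s.bits with hxd
        have hxD : x ∈ D := hD.subset (mem_addNew.2 (.inl rfl))
        refine .some ⟨rfl, ?_, ?_, ?_, ?_⟩
        · dsimp only
          rw [hx, h2, addNew_map encodeNat_injective]
        · dsimp only
          rw [hx, h3, addNew_map encodeNat_injective]
        · dsimp only
          have hiff : c.bits ∈ c.seen ↔ x ∈ s.seen := by
            rw [hx, h2, List.mem_map_of_injective encodeNat_injective]
          unfold addNew
          simp only [hiff]
          split_ifs with hmem
          · exact h4
          · have := hn.resolve_left hmem
            simp only [List.length_append, List.length_singleton]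
            omega
        · refine .cons ⟨?_, ?_, fun v hv => ?_⟩ h5
          · dsimp only
            rw [hx, h3, idxOf_map encodeNat_injective, ← idxOf_addNew x s.dict,
              idxOf_eq_of_prefix hD (mem_addNew.2 (.inl rfl))]
          · exact (List.idxOf_lt_length_iff.2 hxD).trans_le hm
          · dsimp only at hv
            have : v ∈ D := List.idxOf_lt_length_iff.1 (by
              rw [hv]
              exact List.idxOf_lt_length_iff.2 hxD)
            exact (List.idxOf_inj this).1 hv
      · rw [if_neg hn, if_neg hn]
        exact .none
    · rw [pstep_other (fun b hb => hbit ⟨b, hb⟩) hv, confStep_other (fun b hb => hbit ⟨b, hb⟩) hv, h1]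
      split_ifs with hn
      · have := rel_reduce hq hqf hqR ℓ h5
        revert this
        cases Obj.reduce ℓ s.objs <;> cases codeReduce a q m (symTable e) (eqTable e) ℓ c.vals
        · exact fun _ => .none
        · rintro ⟨⟩
        · rintro ⟨⟩
        · rintro (⟨ih⟩ | _)
          exact .some ⟨rfl, h2, h3, h4, ih⟩
      · exact .none

/-- If the parser succeeds, then the run of the machine represents its final state. -/
theorem confRun_of_parse (hq : 2 ≤ q) (hqf : ∀ n, L.Functions n → n ≤ q)
    (hqR : ∀ n, L.Relations n → n ≤ q) {d D : List ℕ} (hm : D.length ≤ m) {w : List (Letter L)}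
    {s : PState L} (hs : parse k d w = some s) (hD : s.dict <+: D) :
    ∃ c, confRun a q m (symTable e) (eqTable e) w.reverse ⟨k, [], [], d.map encodeNat, []⟩ = some c ∧
      Sim e q m k D s c := by
  induction w generalizing s with
  | nil =>
    simp only [parse, Option.some.injEq] at hs
    subst hs
    exact ⟨_, rfl, rfl, rfl, rfl, rfl, .nil⟩
  | cons ℓ w ih =>
    simp only [parse, Option.bind_eq_some_iff] at hs
    obtain ⟨s₀, h₀, hs⟩ := hs
    obtain ⟨c₀, hc₀, hsim⟩ := ih h₀ ((prefix_of_pstep hs).trans hD)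
    have := hsim.step hq hqf hqR hm (parse_sound h₀).2 (ℓ := ℓ) (by
      intro s' hs'
      rw [hs, Option.some.injEq] at hs'
      exact hs' ▸ hD)
    rw [hs] at this
    rw [List.reverse_cons, confRun_append, hc₀, Option.bind_some, confRun]
    generalize confStep a q m (symTable e) (eqTable e) ℓ c₀ = r at this ⊢
    rcases this with ⟨this⟩ | _
    exact ⟨_, rfl, this⟩

/-- If the parser fails, then so does the machine: up to the failure it represents the parser,
with the slots given by the list of variables of the last state. -/
theorem confRun_of_parse_eq_none (hq : 2 ≤ q) (hqf : ∀ n, L.Functions n → n ≤ q)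
    (hqR : ∀ n, L.Relations n → n ≤ q) {d : List ℕ} (hm : d.length + k ≤ m) {w : List (Letter L)}
    (hs : parse k d w = none) :
    confRun a q m (symTable e) (eqTable e) w.reverse ⟨k, [], [], d.map encodeNat, []⟩ = none := by
  induction w with
  | nil => simp [parse] at hs
  | cons ℓ w ih =>
    rw [List.reverse_cons, confRun_append]
    cases h₀ : parse k d w with
    | none => rw [ih h₀, Option.bind_none]
    | some s₀ =>
      rw [parse, h₀, Option.bind_some] at hs
      have hwf := wf_of_parse h₀
      have hD : s₀.dict.length ≤ m := by
        have := hwf.1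
        have := hwf.2
        omega
      obtain ⟨c₀, hc₀, hsim⟩ := confRun_of_parse (e := e) hq hqf hqR hD h₀ List.prefix_rfl
      have := hsim.step hq hqf hqR hD (parse_sound h₀).2 (ℓ := ℓ) (by simp [hs])
      rw [hs] at this
      rw [hc₀, Option.bind_some, confRun]
      generalize confStep a q m (symTable e) (eqTable e) ℓ c₀ = r at this ⊢
      rcases this with _ | _
      rfl

end Simulation

/-! ### The machine accepts the formulas that hold -/

theorem free_subset_vars : ∀ φ : DFormula L, φ.free ⊆ φ.vars
  | .eq _ _ | .rel _ _ | .nrel _ _ | .dep _ _ => subset_rfl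
  | .and φ ψ | .or φ ψ => Finset.union_subset_union (free_subset_vars φ) (free_subset_vars ψ)
  | .ex x φ | .all x φ => (Finset.erase_subset x φ.free).trans
      ((free_subset_vars φ).trans (Finset.subset_insert x φ.vars))

section Acceptance

variable {A : Type*} [Nonempty A] {a : ℕ}

theorem team_eq_of_le (e : A ≃ Fin a) {r m c : ℕ} (hrm : r ≤ m) (hc : c < 2 ^ a ^ r) :
    team e m c = team e r c := by
  have ha := pos_of_equiv e
  ext s
  constructor
  · rintro ⟨i, -, hb, rfl⟩
    refine ⟨i, ?_, hb, rfl⟩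
    by_contra hi
    exact hb (dig_of_lt hc (not_lt.1 hi))
  · rintro ⟨i, hi, hb, rfl⟩
    exact ⟨i, hi.trans_le (Nat.pow_le_pow_right ha hrm), hb, rfl⟩

variable (X : Finset ℕ)

/-- The variables in the domain of the team have the first slots. -/
theorem toList_idxOf_lt_iff {D : List ℕ} (hD : X.toList <+: D) {v : ℕ} :
    D.idxOf v < X.card ↔ v ∈ X := by
  rw [← Finset.length_toList, ← Finset.mem_toList]
  obtain ⟨t, rfl⟩ := hD
  constructor
  · intro h
    by_contra hv
    rw [List.idxOf_append_of_notMem hv] at h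
    omega
  · intro h
    rw [List.idxOf_append_of_mem h]
    exact List.idxOf_lt_length_iff.2 h

theorem injOn_idxOf (D : List ℕ) : Set.InjOn (D.idxOf ·) (D.toFinset : Set ℕ) := by
  intro x hx y _ h
  exact (List.idxOf_inj (by simpa using hx)).1 h

theorem store_congr {σ σ' : ℕ → ℕ} {Y : Finset ℕ} (h : ∀ x ∈ Y, σ x = σ' x) (s : Y → A) :
    store σ s = store σ' s := by
  unfold store
  have : ∀ (x : Y), σ x = σ' x := fun x => h x x.2
  simp only [this]

/-- A code of the given team that works for every number of slots: the unused slots contain the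
default value, whose number is `0`, and leading digits `0` do not change a number. -/
theorem exists_teamCode (e : A ≃ Fin a) (he : (e (Classical.arbitrary A) : ℕ) = 0)
    (T : Set (X → A)) : ∃ τ < 2 ^ a ^ X.card, ∀ D : List ℕ, X.toList <+: D → ∀ m, X.card ≤ m →
      team e m τ = store (D.idxOf ·) '' T := by
  obtain ⟨τ, hτ, h⟩ := exists_team_eq e (m := X.card) (store (X.toList.idxOf ·) '' T) (by
    rintro _ ⟨s, -, rfl⟩
    refine exists_dec_eq e _ fun y hy => ?_
    rw [store, dif_neg]
    · rw [Equiv.eq_symm_apply]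
      exact Fin.ext he
    · rintro ⟨x, rfl⟩
      have := (toList_idxOf_lt_iff X List.prefix_rfl).2 x.2
      omega)
  refine ⟨τ, hτ, fun D hD m hm => ?_⟩
  rw [team_eq_of_le e hm hτ, h]
  congr 1
  funext s
  exact store_congr (fun x hx => (idxOf_eq_of_prefix hD (by simpa using hx)).symm) s

variable [L.Structure A]

variable {X} in
theorem holds_opFinal_iff {e : A ≃ Fin a} {T : Set (X → A)} {τ m k : ℕ}
    (hτ : τ < 2 ^ a ^ X.card)
    (hT : ∀ D : List ℕ, X.toList <+: D → ∀ m, X.card ≤ m → team e m τ = store (D.idxOf ·) '' T)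
    (hm : X.card + k ≤ m) {φ : DFormula L} {s : PState L} {w : List (Letter L)}
    (hs : parse k X.toList w = some s) (hφ : s.seen.toFinset = φ.vars) {x y : ℕ}
    (hx : RepFml e m (s.dict.idxOf ·) φ x) :
    (opFinal τ X.card).Holds [m, x, y] ↔ φ.free ⊆ X ∧ Sat φ X T := by
  have hwf := wf_of_parse hs
  have hvars : φ.vars ⊆ s.dict.toFinset := fun v hv => by
    rw [List.mem_toFinset, hwf.3]
    rw [← hφ, List.mem_toFinset] at hv
    exact .inr hv
  have hX : X ⊆ s.dict.toFinset := fun v hv => by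
    rw [List.mem_toFinset, hwf.3]
    exact .inl (by simpa using hv)
  have hlen : s.dict.length ≤ m := by
    have := hwf.1
    have := hwf.2
    rw [Finset.length_toList] at this
    omega
  rw [hx.final (hτ.trans_le (Nat.pow_le_pow_right two_pos (Nat.pow_le_pow_right (pos_of_equiv e)
    (by omega)))) fun v hv => (List.idxOf_lt_length_iff.2
      (List.mem_toFinset.1 (hvars (free_subset_vars φ hv)))).trans_le hlen,
    hT _ hwf.4 m (by omega), ← sat_iff_satS (injOn_idxOf s.dict) φ X T hvars hX, and_comm]
  exact and_congr_left fun _ => forall₂_congr fun v _ => toList_idxOf_lt_iff X hwf.4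

variable {X} in
/-- Correctness of the machine: it accepts exactly the formulas with at most `k` variables, or with
exactly `k` variables if `exact` is set, that the team satisfies. -/
theorem accepts_iff {e : A ≃ Fin a} {T : Set (X → A)} {τ m k q : ℕ}
    (hτ : τ < 2 ^ a ^ X.card)
    (hT : ∀ D : List ℕ, X.toList <+: D → ∀ m, X.card ≤ m → team e m τ = store (D.idxOf ·) '' T)
    (hq : 2 ≤ q) (hqf : ∀ n, L.Functions n → n ≤ q) (hqR : ∀ n, L.Relations n → n ≤ q)
    (hm : X.card + k ≤ m) (exact : Bool) (w : List (Letter L)) :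
    (∃ c, confRun a q m (symTable e) (eqTable e) w.reverse
        ⟨k, [], [], X.toList.map encodeNat, []⟩ = some c ∧ c.Accepts m exact (opFinal τ X.card)) ↔
      ∃ Φ : DFormula L, w = encodeFormula Φ ∧ (Φ.vars.card ≤ k ∧ (exact = true → k = Φ.vars.card)) ∧
        Φ.free ⊆ X ∧ Sat Φ X T := by
  constructor
  · rintro ⟨c, hc, hb, hbud, ⟨t, x, hvals, ht, hx⟩⟩
    cases hs : parse k X.toList w with
    | none =>
      rw [confRun_of_parse_eq_none hq hqf hqR (by simpa using hm) hs] at hc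
      simp at hc
    | some s =>
      have hwf := wf_of_parse hs
      have hlen : s.dict.length ≤ m := by
        have := hwf.1
        have := hwf.2
        rw [Finset.length_toList] at this
        omega
      obtain ⟨c', hc', hsim⟩ := confRun_of_parse (e := e) hq hqf hqR hlen hs List.prefix_rfl
      obtain rfl : c = c' := by simpa [hc] using hc'
      obtain ⟨h1, h2, h3, h4, h5⟩ := hsim
      rw [hvals] at h5
      obtain ⟨o, os, ho, hnil, hobjs⟩ := List.forall₂_cons_right_iff.1 h5
      obtain rfl := List.forall₂_nil_right_iff.1 hnil
      rcases ho.formula with ⟨φ, hφ, -, hr⟩ | ⟨-, hno⟩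
      · obtain ⟨hw, hnd, hv⟩ := eq_encodeFormula_of_parse hs (h1 ▸ hb) hobjs hφ
        have hcard : s.seen.length = φ.vars.card := by
          rw [← hv, List.toFinset_card_of_nodup hnd]
        refine ⟨φ, hw, ⟨by omega, fun h => ?_⟩, (holds_opFinal_iff hτ hT hm hs hv hr).1 hx⟩
        have := hbud h
        omega
      · rw [hno] at ht
        simp at ht
  · rintro ⟨φ, rfl, ⟨hk, hex⟩, hφ⟩
    obtain ⟨s, hs, hb, hobjs, hnd, hv⟩ := exists_parse_encodeFormula X.toList hk
    have hwf := wf_of_parse hs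
    have hlen : s.dict.length ≤ m := by
      have := hwf.1
      have := hwf.2
      rw [Finset.length_toList] at this
      omega
    obtain ⟨c, hc, h1, h2, h3, h4, h5⟩ := confRun_of_parse (e := e) hq hqf hqR hlen hs List.prefix_rfl
    rw [hobjs] at h5
    obtain ⟨⟨t, x⟩, vs, ho, hnil, hvals⟩ := List.forall₂_cons_left_iff.1 h5
    obtain rfl := List.forall₂_nil_left_iff.1 hnil
    have hcard : s.seen.length = φ.vars.card := by
      rw [← hv, List.toFinset_card_of_nodup hnd]
    refine ⟨c, hc, h1.trans hb, fun h => ?_, t, x, hvals, ?_⟩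
    · have := hex h
      omega
    · rcases ho.formula with ⟨φ', hφ', ht, hr⟩ | ⟨hno, -⟩
      · rw [Obj.fml?_ofFml, Option.some.injEq] at hφ'
        subst hφ'
        exact ⟨ht, (holds_opFinal_iff hτ hT hm hs hv hr).2 hφ⟩
      · simp at hno

end Acceptance

/-! ### Bounds -/

section Bounds

variable {a q : ℕ}

theorem eval_codeBound (a q m : ℕ) : (codeBound a q).eval [m] =
    ((a ^ q) ^ a ^ m + 2 ^ 2 ^ a ^ m + 2 ^ (a ^ m * a ^ m)) * 2 ^ m + (m + 1) := by
  simp [codeBound, numAsg, numTeam]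

theorem le_codeBound (a q m : ℕ) : m + 1 ≤ (codeBound a q).eval [m] := by
  rw [eval_codeBound]
  omega

theorem eval_table_le_codeBound {w B : NExp} (g g' : NExp) {m x y : ℕ}
    (h : 0 < B.eval [m, x, y] ∧ (B.eval [m, x, y] ^ w.eval [m, x, y] ≤ (a ^ q) ^ a ^ m ∨
      B.eval [m, x, y] ^ w.eval [m, x, y] ≤ 2 ^ 2 ^ a ^ m ∨
      B.eval [m, x, y] ^ w.eval [m, x, y] ≤ 2 ^ (a ^ m * a ^ m))) :
    (table w B g g').eval [m, x, y] ≤ (codeBound a q).eval [m] := by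
  refine (eval_table_le w B g g' m [x, y] h.1).trans ?_
  rw [eval_codeBound]
  refine (Nat.mul_le_mul_right _ ?_).trans (Nat.le_add_right _ _)
  obtain ⟨-, h | h | h⟩ := h
  · exact (h.trans (Nat.le_add_right _ _)).trans (Nat.le_add_right _ _)
  · exact (h.trans (Nat.le_add_left _ _)).trans (Nat.le_add_right _ _)
  · exact h.trans (Nat.le_add_left _ _)

theorem eval_le_codeBound {L : FirstOrder.Language.{0, 0}} {F : L.Symbols → ℕ → ℕ} {E : ℕ → ℕ}
    (ha : 0 < a) {e : NExp} (he : e ∈ ops a q F E) (m x y : ℕ) :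
    e.eval [m, x, y] ≤ (codeBound a q).eval [m] := by
  rcases he with (he | ⟨s, rfl⟩) | ⟨s, rfl⟩
  · simp only [Set.mem_insert_iff, Set.mem_singleton_iff] at he
    rcases he with rfl | rfl | rfl | rfl | rfl | rfl | rfl | rfl | rfl | rfl | rfl <;>
    exact eval_table_le_codeBound _ _ (by simp [numAsg, numTeam, ha])
  · exact eval_table_le_codeBound _ _ (by simp [numAsg, ha])
  · exact eval_table_le_codeBound _ _ (by simp [numAsg, numTeam])

theorem eval_opFinal_le (τ r : ℕ) (l : List ℕ) : (opFinal τ r).eval l ≤ 1 := by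
  rw [opFinal, eval_ind]
  split_ifs <;> omega

/-- A bound for the size of the stacks and the cost of the operations `es`, up to a factor linear in
the length of the word; `D` is the length of the list of the variables of the team as a word. -/
noncomputable def stepBound (a q D : ℕ) (es : List NExp) (m : ℕ) : ℕ :=
  (codeBound a q).eval [m] + (es.map fun e => e.totalCost m ((codeBound a q).eval [m])).sum +
    2 * m + (D + 5)

theorem primrec_list_sum {ι : Type*} (l : List ι) {f : ι → ℕ → ℕ} (hf : ∀ i, Primrec (f i)) :
    Primrec fun m => (l.map fun i => f i m).sum := by
  induction l with
  | nil => exact Primrec.const 0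
  | cons i l ih => exact primrec_add (hf i) ih

theorem primrec_stepBound (a q D : ℕ) (es : List NExp) : Primrec (stepBound a q D es) := by
  have hB : Primrec fun m => (codeBound a q).eval [m] :=
    (primrec_eval _).comp (Primrec.list_cons.comp Primrec.id (Primrec.const []))
  exact primrec_add (primrec_add (primrec_add hB (primrec_list_sum es fun e =>
    (primrec_totalCost e).comp Primrec.id hB)) (primrec_mul_const Primrec.id 2)) (Primrec.const _)

end Bounds

/-! ### The decision procedure -/

section Procedure

variable (L : FirstOrder.Language.{0, 0}) [Finite L.Symbols] (A : Type*) [L.Structure A] [Finite A]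
  [Nonempty A] (X : Finset ℕ) (T : Set (X → A))

/-- The elements of a finite structure can be numbered in such a way that a given one gets the
number `0`. -/
theorem exists_equiv_apply_eq_zero (A : Type*) [Finite A] (x : A) :
    ∃ (a : ℕ) (e : A ≃ Fin a), (e x : ℕ) = 0 := by
  obtain ⟨a, ⟨e⟩⟩ := Finite.exists_equiv_fin A
  have ha : 0 < a := Fin.pos (e x)
  exact ⟨a, e.trans (Equiv.swap (e x) ⟨0, ha⟩), by simp⟩

theorem exists_arity_bound : ∃ q, 2 ≤ q ∧ (∀ n, L.Functions n → n ≤ q) ∧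
    ∀ n, L.Relations n → n ≤ q := by
  obtain ⟨b, hb⟩ := (Set.finite_range fun s : L.Symbols => s.elim (·.1) (·.1)).bddAbove
  refine ⟨max 2 b, le_max_left _ _, fun n f => le_max_of_le_right (hb ⟨.inl ⟨n, f⟩, rfl⟩),
    fun n R => le_max_of_le_right (hb ⟨.inr ⟨n, R⟩, rfl⟩)⟩

/-- The program reads the unary number `k` and the word, from right to left, and decides whether
the word is a formula with at most `k₀ + k` variables that holds in the team; its number of steps is
cubic in the length of the word if `k` is fixed. -/
theorem exists_prog : ∃ g : ℕ → ℕ, Primrec g ∧ ∀ (exact : Bool) (k₀ : ℕ), ∃ P : StackProg (Sym L),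
    ∀ (k : ℕ) (w : List (Letter L)), ∃ v,
      Exec P (none, update (fun _ => []) 0 (num one k ++ w.reverse.map Sum.inl)) (v, fun _ => [])
        ((w.length + 1) ^ 3 * g (k₀ + k)) ∧
      (v.isSome = true ↔ ∃ Φ : DFormula L, w = encodeFormula Φ ∧
        (Φ.vars.card ≤ k₀ + k ∧ (exact = true → k₀ + k = Φ.vars.card)) ∧ Φ.free ⊆ X ∧ Sat Φ X T) := by
  obtain ⟨a, e, he⟩ := exists_equiv_apply_eq_zero A (Classical.arbitrary A)
  obtain ⟨q, hq, hqf, hqR⟩ := exists_arity_bound L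
  obtain ⟨τ, hτ, hT⟩ := exists_teamCode X e he T
  have ha := pos_of_equiv e
  set d := X.toList.map encodeNat with hd
  set es : List NExp :=
    opFinal τ X.card :: (finite_ops a q (symTable (L := L) e) (eqTable e)).toFinset.toList with hes
  set G := stepBound a q (encWords d : List (Sym L)).length es with hG
  have hGp : Primrec G := primrec_stepBound _ _ _ _
  refine ⟨fun k => (20 * q + 800) * (G (X.card + k) * G (X.card + k)),
    primrec_mul_const (Primrec.nat_mul.comp (hGp.comp (primrec_add (Primrec.const _) Primrec.id))
      (hGp.comp (primrec_add (Primrec.const _) Primrec.id))) _, fun exact k₀ =>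
    ⟨mainProg a q (symTable e) (eqTable e) d X.card k₀ exact (opFinal τ X.card), fun k w => ?_⟩⟩
  set m := X.card + (k₀ + k) with hm
  set B := (codeBound a q).eval [m] with hB
  have hGm : G m = B + (es.map fun e => e.totalCost m B).sum + 2 * m +
    ((encWords d : List (Sym L)).length + 5) := rfl
  set n := w.length with hn
  have hGZ : G m ≤ (n + 1) * G m := Nat.le_mul_of_pos_left _ (by omega)
  have hcost : ∀ e ∈ es, ∀ x ≤ B, ∀ y ≤ B, e.cost [m, x, y] ≤ (n + 1) * G m := by
    intro e he x hx y hy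
    have h1 := cost_le_totalCost e (m := m) hx hy
    have h2 := List.single_le_sum (fun _ _ => Nat.zero_le _) _
      (List.mem_map_of_mem (f := fun e : NExp => e.totalCost m B) he)
    omega
  have hops : ∀ e' ∈ ops a q (symTable (L := L) e) (eqTable e), OpBound m B ((n + 1) * G m) e' :=
    fun e' he' x hx y hy => ⟨hcost e' (by simp [hes, he']) x hx y hy,
      eval_le_codeBound ha he' m x y⟩
  have hmB : m + 1 ≤ B := le_codeBound a q m
  have hfin : OpBound m B ((n + 1) * G m) (opFinal τ X.card) := fun x hx y hy =>
    ⟨hcost _ (by simp [hes]) x hx y hy, (eval_opFinal_le _ _ _).trans (by omega)⟩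
  obtain ⟨v, hv, hiff⟩ := exec_mainProg (n := n) hops (by omega) (by omega) hq hqf hqR hfin
    (fun x => eval_opFinal_le _ _ _) exact d X.card k₀ k (by simp [hd]) (by omega)
    (by
      have : n * (B + 4) ≤ n * G m := Nat.mul_le_mul_left _ (by omega)
      rw [add_mul, one_mul]
      have e1 : n * (B + 4) = n * (B + 1) + 3 * n := by ring
      omega) w.reverse (by simp [hn])
  refine ⟨v, ?_, hiff.trans (accepts_iff hτ hT hq hqf hqR le_rfl exact w)⟩
  have e1 : (n + 1) * ((20 * q + 800) * ((n + 1) * G m * ((n + 1) * G m))) =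
      (n + 1) ^ 3 * ((20 * q + 800) * (G m * G m)) := by ring
  rw [e1] at hv
  exact hv

theorem map_unaryEncodeNat {α : Type} (f : Bool → α) (k : ℕ) :
    (unaryEncodeNat k).map f = num (f true) k := by
  induction k with
  | zero => rfl
  | succ k ih =>
    rw [unaryEncodeNat, List.map_cons, ih]
    rfl

theorem inFPT_paramExprMC : InFPT (paramExprMC L A X T) := by
  classical
  have := finite_letter L
  obtain ⟨g, hg, h⟩ := exists_prog L A X T
  obtain ⟨P, hP⟩ := h true 0
  obtain ⟨M, hM⟩ := exists_machine (Sum.elim Sum.inl fun _ => one : Letter L ⊕ Bool → Sym L) P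
  refine ⟨M, fun k => g k + k + 2, (Polynomial.X + 1) ^ 3,
    (primrec_add (primrec_add hg Primrec.id) (Primrec.const 2)).to_comp, fun w k => ?_⟩
  obtain ⟨v, hv, hiff⟩ := hP k w
  rw [zero_add] at hv hiff
  have hinp : ((encodeInstance w k).map (Sum.elim Sum.inl fun _ => one : Letter L ⊕ Bool → Sym L)).reverse =
      num one k ++ w.reverse.map Sum.inl := by
    simp [encodeInstance, Function.comp_def, map_unaryEncodeNat, num]
  have hlen : (encodeInstance w k).length = w.length + k := by
    have : ∀ k, (unaryEncodeNat k).length = k := fun k => by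
      induction k with
      | zero => rfl
      | succ k ih => rw [unaryEncodeNat, List.length_cons, ih]
    simp [encodeInstance, this]
  have hdec : v.isSome = decide ((w, k) ∈ paramExprMC L A X T) := by
    rw [Bool.eq_iff_iff, hiff, decide_eq_true_iff]
    refine exists_congr fun Φ => and_congr_right fun _ => and_congr_left fun _ => ?_
    exact ⟨fun h => h.2 rfl, fun h => ⟨h.ge, fun _ => h⟩⟩
  obtain ⟨hM⟩ := hM (encodeInstance w k) v _ (by rw [hinp]; exact hv)
  rw [hdec, hlen] at hM
  refine ⟨⟨hM.toEvalsTo, hM.steps_le_m.trans ?_⟩⟩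
  rw [Polynomial.eval_pow, Polynomial.eval_add, Polynomial.eval_X, Polynomial.eval_one]
  -- the time for reading the input is absorbed into the product
  have h1 : w.length + 1 ≤ (w.length + 1) ^ 3 := Nat.le_self_pow (by norm_num) _
  have h2 : (w.length + 1) * (k + 2) ≤ (w.length + 1) ^ 3 * (k + 2) := Nat.mul_le_mul_right _ h1
  have h3 : w.length + k + 2 ≤ (w.length + 1) * (k + 2) := by nlinarith
  calc (w.length + 1) ^ 3 * g k + (w.length + k) + 2
      ≤ (w.length + 1) ^ 3 * g k + (w.length + 1) ^ 3 * (k + 2) := by omega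
    _ = (g k + k + 2) * (w.length + 1) ^ 3 := by ring

theorem inP_exprMC (k : ℕ) : InP (exprMC L A X T k) := by
  classical
  have := finite_letter L
  obtain ⟨g, -, h⟩ := exists_prog L A X T
  obtain ⟨P, hP⟩ := h false k
  obtain ⟨M, hM⟩ := exists_machine (Sum.inl : Letter L → Sym L) P
  have key : ∀ w : List (Letter L), Nonempty (Turing.TM2OutputsInTime M.tm
      (w.map M.inputAlphabet.invFun)
      (some ((encodeBool (decide (w ∈ exprMC L A X T k))).map M.outputAlphabet.invFun))
      (((Polynomial.X + 1) ^ 3 * Polynomial.C (g k) + Polynomial.X + 2 : Polynomial ℕ).eval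
        w.length)) := by
    intro w
    obtain ⟨v, hv, hiff⟩ := hP 0 w
    have hdec : v.isSome = decide (w ∈ exprMC L A X T k) := by
      rw [Bool.eq_iff_iff, hiff, decide_eq_true_iff]
      refine exists_congr fun Φ => and_congr_right fun _ => and_congr_left fun _ => ?_
      simp
    obtain ⟨hM⟩ := hM w v _ (by simpa [num] using hv)
    rw [hdec] at hM
    refine ⟨⟨hM.toEvalsTo, hM.steps_le_m.trans (le_of_eq ?_)⟩⟩
    simp
  exact ⟨{ M with time := _, outputsFun := fun w => (key w).some }⟩

end Procedure

end DependenceLogic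

theorem mainTheorem1 (L : FirstOrder.Language.{0, 0}) [Finite L.Symbols] (A : Type*) [L.Structure A]
    [Finite A] [Nonempty A] (X : Finset ℕ) (T : Set (X → A)) :
    DependenceLogic.InFPT (DependenceLogic.paramExprMC L A X T) ∧
      ∀ k : ℕ, 1 ≤ k → DependenceLogic.InP (DependenceLogic.exprMC L A X T k) :=
  ⟨DependenceLogic.inFPT_paramExprMC L A X T, fun k _ => DependenceLogic.inP_exprMC L A X T k⟩
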